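/- Let $d\in\mathbb N$, $\mathbb T^d=(\mathbb R/\mathbb Z)^d$ with its normalised Lebesgue measure, and let $K:\mathbb T^d\times\mathbb T^d\to\mathbb R^d$ be continuous with summable Fourier coefficients, $\sum_{\lambda,\eta\in\mathbb Z^d}|\hat K(\lambda,\eta)|<\infty$. Then there is a constant $C=C(K)\ge 0$, depending only on $K$ (and $d$), such that the following holds for every $\sigma>C$, every probability density $\rho_0\in L^2(\mathbb T^d)$ and every integer $N\ge 1$. Let $X_t=(X_t^1,\dots,X_t^N)$, $t\ge 0$, be any weak solution on $(\mathbb T^d)^N$ (on some filtered probability space, with continuous adapted paths) of $$\mathrm dX_t^i=\frac1N\sum_{j=1}^N K(X_t^i,X_t^j)\,\mathrm dt+\sqrt{2\sigma}\,\mathrm dW_t^i,\qquad i=1,\dots,N,$$ where $W^1,\dots,W^N$ are independent standard $d$-dimensional Brownian motions with respect to the filtration and $X_0^1,\dots,X_0^N$ are independent with common density $\rho_0$, and let $\mu_N^t=\frac1N\sum_{i=1}^N\delta_{X_t^i}$ be the empirical measure. For a bounded real random variable $Y$ let $$\kappa_m(Y)=(-i)^m\frac{\mathrm d^m}{\mathrm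 du^m}\log\mathbb E\,e^{iuY}\Big|_{u=0}$$ denote its $m$-th cumulant. Then for every real-valued $\phi\in C^\infty(\mathbb T^d)$, every $t\ge0$ and every integer $m\ge1$, $$\left|\kappa_m\!\left[\int\phi\,\mathrm d\mu_N^t\right]\right|\le\frac{\big(8\|\hat\phi\|_{l^1}\big)^m\,(m!)^4}{N^{m-1}},\qquad \|\hat\phi\|_{l^1}=\sum_{k\in\mathbb Z^d}|\hat\phi(k)|.$$ -/

import Mathlib

open MeasureTheory ProbabilityTheory
open scoped NNReal ENNReal

namespace MeanField

noncomputable section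

/-- The flat torus `𝕋^d = (ℝ/ℤ)^d`. -/
abbrev Torus (d : ℕ) : Type := UnitAddTorus (Fin d)

/-- The projection `ℝ^d → 𝕋^d`. -/
def toTorus {d : ℕ} (v : Fin d → ℝ) : Torus d := fun k => (v k : UnitAddCircle)

/-- The normalised Haar (Lebesgue) measure on `𝕋^d`, of total mass one. -/
def torusMeasure (d : ℕ) : Measure (Torus d) :=
  Measure.pi fun _ => AddCircle.haarAddCircle

/-- The vector-valued Fourier coefficient `K̂(λ, η) ∈ ℂ^d` of a kernel `K : 𝕋^d × 𝕋^d → ℝ^d`. A pair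
of points (of frequencies) is encoded as a point (a frequency) indexed by `Fin d ⊕ Fin d`. -/
def kernelFourierCoeff {d : ℕ} (K : Torus d → Torus d → EuclideanSpace ℝ (Fin d))
    (lam eta : Fin d → ℤ) : EuclideanSpace ℂ (Fin d) :=
  WithLp.toLp 2 fun j =>
    UnitAddTorus.mFourierCoeff
      (fun z : UnitAddTorus (Fin d ⊕ Fin d) =>
        ((K (fun k => z (Sum.inl k)) (fun k => z (Sum.inr k)) j : ℝ) : ℂ))
      (Sum.elim lam eta)

/-- `‖φ̂‖_{l¹} = ∑_{k ∈ ℤ^d} |φ̂(k)|`. -/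
def fourierL1Norm {d : ℕ} (φ : Torus d → ℝ) : ℝ :=
  ∑' k : Fin d → ℤ, ‖UnitAddTorus.mFourierCoeff (fun x : Torus d => ((φ x : ℝ) : ℂ)) k‖

/-- `φ ∈ C^∞(𝕋^d)`: the periodic lift of `φ` to `ℝ^d` is smooth. -/
def IsSmoothOnTorus {d : ℕ} (φ : Torus d → ℝ) : Prop :=
  ContDiff ℝ (⊤ : ℕ∞) fun v : Fin d → ℝ => φ (toTorus v)

/-- `W` is a family of `N` independent standard `d`-dimensional Brownian motions relative to the
filtration `ℱ`: the coordinates are independent real Brownian motions, `W` is adapted, and the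
increments after time `s` are independent of `ℱ s`. -/
structure IsBrownianFamily {d N : ℕ} {Ω : Type*} {mΩ : MeasurableSpace Ω} (P : Measure Ω)
    (ℱ : Filtration ℝ≥0 mΩ) (W : ℝ≥0 → Ω → Fin N → EuclideanSpace ℝ (Fin d)) : Prop where
  brownian : ∀ (i : Fin N) (k : Fin d), IsBrownianReal (fun t ω => W t ω i k) P
  indep : iIndepFun (fun (p : Fin N × Fin d) (ω : Ω) (t : ℝ≥0) => W t ω p.1 p.2) P
  adapted : Adapted ℱ W
  indep_past : ∀ s t : ℝ≥0, s ≤ t →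
    Indep (MeasurableSpace.comap (fun ω => W t ω - W s ω) inferInstance) (ℱ s) P

/-- `(X, W)` is a (weak) solution, on the filtered probability space `(Ω, ℱ, P)`, of
`dXⁱ = (1/N) ∑ⱼ K(Xⁱ, Xʲ) dt + √(2σ) dWⁱ`, `i = 1, …, N`, on the torus `𝕋^d`,
whose initial positions `X₀ⁱ` are i.i.d. with density `ρ₀`. -/
structure IsParticleSystem {d N : ℕ} {Ω : Type*} {mΩ : MeasurableSpace Ω}
    (K : Torus d → Torus d → EuclideanSpace ℝ (Fin d)) (σ : ℝ) (ρ₀ : Torus d → ℝ)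
    (P : Measure Ω) (ℱ : Filtration ℝ≥0 mΩ)
    (W : ℝ≥0 → Ω → Fin N → EuclideanSpace ℝ (Fin d))
    (X : ℝ≥0 → Ω → Fin N → Torus d) : Prop where
  brownian : IsBrownianFamily P ℱ W
  adapted : Adapted ℱ X
  continuous_paths : ∀ᵐ ω ∂P, Continuous fun t => X t ω
  initial_law : ∀ i : Fin N, P.map (fun ω => X 0 ω i) =
    (torusMeasure d).withDensity fun x => ENNReal.ofReal (ρ₀ x)
  initial_indep : iIndepFun (fun (i : Fin N) (ω : Ω) => X 0 ω i) P
  sde : ∀ᵐ ω ∂P, ∀ (t : ℝ≥0) (i : Fin N),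
    X t ω i = X 0 ω i + toTorus (WithLp.ofLp
      ((∫ s in (0 : ℝ)..t, (N : ℝ)⁻¹ • ∑ j : Fin N, K (X s.toNNReal ω i) (X s.toNNReal ω j))
        + Real.sqrt (2 * σ) • W t ω i))

/-- The empirical measure `(1/N) ∑ᵢ δ_{xᵢ}`. -/
def empiricalMeasure {d N : ℕ} (x : Fin N → Torus d) : Measure (Torus d) :=
  (N : ℝ≥0∞)⁻¹ • ∑ i : Fin N, Measure.dirac (x i)

/-- The `m`-th cumulant `κ_m(Y) = (-i)^m (d/du)^m log 𝔼[e^{iuY}]` at `u = 0`. -/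
def cumulant {Ω : Type*} {mΩ : MeasurableSpace Ω} (P : Measure Ω) (Y : Ω → ℝ) (m : ℕ) : ℂ :=
  (-Complex.I) ^ m * iteratedDeriv m (fun u : ℝ => Complex.log (charFun (P.map Y) u)) 0

end

end MeanField

/-! Take the exponentials `expo l` on configuration space and let M_t(l) be their expectations. The
product of exponentials is an exponential, so every joint moment is some M_t(l), and the joint
cumulants are the formal logarithm `kap (mom M)` of the moments, functions on multisets being
treated as formal power series. The dynamics is linear on M: diffusion multiplies by a quadratic
form -B(l,l), and the drift adds terms w_q(l) M(l + τ_q) with w_q additive in l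
(`IsParticleSystem.hasDerivWithinAt_fourierMoment`, `IsParticleSystem.integral_drift`).

Because B is bilinear and w_q additive, the cumulants obey a linear hierarchy (`conv_hierarchyRHS`,
`hasDerivWithinAt_kap`). Each argument a is damped at rate B(a,a); a drift term replaces one
argument a by a + τ_q and keeps the order; the off-diagonal part of B merges two arguments with a
common particle and lowers the order by one. No products of cumulants appear.

The decay in N is carried by a combinatorial weight. Particles in a set U carry labels, each
argument lives on particles of a single label, and a cumulant with c labels should be at most b
(|U|/N)^(c-1). Merging preserves the number of labels (`LabelBound.merge`). An interaction with a
particle outside U enlarges U by one, at bounded cost; one with a particle of U may lose a label,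
hence a factor |U|/N, but only a fraction |U|/N of all particles is of this kind
(`LabelBound.interaction`, `sum_interactionBound_le`). So the interaction preserves the weight up to
a factor 4. Since nonzero integer frequencies satisfy |n| ≤ n², first-order terms are dominated by
the diffusion when σ is large, uniformly in time (`norm_hierarchyRHS_add_le`, `norm_le_of_damped`).
Initially, cumulants mixing independent groups vanish (`kap_eq_zero_of_factor`), and a bootstrap
from a crude bound gives constants free of N and t (`IsMeanFieldEvolution.labelBound`).

Finally the linear statistic is an absolutely convergent combination of one-particle exponentials.
Cumulants are multilinear (`contract_kap`), and summing the weighted bounds over all choices of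
particles yields the power of N (`norm_contract_siteFreq_le`, `norm_contract_kap_le`).
`cumulant_eq_kap` matches the formal cumulants with derivatives of the logarithm of the
characteristic function. -/

namespace MeanField

/-! ### The Hurwitz algebra of functions on multisets -/

section Hurwitz

variable {α : Type*}

/-- The Hurwitz (shuffle) product of two functions on multisets. -/
noncomputable def conv (f g : Multiset α → ℂ) (s : Multiset α) : ℂ :=
  (s.antidiagonal.map fun p => f p.1 * g p.2).sum

/-- The partial derivative `∂_a f` of a function on multisets. -/
def shift (a : α) (f : Multiset α → ℂ) : Multiset α → ℂ := fun s => f (a ::ₘ s)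

lemma conv_zero_apply (f g : Multiset α → ℂ) : conv f g 0 = f 0 * g 0 := by
  simp [conv]

lemma conv_cons (f g : Multiset α → ℂ) (a : α) (s : Multiset α) :
    conv f g (a ::ₘ s) = conv f (shift a g) s + conv (shift a f) g s := by
  simp [conv, shift, Multiset.antidiagonal_cons, Multiset.map_map]

lemma shift_conv (f g : Multiset α → ℂ) (a : α) :
    shift a (conv f g) = conv f (shift a g) + conv (shift a f) g := by
  funext s; exact conv_cons f g a s

lemma conv_add_left (f f' g : Multiset α → ℂ) : conv (f + f') g = conv f g + conv f' g := by
  funext s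
  simp [conv, add_mul]

lemma conv_add_right (f g g' : Multiset α → ℂ) : conv f (g + g') = conv f g + conv f g' := by
  funext s
  simp [conv, mul_add]

lemma conv_smul_left (c : ℂ) (f g : Multiset α → ℂ) : conv (c • f) g = c • conv f g := by
  funext s
  simp [conv, mul_assoc, Multiset.sum_map_mul_left]

lemma conv_sub_left (f f' g : Multiset α → ℂ) : conv (f - f') g = conv f g - conv f' g := by
  have h := conv_smul_left (-1) f' g
  rw [sub_eq_add_neg, conv_add_left, show -f' = (-1 : ℂ) • f' by simp, h]
  simp [sub_eq_add_neg]

lemma conv_comm (f g : Multiset α → ℂ) : conv f g = conv g f := by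
  funext s
  induction s using Multiset.induction_on generalizing f g with
  | empty => simp [conv_zero_apply, mul_comm]
  | cons a s ih => rw [conv_cons, conv_cons, ih, ih (shift a f), add_comm]

lemma conv_assoc (f g h : Multiset α → ℂ) : conv (conv f g) h = conv f (conv g h) := by
  funext s
  induction s using Multiset.induction_on generalizing f g h with
  | empty => simp [conv_zero_apply, mul_assoc]
  | cons a s ih =>
    simp only [conv_cons, shift_conv, conv_add_left, conv_add_right, Pi.add_apply, ih]
    ring

lemma conv_congr {f f' g g' : Multiset α → ℂ} {s : Multiset α}
    (h : ∀ t u, t + u = s → f t * g u = f' t * g' u) : conv f g s = conv f' g' s := by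
  unfold conv
  congr 1
  exact Multiset.map_congr rfl fun p hp => h _ _ (Multiset.mem_antidiagonal.1 hp)

lemma conv_eq_zero {f g : Multiset α → ℂ} {s : Multiset α}
    (h : ∀ t u, t + u = s → f t * g u = 0) : conv f g s = 0 := by
  unfold conv
  refine Multiset.sum_eq_zero fun x hx => ?_
  obtain ⟨p, hp, rfl⟩ := Multiset.mem_map.1 hx
  exact h _ _ (Multiset.mem_antidiagonal.1 hp)

/-- If `f` vanishes on multisets smaller than `s`, only one term of the product survives. -/
lemma conv_eq_top {f : Multiset α → ℂ} (g : Multiset α → ℂ) {s : Multiset α}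
    (h : ∀ t, t.card < s.card → f t = 0) : conv f g s = f s * g 0 := by
  induction s using Multiset.induction_on generalizing f with
  | empty => exact conv_zero_apply f g
  | cons a s ih =>
    rw [conv_cons, ih (f := shift a f), conv_eq_zero, zero_add]
    · rfl
    · rintro t u rfl
      rw [h t (by simp), zero_mul]
    · intro t ht
      exact h _ (by simpa using ht)

/-- A series with constant term 1 cannot annihilate the lowest-degree part of `f`, so it may be
cancelled. -/
lemma eq_zero_of_conv_eq_zero {f g : Multiset α → ℂ} (hg : g 0 = 1) (h : conv f g = 0) :
    f = 0 := by
  funext s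
  induction hn : s.card using Nat.strong_induction_on generalizing s with
  | _ n ih =>
    have h1 := congrFun h s
    rw [conv_eq_top g (fun t ht => ih _ (hn ▸ ht) t rfl), hg, mul_one] at h1
    exact h1

/-! ### The Euler derivation and the formal logarithm. -/

/-- The Euler derivation. -/
noncomputable def euler (f : Multiset α → ℂ) : Multiset α → ℂ := fun s => s.card * f s

lemma euler_conv (f g : Multiset α → ℂ) :
    euler (conv f g) = conv (euler f) g + conv f (euler g) := by
  funext s
  simp only [euler, conv, Pi.add_apply, ← Multiset.sum_map_mul_left, ← Multiset.sum_map_add]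
  congr 1
  refine Multiset.map_congr rfl fun p hp => ?_
  rw [← Multiset.mem_antidiagonal.1 hp, Multiset.card_add]
  push_cast
  ring

lemma shift_euler (f : Multiset α → ℂ) (a : α) :
    shift a (euler f) = euler (shift a f) + shift a f := by
  funext s
  simp [shift, euler]
  ring

/-- The joint cumulants (formal logarithm) of the joint moments `μ`. -/
noncomputable def kap (μ : Multiset α → ℂ) (s : Multiset α) : ℂ :=
  (s.card : ℂ)⁻¹ * (s.card * μ s - (s.antidiagonal.map fun p =>
    if _ : p.1.card < s.card then p.1.card * kap μ p.1 * μ p.2 else 0).sum)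
termination_by s.card

lemma kap_zero (μ : Multiset α → ℂ) : kap μ 0 = 0 := by
  rw [kap]; simp

lemma kap_unfold (μ : Multiset α → ℂ) (s : Multiset α) :
    kap μ s = (s.card : ℂ)⁻¹ * (s.card * μ s -
      conv (fun t => if t.card < s.card then euler (kap μ) t else 0) μ s) := by
  rw [kap]
  congr 3
  refine Multiset.map_congr rfl fun p _ => ?_
  by_cases h : p.1.card < s.card <;> simp [h, euler]

/-- This is E(log μ) · μ = Eμ. The recursion defining `kap` is this identity solved for its top
term, which is possible since the constant term of μ is 1. -/
lemma euler_kap {μ : Multiset α → ℂ} (h0 : μ 0 = 1) : conv (euler (kap μ)) μ = euler μ := by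
  funext s
  rcases eq_or_ne s 0 with rfl | hs
  · simp [conv_zero_apply, euler]
  have hc : (s.card : ℂ) ≠ 0 := by simpa using hs
  have hsplit : euler (kap μ) = (fun t => if t.card < s.card then euler (kap μ) t else 0) +
      fun t => if t.card < s.card then 0 else euler (kap μ) t := by
    funext t
    by_cases h : t.card < s.card <;> simp [h]
  rw [hsplit, conv_add_left, Pi.add_apply, conv_eq_top (s := s) (f := fun t => if t.card < s.card
    then 0 else euler (kap μ) t) μ (fun t ht => by simp [ht])]
  simp only [lt_irrefl, if_false, h0, mul_one]
  have := kap_unfold μ s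
  rw [eq_inv_mul_iff_mul_eq₀ hc] at this
  simp only [euler] at this ⊢
  rw [this]
  ring

/-- The Euler identity determines all partial derivatives: the defect h = ∂_a μ - (∂_a κ)μ satisfies
(E + 1)h = (Eκ)h. As Eκ has no constant term, the right side in each degree involves only lower
degrees of h, so h = 0. -/
lemma conv_shift_kap {μ : Multiset α → ℂ} (h0 : μ 0 = 1) (a : α) :
    conv (shift a (kap μ)) μ = shift a μ := by
  set κ := kap μ with hκ
  set h : Multiset α → ℂ := shift a μ - conv (shift a κ) μ with hh
  have hE := euler_kap h0
  rw [← hκ] at hE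
  have h1 : euler h + h = conv (euler κ) h := by
    have e1 := shift_euler μ a
    rw [← hE, shift_conv, shift_euler, conv_add_left] at e1
    have e2 := euler_conv (shift a κ) μ
    rw [← hE, ← conv_assoc, conv_comm (shift a κ) (euler κ), conv_assoc] at e2
    have e3 : conv (euler κ) h = conv (euler κ) (shift a μ) -
        conv (euler κ) (conv (shift a κ) μ) := by
      rw [conv_comm, hh, conv_sub_left, conv_comm _ (euler κ), conv_comm _ (euler κ)]
    have e4 : euler h = euler (shift a μ) - euler (conv (shift a κ) μ) := by
      funext s; simp [euler, hh, mul_sub]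
    rw [e3, e4, e2, hh]
    have e5 : euler (shift a μ) + shift a μ = conv (euler κ) (shift a μ) +
      (conv (euler (shift a κ)) μ + conv (shift a κ) μ) := e1.symm
    have e6 := eq_sub_of_add_eq e5
    rw [e6]
    abel
  suffices h = 0 from (sub_eq_zero.1 this).symm
  funext s
  induction hn : s.card using Nat.strong_induction_on generalizing s with
  | _ n ih =>
    have h2 := congrFun h1 s
    rw [conv_eq_zero] at h2
    · simp only [Pi.add_apply, euler] at h2
      have h3 : ((s.card : ℂ) + 1) * h s = 0 := by rw [← h2]; ring
      exact (mul_eq_zero.1 h3).resolve_left (Nat.cast_add_one_ne_zero _)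
    · rintro t u rfl
      rcases eq_or_ne t 0 with rfl | ht
      · simp [euler]
      · have := Multiset.card_pos.2 ht
        rw [ih u.card (by rw [← hn, Multiset.card_add]; omega) u rfl]
        simp

/-- The tool for recognising a formal logarithm. It serves for contractions of cumulants and for
jets of the complex logarithm. -/
lemma kap_unique {μ κ : Multiset α → ℂ} (h0 : μ 0 = 1) (hκ0 : κ 0 = 0)
    (h : ∀ a, conv (shift a κ) μ = shift a μ) : κ = kap μ := by
  have h1 : ∀ a, shift a κ = shift a (kap μ) := fun a => by
    refine sub_eq_zero.1 (eq_zero_of_conv_eq_zero h0 ?_)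
    rw [conv_sub_left, h, conv_shift_kap h0, sub_self]
  funext s
  induction s using Multiset.induction_on with
  | empty => rw [hκ0, kap_zero]
  | cons a s _ => exact congrFun (h1 a) s

/-- A class of functions of time closed under the algebraic operations and containing all joint
moments contains all joint cumulants. -/
lemma kap_mem_of_closed {μ : ℝ → Multiset α → ℂ} (p : (ℝ → ℂ) → Prop)
    (hconst : ∀ c : ℂ, p fun _ => c) (hadd : ∀ f g, p f → p g → p fun t => f t + g t)
    (hmul : ∀ f g, p f → p g → p fun t => f t * g t) (h : ∀ s, p fun t => μ t s)
    (s : Multiset α) : p fun t => kap (μ t) s := by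
  induction hn : s.card using Nat.strong_induction_on generalizing s with
  | _ n ih =>
    have hsum : ∀ m : Multiset (Multiset α × Multiset α), p fun t => (m.map fun q =>
        if _ : q.1.card < s.card then q.1.card * kap (μ t) q.1 * μ t q.2 else 0).sum := by
      intro m
      induction m using Multiset.induction_on with
      | empty => simpa using hconst 0
      | cons q m hm =>
        simp only [Multiset.map_cons, Multiset.sum_cons]
        refine hadd _ _ ?_ hm
        by_cases hq : q.1.card < s.card
        · simp only [hq, dite_true]
          exact hmul _ _ (hmul _ _ (hconst _) (ih _ (hn ▸ hq) _ rfl)) (h _)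
        · simpa [hq] using hconst 0
    have heq : (fun t => kap (μ t) s) = fun t => (s.card : ℂ)⁻¹ * (s.card * μ t s + (-1) *
        (s.antidiagonal.map fun q => if _ : q.1.card < s.card then
          q.1.card * kap (μ t) q.1 * μ t q.2 else 0).sum) := by
      funext t
      rw [kap]
      ring
    rw [heq]
    exact hmul _ _ (hconst _) (hadd _ _ (hmul _ _ (hconst _) (h s))
      (hmul _ _ (hconst _) (hsum _)))

lemma hasSum_conv_left {ι : Type*} {F : ι → Multiset α → ℂ} {f : Multiset α → ℂ}
    (g : Multiset α → ℂ) (h : ∀ s, HasSum (fun i => F i s) (f s)) (s : Multiset α) :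
    HasSum (fun i => conv (F i) g s) (conv f g s) := by
  induction s using Multiset.induction_on generalizing F f g with
  | empty => simpa only [conv_zero_apply] using (h 0).mul_right (g 0)
  | cons a s ih =>
    simp only [conv_cons]
    exact (ih _ h).add (ih _ fun s => h (a ::ₘ s))

lemma hasDerivWithinAt_conv {f g : ℝ → Multiset α → ℂ} {f' g' : Multiset α → ℂ} {S : Set ℝ}
    {x : ℝ} (hf : ∀ s, HasDerivWithinAt (fun t => f t s) (f' s) S x)
    (hg : ∀ s, HasDerivWithinAt (fun t => g t s) (g' s) S x) (s : Multiset α) :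
    HasDerivWithinAt (fun t => conv (f t) (g t) s) (conv f' (g x) s + conv (f x) g' s) S x := by
  induction s using Multiset.induction_on generalizing f g f' g' with
  | empty =>
    simp only [conv_zero_apply]
    exact (hf 0).mul (hg 0)
  | cons a s ih =>
    simp only [conv_cons]
    refine ((ih hf (g' := shift a g') fun s => hg (a ::ₘ s)).add
      (ih (f' := shift a f') (fun s => hf (a ::ₘ s)) hg)).congr_deriv ?_
    exact add_add_add_comm _ _ _ _

/-- The time derivative of the cumulants, in terms of that of the moments. -/
lemma hasDerivWithinAt_kap {μ : ℝ → Multiset α → ℂ} {μ' D : Multiset α → ℂ} {S : Set ℝ} {x : ℝ}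
    (hS : UniqueDiffWithinAt ℝ S x) (h0 : ∀ t, μ t 0 = 1)
    (hμ : ∀ s, HasDerivWithinAt (fun t => μ t s) (μ' s) S x)
    (hD : conv D (μ x) = μ') (s : Multiset α) :
    HasDerivWithinAt (fun t => kap (μ t) s) (D s) S x := by
  have hdiff : ∀ s, DifferentiableWithinAt ℝ (fun t => kap (μ t) s) S x := fun s =>
    kap_mem_of_closed (fun f => DifferentiableWithinAt ℝ f S x)
      (fun c => differentiableWithinAt_const c) (fun f g hf hg => hf.fun_add hg)
      (fun f g hf hg => hf.fun_mul hg) (fun s => (hμ s).differentiableWithinAt) s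
  set κ' : Multiset α → ℂ := fun s => derivWithin (fun t => kap (μ t) s) S x with hκ'
  have hκ : ∀ s, HasDerivWithinAt (fun t => kap (μ t) s) (κ' s) S x := fun s =>
    (hdiff s).hasDerivWithinAt
  have hμ0 : μ' 0 = 0 := by
    have := hμ 0
    simp only [h0] at this
    exact hS.eq_deriv S this (hasDerivWithinAt_const x S (1 : ℂ))
  have hκ0 : κ' 0 = 0 := by
    have := hκ 0
    simp only [kap_zero] at this
    exact hS.eq_deriv S this (hasDerivWithinAt_const x S (0 : ℂ))
  have hrel : ∀ a, shift a μ' = conv (shift a κ') (μ x) + conv (shift a (kap (μ x))) μ' := by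
    intro a
    funext s
    have h1 := hasDerivWithinAt_conv (f := fun t => shift a (kap (μ t))) (f' := shift a κ')
      (fun s => hκ (a ::ₘ s)) hμ s
    simp only [conv_shift_kap (h0 _)] at h1
    exact hS.eq_deriv S (hμ (a ::ₘ s)) h1
  -- The chain rule for μ = exp κ in the time variable. The defect h satisfies ∂_a h = (∂_a κ) h and
  -- h(0) = 0, hence vanishes by induction on the degree; afterwards μ is cancelled from κ' μ = D μ.
  have hmain : μ' - conv κ' (μ x) = 0 := by
    set h := μ' - conv κ' (μ x) with hh
    have hsh : ∀ a, shift a h = conv (shift a (kap (μ x))) h := by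
      intro a
      have e1 : shift a h = shift a μ' - shift a (conv κ' (μ x)) := rfl
      have e2 : conv (shift a (kap (μ x))) h = conv (shift a (kap (μ x))) μ' -
          conv (shift a (kap (μ x))) (conv κ' (μ x)) := by
        rw [conv_comm, hh, conv_sub_left, conv_comm, conv_comm (conv κ' (μ x))]
      rw [e1, e2, hrel, shift_conv, ← conv_assoc, conv_comm (shift a (kap (μ x))) κ', conv_assoc,
        conv_shift_kap (h0 _)]
      abel
    funext s
    induction hn : s.card using Nat.strong_induction_on generalizing s with
    | _ n ih =>
      rcases Multiset.empty_or_exists_mem s with rfl | ⟨a, ha⟩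
      · simp [hh, conv_zero_apply, hμ0, hκ0]
      · obtain ⟨s, rfl⟩ := Multiset.exists_cons_of_mem ha
        have := congrFun (hsh a) s
        rw [conv_eq_zero] at this
        · exact this
        · rintro t u rfl
          rw [ih u.card (by rw [← hn]; simp) u rfl]
          simp
  have hκD : κ' = D := by
    refine sub_eq_zero.1 (eq_zero_of_conv_eq_zero (h0 x) ?_)
    rw [conv_sub_left, hD, ← sub_eq_zero.1 hmain, sub_self]
  exact hκD ▸ hκ s

/-- Multiplication by the coordinates: `∑_a z_a F_a`. -/
noncomputable def zmul [DecidableEq α] (F : α → Multiset α → ℂ) (s : Multiset α) : ℂ :=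
  (s.map fun a => F a (s.erase a)).sum

lemma zmul_cons [DecidableEq α] (F : α → Multiset α → ℂ) (b : α) (s : Multiset α) :
    zmul F (b ::ₘ s) = F b s + zmul (fun a => shift b (F a)) s := by
  unfold zmul
  rw [Multiset.map_cons, Multiset.sum_cons, Multiset.erase_cons_head]
  congr 2
  exact Multiset.map_congr rfl fun a ha => by rw [Multiset.erase_cons_tail_of_mem ha]; rfl

lemma zmul_add [DecidableEq α] (F G : α → Multiset α → ℂ) :
    zmul (fun a => F a + G a) = zmul F + zmul G := by
  funext s
  simp [zmul]

lemma conv_zmul [DecidableEq α] (F : α → Multiset α → ℂ) (g : Multiset α → ℂ) :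
    conv (zmul F) g = zmul fun a => conv (F a) g := by
  funext s
  induction s using Multiset.induction_on generalizing F g with
  | empty => simp [conv_zero_apply, zmul]
  | cons b s ih =>
    have h1 : shift b (zmul F) = F b + zmul fun a => shift b (F a) := by
      funext s; exact zmul_cons F b s
    rw [conv_cons, zmul_cons, h1, conv_add_left, Pi.add_apply, ih, ih]
    simp only [shift_conv]
    rw [zmul_add]
    simp only [Pi.add_apply]
    ring

/-- Joint cumulants of two independent nonempty groups of variables vanish. -/
lemma kap_eq_zero_of_factor {μ : Multiset α → ℂ} (h0 : μ 0 = 1) {P Q : α → Prop}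
    (h : ∀ t u : Multiset α, (∀ a ∈ t, P a) → (∀ a ∈ u, Q a) → μ (t + u) = μ t * μ u)
    {t u : Multiset α} (ht : ∀ a ∈ t, P a) (hu : ∀ a ∈ u, Q a) (ht0 : t ≠ 0) (hu0 : u ≠ 0) :
    kap μ (t + u) = 0 := by
  classical
  induction hn : (t + u).card using Nat.strong_induction_on generalizing t u with
  | _ n ih =>
    obtain ⟨a, ha⟩ := Multiset.exists_mem_of_ne_zero ht0
    obtain ⟨t, rfl⟩ := Multiset.exists_cons_of_mem ha
    have hta : ∀ b ∈ t, P b := fun b hb => ht b (Multiset.mem_cons_of_mem hb)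
    have e1 := congrFun (conv_shift_kap h0 a) (t + u)
    have e2 := congrFun (conv_shift_kap h0 a) t
    have e3 : shift a μ (t + u) = shift a μ t * μ u := by
      have := h (a ::ₘ t) u ht hu
      rwa [Multiset.cons_add] at this
    rw [e3, ← e2] at e1
    set κ' := shift a (kap μ) with hκ'
    have e4 : conv (fun s => if s = t + u then κ' s else 0) μ (t + u) = κ' (t + u) := by
      rw [conv_eq_top, h0, mul_one, if_pos rfl]
      intro s hs
      rw [if_neg]
      rintro rfl
      exact lt_irrefl _ hs
    have e5 : conv (fun s => if s = t + u then 0 else κ' s) μ (t + u) = conv κ' μ t * μ u := by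
      unfold conv
      rw [Multiset.antidiagonal_add, Multiset.map_bind, Multiset.sum_bind,
        ← Multiset.sum_map_mul_right]
      congr 1
      refine Multiset.map_congr rfl fun p hp => ?_
      rw [Multiset.mem_antidiagonal] at hp
      subst hp
      have hmem : ((0 : Multiset α), u) ∈ u.antidiagonal := by simp
      have hp2 : ∀ b ∈ p.2, P b := fun b hb => hta b (by simp [hb])
      obtain ⟨v, rfl⟩ : ∃ v, v = u := ⟨u, rfl⟩
      -- When `q.1 ≠ 0` and the pair is not the top one, the coefficient is a smaller mixed
      -- cumulant, zero by induction. The terms with `q.1 = 0` already reproduce the factorised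
      -- moment, so the remaining top term must vanish.
      have key : ∀ q ∈ v.antidiagonal, (if p.1 + q.1 = p.1 + p.2 + v then 0 else κ' (p.1 + q.1)) *
          μ (p.2 + q.2) = (if q.1 = 0 then κ' p.1 else 0) * (μ p.2 * μ q.2) := by
        intro q hq
        rw [Multiset.mem_antidiagonal] at hq
        have hq1 : ∀ b ∈ q.1, Q b := fun b hb => hu b (hq ▸ Multiset.mem_add.2 (Or.inl hb))
        have hq2 : ∀ b ∈ q.2, Q b := fun b hb => hu b (hq ▸ Multiset.mem_add.2 (Or.inr hb))
        rw [h p.2 q.2 hp2 hq2]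
        congr 1
        by_cases hq0 : q.1 = 0
        · rw [if_pos hq0, hq0, add_zero, if_neg]
          intro hc
          rw [add_assoc] at hc
          have := congrArg Multiset.card hc
          simp at this
          exact hu0 this.2
        · rw [if_neg hq0]
          split_ifs with hc
          · rfl
          · have hcard : p.1.card + q.1.card < p.1.card + p.2.card + v.card := by
              have : p.1.card + q.1.card ≠ p.1.card + p.2.card + v.card := by
                intro hh
                apply hc
                rw [← hq] at hh ⊢
                simp only [Multiset.card_add] at hh
                have h2 : p.2 = 0 := Multiset.card_eq_zero.1 (by omega)
                have h3 : q.2 = 0 := Multiset.card_eq_zero.1 (by omega)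
                simp [h2, h3]
              have : v.card = q.1.card + q.2.card := by rw [← hq, Multiset.card_add]
              omega
            have := ih ((a ::ₘ p.1) + q.1).card (by
                rw [← hn]; simp only [Multiset.card_add, Multiset.card_cons]; omega)
              (t := a ::ₘ p.1) (u := q.1) (by
                intro b hb
                rcases Multiset.mem_cons.1 hb with rfl | hb
                · exact ht _ (by simp)
                · exact hta b (by simp [hb])) hq1 (by simp) hq0 rfl
            rw [Multiset.cons_add] at this
            exact this
      rw [Multiset.map_map]
      calc _ = (v.antidiagonal.map fun q => (if q.1 = 0 then κ' p.1 else 0) *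
            (μ p.2 * μ q.2)).sum := by
            congr 1
            exact Multiset.map_congr rfl key
        _ = conv (fun q => if q = 0 then κ' p.1 * μ p.2 else 0) μ v := by
            unfold conv
            congr 1
            refine Multiset.map_congr rfl fun q _ => ?_
            by_cases hq : q.1 = 0 <;> simp [hq, mul_assoc]
        _ = conv μ (fun q => if q = 0 then κ' p.1 * μ p.2 else 0) v := by rw [conv_comm]
        _ = conv (fun w => if w = v then μ w else 0)
              (fun q => if q = 0 then κ' p.1 * μ p.2 else 0) v := by
            refine conv_congr fun w q hwq => ?_
            by_cases hq : q = 0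
            · subst hq
              rw [add_zero] at hwq
              simp [hwq]
            · simp [hq]
        _ = _ := by
            rw [conv_eq_top]
            · simp [mul_comm]
            · intro w hw
              rw [if_neg]
              rintro rfl
              exact lt_irrefl _ hw
    have e6 : κ' = (fun s => if s = t + u then κ' s else 0) +
        fun s => if s = t + u then 0 else κ' s := by
      funext s
      by_cases hs : s = t + u <;> simp [hs]
    have e7 := congrArg (fun f => conv f μ (t + u)) e6
    simp only [conv_add_left, Pi.add_apply, e4, e5, e1] at e7
    simpa [hκ', shift] using e7

/-! ### Absolute bounds on cumulants. -/

lemma sum_antidiagonal_card (g : ℕ → ℝ) (s : Multiset α) :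
    (s.antidiagonal.map fun p => g p.1.card).sum =
      ∑ j ∈ Finset.range (s.card + 1), (s.card.choose j : ℝ) * g j := by
  have h1 : (s.antidiagonal.map fun p => g p.1.card) =
      s.powerset.map fun t => g t.card := by
    rw [← Multiset.antidiagonal_map_fst, Multiset.map_map]; rfl
  rw [h1, ← Multiset.bind_powerset_len, Multiset.map_bind, Multiset.sum_bind]
  change (Multiset.map _ (Finset.range (s.card + 1)).val).sum = _
  refine Finset.sum_congr rfl fun j _ => ?_
  have h2 : (s.powersetCard j).map (fun t => g t.card) = (s.powersetCard j).map fun _ => g j :=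
    Multiset.map_congr rfl fun t ht => by rw [(Multiset.mem_powersetCard.1 ht).2]
  simp only [h2, Multiset.map_const', Multiset.sum_replicate, Multiset.card_powersetCard,
    nsmul_eq_mul]

/-- Moving the term j = n to the other side, this says that 2^n n! dominates the recursion b_n = 1 +
∑_{j<n} C(n,j) b_j, which is what the cumulant recursion produces for moments bounded by 1. -/
lemma sum_choose_two_pow_factorial_le (n : ℕ) :
    ∑ j ∈ Finset.range (n + 1), (n.choose j : ℝ) * (2 ^ j * j.factorial) + 1 ≤
      2 * (2 ^ n * n.factorial) := by
  induction n with
  | zero => norm_num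
  | succ n ih =>
    rw [Finset.sum_range_succ']
    have h : ∀ j ∈ Finset.range (n + 1), ((n + 1).choose (j + 1) : ℝ) *
        (2 ^ (j + 1) * (j + 1).factorial) =
        2 * (n + 1) * ((n.choose j : ℝ) * (2 ^ j * j.factorial)) := by
      intro j _
      have : ((n : ℝ) + 1) * n.choose j = (n + 1).choose (j + 1) * (j + 1) := by
        exact_mod_cast Nat.add_one_mul_choose_eq n j
      rw [Nat.factorial_succ]
      push_cast
      linear_combination (-(2 : ℝ) ^ (j + 1) * j.factorial) * this
    rw [Finset.sum_congr rfl h, ← Finset.mul_sum, Nat.factorial_succ]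
    push_cast
    simp only [Nat.choose_zero_right, pow_zero, Nat.factorial_zero, Nat.cast_one, mul_one]
    have hn : (0 : ℝ) ≤ n := n.cast_nonneg
    have := mul_le_mul_of_nonneg_left ih (by positivity : (0 : ℝ) ≤ 2 * (n + 1))
    rw [pow_succ]
    nlinarith

lemma norm_conv_le {f g : Multiset α → ℂ} {b : Multiset α → ℝ} (s : Multiset α)
    (hf : ∀ t, t ≤ s → ‖f t‖ ≤ b t) (hg : ∀ t, ‖g t‖ ≤ 1) :
    ‖conv f g s‖ ≤ (s.antidiagonal.map fun p => b p.1).sum := by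
  unfold conv
  have h1 : ∀ m : Multiset (Multiset α × Multiset α), (∀ p ∈ m, p.1 ≤ s) →
      ‖(m.map fun p => f p.1 * g p.2).sum‖ ≤ (m.map fun p => b p.1).sum := by
    intro m
    induction m using Multiset.induction_on with
    | empty => simp
    | cons p m ih =>
      intro hm
      simp only [Multiset.map_cons, Multiset.sum_cons]
      refine (norm_add_le _ _).trans (add_le_add ?_ (ih fun q hq => hm q (by simp [hq])))
      rw [norm_mul]
      have := hf p.1 (hm p (by simp))
      calc _ ≤ b p.1 * 1 := mul_le_mul this (hg _) (norm_nonneg _) ((norm_nonneg _).trans this)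
        _ = _ := mul_one _
  refine h1 _ fun p hp => ?_
  rw [← Multiset.mem_antidiagonal.1 hp]
  exact Multiset.le_add_right _ _

/-- Joint cumulants of variables whose joint moments are bounded by one. -/
lemma norm_kap_cons_le {μ : Multiset α → ℂ} (h0 : μ 0 = 1) (hμ : ∀ s, ‖μ s‖ ≤ 1) (a : α)
    (s : Multiset α) : ‖kap μ (a ::ₘ s)‖ ≤ 2 ^ s.card * s.card.factorial := by
  induction hn : s.card using Nat.strong_induction_on generalizing s a with
  | _ n ih =>
    subst hn
    set g : ℕ → ℝ := fun j => 2 ^ j * j.factorial with hg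
    have e1 := congrFun (conv_shift_kap h0 a) s
    have e2 : shift a (kap μ) = (fun t => if t.card < s.card then 0 else shift a (kap μ) t) +
        fun t => if t.card < s.card then shift a (kap μ) t else 0 := by
      funext t
      by_cases h : t.card < s.card <;> simp [h]
    rw [e2, conv_add_left, Pi.add_apply, conv_eq_top _ (fun t ht => if_pos ht),
      if_neg (lt_irrefl _),
      h0, mul_one] at e1
    -- The identity (∂_a κ) μ = ∂_a μ solved for its top term: only cumulants containing `a` of
    -- lower order remain.
    have e3 : kap μ (a ::ₘ s) = shift a μ s -
      conv (fun t => if t.card < s.card then shift a (kap μ) t else 0) μ s := eq_sub_of_add_eq e1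
    have e4 := norm_conv_le (f := fun t => if t.card < s.card then shift a (kap μ) t else 0)
      (g := μ) (b := fun t => (fun j => if j < s.card then g j else 0) t.card) s (by
        intro t _
        by_cases h : t.card < s.card
        · simp only [h, if_true]
          exact ih t.card h a t rfl
        · simp [h]) hμ
    rw [sum_antidiagonal_card (fun j => if j < s.card then g j else 0), Finset.sum_range_succ] at e4
    simp only [lt_irrefl, if_false, mul_zero, add_zero] at e4
    rw [Finset.sum_congr rfl (g := fun j => (s.card.choose j : ℝ) * g j) (fun j hj => by
      rw [if_pos (Finset.mem_range.1 hj)])] at e4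
    have e5 := sum_choose_two_pow_factorial_le s.card
    rw [Finset.sum_range_succ, Nat.choose_self] at e5
    rw [e3]
    refine (norm_sub_le _ _).trans ?_
    have e6 : ‖shift a μ s‖ ≤ 1 := hμ _
    simp only [hg] at e4
    push_cast at e5
    linarith

end Hurwitz

/-! ### The evolution of the cumulants of a closed family of moments -/

section Hierarchy

variable {Λ Q : Type*} [AddCommGroup Λ]

/-- The joint moments of exponentials with Fourier transform `M`. -/
def mom (M : Λ → ℂ) : Multiset Λ → ℂ := fun s => M s.sum

lemma shift_mom (M : Λ → ℂ) (a : Λ) (s : Multiset Λ) : shift a (mom M) s = M (a + s.sum) := by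
  simp [shift, mom]

lemma multiset_sum_hasSum {β ι : Type*} (s : Multiset β) {F : β → ι → ℂ} {f : β → ℂ}
    (h : ∀ b ∈ s, HasSum (F b) (f b)) :
    HasSum (fun i => (s.map fun b => F b i).sum) (s.map f).sum := by
  induction s using Multiset.induction_on with
  | empty => simp
  | cons b s ih =>
    simp only [Multiset.map_cons, Multiset.sum_cons]
    exact (h b (by simp)).add (ih fun c hc => h c (by simp [hc]))

variable [DecidableEq Λ]

/-- The right-hand side of the evolution equation of the joint cumulants `κ`. -/
noncomputable def hierarchyRHS (B : Λ →+ Λ →+ ℝ) (w : Q → Λ →+ ℂ) (τ : Q → Λ)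
    (κ : Multiset Λ → ℂ) : Multiset Λ → ℂ :=
  zmul (fun a => (-(B a a : ℂ)) • shift a κ) +
    zmul (fun a s => ∑' q, w q a * κ ((a + τ q) ::ₘ s)) +
    zmul (fun a => zmul fun b => (-(B a b : ℂ)) • shift (a + b) κ)

/-- Multiplication by μ turns each ∂_a κ into ∂_a μ and commutes with multiplication by coordinates.
The right side then follows by expanding B(∑a, ∑a) into diagonal and off-diagonal parts and w_q(∑a)
by additivity. The absolute bound `norm_kap_cons_le` makes the series over q converge. -/
lemma conv_hierarchyRHS {M : Λ → ℂ} (h0 : M 0 = 1) (hM : ∀ l, ‖M l‖ ≤ 1)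
    (B : Λ →+ Λ →+ ℝ) (w : Q → Λ →+ ℂ) (τ : Q → Λ)
    (hw : ∀ l, Summable fun q => ‖w q l‖) (s : Multiset Λ) :
    conv (hierarchyRHS B w τ (kap (mom M))) (mom M) s =
      -(B s.sum s.sum : ℂ) * M s.sum + ∑' q, w q s.sum * M (s.sum + τ q) := by
  have hm0 : mom M 0 = 1 := by simp [mom, h0]
  have hm : ∀ s, ‖mom M s‖ ≤ 1 := fun s => hM _
  set κ := kap (mom M) with hκ
  have hsum : ∀ a s, HasSum (fun q => w q a * κ ((a + τ q) ::ₘ s))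
      (∑' q, w q a * κ ((a + τ q) ::ₘ s)) := by
    intro a s
    refine Summable.hasSum (Summable.of_norm_bounded
      ((hw a).mul_right (2 ^ s.card * (s.card.factorial : ℝ))) fun q => ?_)
    · rw [norm_mul]
      exact mul_le_mul_of_nonneg_left (norm_kap_cons_le hm0 hm _ _) (norm_nonneg _)
  have h2 : ∀ a s, conv (fun s => ∑' q, w q a * κ ((a + τ q) ::ₘ s)) (mom M) s =
      ∑' q, w q a * M (a + s.sum + τ q) := by
    intro a s
    have := hasSum_conv_left (F := fun q => w q a • shift (a + τ q) κ) (mom M)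
      (fun s => hsum a s) s
    rw [← this.tsum_eq]
    congr 1
    funext q
    rw [conv_smul_left, hκ, conv_shift_kap hm0, Pi.smul_apply, shift_mom, smul_eq_mul]
    congr 2
    abel
  unfold hierarchyRHS
  simp only [conv_add_left, conv_zmul, conv_smul_left, hκ, conv_shift_kap hm0, Pi.add_apply]
  rw [← hκ]
  have e1 : zmul (fun a => -(B a a : ℂ) • shift a (mom M)) s =
      (s.map fun a => -(B a a : ℂ) * M s.sum).sum := by
    unfold zmul
    congr 1
    refine Multiset.map_congr rfl fun a ha => ?_
    beta_reduce
    rw [Pi.smul_apply, shift_mom, Multiset.sum_erase ha, smul_eq_mul]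
  have e2 : zmul (fun a => conv (fun s => ∑' q, w q a * κ ((a + τ q) ::ₘ s)) (mom M)) s =
      ∑' q, w q s.sum * M (s.sum + τ q) := by
    have hs : ∀ a ∈ s, HasSum (fun q => w q a * M (s.sum + τ q))
        (∑' q, w q a * M (s.sum + τ q)) := fun a _ =>
      (Summable.of_norm_bounded (hw a) fun q => by
        rw [norm_mul]
        exact mul_le_of_le_one_right (norm_nonneg _) (hM _)).hasSum
    have := multiset_sum_hasSum s hs
    rw [show (∑' q, w q s.sum * M (s.sum + τ q)) =
        ∑' q, (s.map fun a => w q a * M (s.sum + τ q)).sum from by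
      congr 1
      funext q
      rw [Multiset.sum_map_mul_right, map_multiset_sum], this.tsum_eq]
    unfold zmul
    congr 1
    refine Multiset.map_congr rfl fun a ha => ?_
    beta_reduce
    rw [h2, Multiset.sum_erase ha]
  have e3 : zmul (fun a => zmul fun b => -(B a b : ℂ) • shift (a + b) (mom M)) s =
      (s.map fun a => -((B a s.sum : ℂ) - B a a) * M s.sum).sum := by
    unfold zmul
    congr 1
    refine Multiset.map_congr rfl fun a ha => ?_
    have : B a s.sum - B a a = ((s.erase a).map fun b => B a b).sum := by
      have h := Multiset.sum_erase ha
      conv_lhs => rw [← h, map_add, map_multiset_sum]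
      ring
    rw [← Complex.ofReal_sub, this, ← Multiset.sum_erase ha]
    have h4 : ∀ b ∈ s.erase a, (-(B a b : ℂ) • shift (a + b) (mom M)) ((s.erase a).erase b) =
        -(B a b : ℂ) * M (a + (s.erase a).sum) := by
      intro b hb
      rw [Pi.smul_apply, shift_mom, add_assoc, Multiset.sum_erase hb, smul_eq_mul]
    beta_reduce
    rw [Multiset.map_congr rfl h4, Multiset.sum_map_mul_right, Multiset.sum_map_neg]
    congr 2
    have h5 := map_multiset_sum Complex.ofRealHom ((s.erase a).map fun b => B a b)
    rw [Multiset.map_map] at h5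
    exact h5.symm
  rw [e1, e2, e3]
  have e4 : (B s.sum s.sum : ℂ) = (s.map fun a => (B a s.sum : ℂ)).sum := by
    have h6 : B s.sum s.sum = (s.map fun a => B a s.sum).sum := by
      exact map_multiset_sum (AddMonoidHom.flip B s.sum) s
    rw [h6]
    have h5 := map_multiset_sum Complex.ofRealHom (s.map fun a => B a s.sum)
    rw [Multiset.map_map] at h5
    exact h5
  rw [e4, add_right_comm, ← Multiset.sum_map_add]
  congr 1
  rw [← Multiset.sum_map_neg, ← Multiset.sum_map_mul_right]
  congr 1
  refine Multiset.map_congr rfl fun a _ => ?_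
  ring

lemma hasDerivWithinAt_kap_mom {M : ℝ → Λ → ℂ} (h0 : ∀ t, M t 0 = 1) (hM : ∀ t l, ‖M t l‖ ≤ 1)
    (B : Λ →+ Λ →+ ℝ) (w : Q → Λ →+ ℂ) (τ : Q → Λ) (hw : ∀ l, Summable fun q => ‖w q l‖) {x : ℝ}
    (hd : ∀ l, HasDerivWithinAt (fun t => M t l)
      (-(B l l : ℂ) * M x l + ∑' q, w q l * M x (l + τ q)) (Set.Ici x) x) (s : Multiset Λ) :
    HasDerivWithinAt (fun t => kap (mom (M t)) s) (hierarchyRHS B w τ (kap (mom (M x))) s)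
      (Set.Ici x) x :=
  hasDerivWithinAt_kap (uniqueDiffWithinAt_Ici x) (μ := fun t => mom (M t))
    (μ' := fun s => -(B s.sum s.sum : ℂ) * M x s.sum + ∑' q, w q s.sum * M x (s.sum + τ q))
    (fun t => by simp [mom, h0]) (fun s => hd s.sum)
    (funext fun s => conv_hierarchyRHS (h0 x) (hM x) B w τ hw s) s

/-- A maximum principle for damped linear equations. -/
lemma norm_le_of_damped {f f' : ℝ → ℂ} {D Y : ℝ} (hf : ContinuousOn f (Set.Ici 0))
    (hf' : ∀ t, 0 ≤ t → HasDerivWithinAt f (f' t) (Set.Ici t) t)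
    (hb : ∀ t, 0 ≤ t → ‖f' t + D * f t‖ ≤ D * Y) (h0 : ‖f 0‖ ≤ Y) {t : ℝ} (ht : 0 ≤ t) :
    ‖f t‖ ≤ Y := by
  have key := image_norm_le_of_norm_deriv_right_le_deriv_boundary (a := 0) (b := t)
    (f := fun s => (Real.exp (D * s) : ℂ) * f s)
    (f' := fun s => (Real.exp (D * s) : ℂ) * (f' s + D * f s))
    (B := fun s => Y * Real.exp (D * s)) (B' := fun s => Y * (Real.exp (D * s) * D))
    (by
      refine ContinuousOn.mul ?_ (hf.mono Set.Icc_subset_Ici_self)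
      exact (Complex.continuous_ofReal.comp (by fun_prop)).continuousOn)
    (by
      intro s hs
      have h1 : HasDerivAt (fun s : ℝ => (Real.exp (D * s) : ℂ))
          ((Real.exp (D * s) * D : ℝ) : ℂ) s := by
        have := ((hasDerivAt_id s).const_mul D).exp
        simpa using this.ofReal_comp
      refine (h1.hasDerivWithinAt.mul (hf' s hs.1)).congr_deriv ?_
      push_cast
      ring)
    (by simpa using h0)
    (by
      intro s
      have := ((hasDerivAt_id s).const_mul D).exp.const_mul Y
      simpa using this)
    (by
      intro s hs
      rw [norm_mul, Complex.norm_real, Real.norm_of_nonneg (Real.exp_pos _).le]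
      have := mul_le_mul_of_nonneg_left (hb s hs.1) (Real.exp_pos (D * s)).le
      linarith)
    (Set.right_mem_Icc.2 ht)
  rw [norm_mul, Complex.norm_real, Real.norm_of_nonneg (Real.exp_pos _).le, mul_comm] at key
  exact le_of_mul_le_mul_right key (Real.exp_pos _)

end Hierarchy

/-! ### Uniform estimates on joint cumulants of a mean-field hierarchy -/

section Estimate

variable {d N : ℕ}

/-- The frequencies of `N` particles on the torus. -/
abbrev Freq (N d : ℕ) : Type := Fin N → Fin d → ℤ

/-- The number of labels occurring in a labelled multiset. -/
def numLabels (S : Multiset (Freq N d × Fin N)) : ℕ := (S.map Prod.snd).toFinset.card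

/-- Each frequency is supported in `U`, where the sites carry the label of the frequency. -/
structure Labelled (S : Multiset (Freq N d × Fin N)) (U : Finset (Fin N)) (h : Fin N → Fin N) :
    Prop where
  supp : ∀ x ∈ S, ∀ i, x.1 i ≠ 0 → i ∈ U ∧ h i = x.2
  le_card : numLabels S ≤ U.card

/-- The decay in `N` expected from the joint cumulant of a labelled multiset. -/
noncomputable def labelWeight (S : Multiset (Freq N d × Fin N)) (U : Finset (Fin N)) : ℝ :=
  ((U.card : ℝ) / N) ^ (numLabels S - 1)

/-- The bound `|κ(S)| ≤ b (|U| / N) ^ (c - 1)`, over labelled multisets of cardinality `n`. -/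
def LabelBound (n : ℕ) (b : ℝ) (κ : Multiset (Freq N d) → ℂ) : Prop :=
  ∀ S U h, S.card = n → Labelled S U h → ‖κ (S.map Prod.fst)‖ ≤ b * labelWeight S U

lemma card_div_le_one (U : Finset (Fin N)) : (U.card : ℝ) / N ≤ 1 := by
  refine div_le_one_of_le₀ ?_ (Nat.cast_nonneg N)
  have := U.card_le_univ
  rw [Fintype.card_fin] at this
  exact_mod_cast this

lemma labelWeight_nonneg (S : Multiset (Freq N d × Fin N)) (U : Finset (Fin N)) :
    0 ≤ labelWeight S U := by
  unfold labelWeight; positivity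

lemma numLabels_le_card (S : Multiset (Freq N d × Fin N)) : numLabels S ≤ S.card := by
  unfold numLabels
  exact (Multiset.toFinset_card_le _).trans (Multiset.card_map _ _).le

lemma numLabels_pos {S : Multiset (Freq N d × Fin N)} (hS : S ≠ 0) : 0 < numLabels S := by
  obtain ⟨x, hx⟩ := Multiset.exists_mem_of_ne_zero hS
  exact Finset.card_pos.2 ⟨x.2, by simpa using ⟨x.1, hx⟩⟩

/-- The cost of adding one particle to U in the weight (|U|/N)^(c-1). It is bounded only because
there are at most |U| labels, the reason for the field `le_card` of `Labelled`. -/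
lemma one_add_inv_pow_le {u c : ℕ} (hc : c ≤ u) (hu : 0 < u) : (1 + 1 / (u : ℝ)) ^ (c - 1) ≤ 3 := by
  have hu' : (0 : ℝ) < u := by exact_mod_cast hu
  have h1 : 1 + 1 / (u : ℝ) ≤ Real.exp (1 / u) := by
    rw [add_comm]; exact Real.add_one_le_exp _
  calc (1 + 1 / (u : ℝ)) ^ (c - 1) ≤ (1 + 1 / (u : ℝ)) ^ u :=
        pow_le_pow_right₀ (by simp) (by omega)
    _ ≤ Real.exp (1 / u) ^ u := pow_le_pow_left₀ (by positivity) h1 _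
    _ = Real.exp 1 := by rw [← Real.exp_nat_mul]; congr 1; field_simp
    _ ≤ 3 := by linarith [Real.exp_one_lt_d9]

/-- The shift of frequencies due to an interaction of the particles `i` and `j`. -/
def pairFreq (i j : Fin N) (r : (Fin d → ℤ) × (Fin d → ℤ)) : Freq N d :=
  Pi.single i r.1 + Pi.single j r.2

lemma pairFreq_ne_zero {i j k : Fin N} {r : (Fin d → ℤ) × (Fin d → ℤ)}
    (h : pairFreq i j r k ≠ 0) : k = i ∨ k = j := by
  by_contra! hc
  apply h
  simp [pairFreq, Pi.single_eq_of_ne hc.1, Pi.single_eq_of_ne hc.2]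

/-- The effect on the joint cumulants of an interaction with the particle `j`. -/
noncomputable def interactionBound (U : Finset (Fin N)) (c : ℕ) (j : Fin N) : ℝ :=
  if j ∈ U then ((U.card : ℝ) / N) ^ (c - 1 - 1) else 3 * ((U.card : ℝ) / N) ^ (c - 1)

/-- Particles of U lose one factor |U|/N but make up only this fraction of all particles, so they
contribute 1 after averaging; the others contribute 3. -/
lemma sum_interactionBound_le (U : Finset (Fin N)) {c : ℕ} (hN : 0 < N) :
    ∑ j, interactionBound U c j ≤ N * (4 * ((U.card : ℝ) / N) ^ (c - 1)) := by
  have hN' : (0 : ℝ) < N := by exact_mod_cast hN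
  set p : ℝ := (U.card : ℝ) / N with hp
  have hp0 : 0 ≤ p := by positivity
  have hp1 : p ≤ 1 := card_div_le_one U
  unfold interactionBound
  rw [Finset.sum_ite]
  simp only [Finset.sum_const, nsmul_eq_mul, Finset.filter_mem_eq_inter, Finset.univ_inter]
  have h1 : ((Finset.univ.filter fun j => j ∉ U).card : ℝ) ≤ N := by
    have := (Finset.univ.filter fun j : Fin N => j ∉ U).card_le_univ
    rw [Fintype.card_fin] at this
    exact_mod_cast this
  have h2 : (U.card : ℝ) * p ^ (c - 1 - 1) ≤ N * p ^ (c - 1) := by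
    have h3 : (U.card : ℝ) = N * p := by rw [hp]; field_simp
    rw [h3, mul_assoc, ← pow_succ']
    refine mul_le_mul_of_nonneg_left ?_ hN'.le
    -- With truncated subtraction (c - 1 - 1) + 1 ≥ c - 1, with equality for c ≥ 2.
    exact pow_le_pow_of_le_one hp0 hp1 (by omega)
  have h4 : ((Finset.univ.filter fun j => j ∉ U).card : ℝ) * (3 * p ^ (c - 1)) ≤
      N * (3 * p ^ (c - 1)) := mul_le_mul_of_nonneg_right h1 (by positivity)
  linarith

/-- The new frequency lives on the particles of `x` and on `j`. The labelling is repaired either by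
identifying the label of `j` with that of `x`, or, if `j` is not yet in U, by adding it with the
label of `x`. -/
lemma LabelBound.interaction {n : ℕ} {b : ℝ} {κ : Multiset (Freq N d) → ℂ}
    (hb : LabelBound n b κ) (hb0 : 0 ≤ b) {S : Multiset (Freq N d × Fin N)} {U : Finset (Fin N)}
    {h : Fin N → Fin N} {x : Freq N d × Fin N} (hS : (x ::ₘ S).card = n)
    (hL : Labelled (x ::ₘ S) U h) {i : Fin N} (hi : x.1 i ≠ 0) (j : Fin N)
    (r : (Fin d → ℤ) × (Fin d → ℤ)) :
    ‖κ ((x.1 + pairFreq i j r) ::ₘ S.map Prod.fst)‖ ≤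
      b * interactionBound U (numLabels (x ::ₘ S)) j := by
  classical
  have hUpos : 0 < U.card := Finset.card_pos.2 ⟨i, (hL.supp x (by simp) i hi).1⟩
  have hne : ∀ k, (x.1 + pairFreq i j r) k ≠ 0 → x.1 k ≠ 0 ∨ k = j := by
    intro k hk
    by_cases hx : x.1 k = 0
    · right
      rw [Pi.add_apply, hx, zero_add] at hk
      rcases pairFreq_ne_zero hk with rfl | rfl
      · exact absurd hx hi
      · rfl
    · exact Or.inl hx
  unfold interactionBound
  by_cases hj : j ∈ U
  · rw [if_pos hj]
    -- The relabelling that identifies the label of `j` with that of `x`; at most the label `h j`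
    -- disappears.
    set ρ : Fin N → Fin N := fun y => if y = h j then x.2 else y with hρ
    have hρx : ρ x.2 = x.2 := by simp [hρ]
    set S' : Multiset (Freq N d × Fin N) :=
      (x.1 + pairFreq i j r, x.2) ::ₘ S.map fun y => (y.1, ρ y.2) with hS'
    have hlab : (S'.map Prod.snd).toFinset = ((x ::ₘ S).map Prod.snd).toFinset.image ρ := by
      ext y
      simp only [hS', Multiset.map_cons, Multiset.map_map, Function.comp_def, hρx,
        Multiset.toFinset_cons, Finset.image_insert, Finset.mem_insert, Multiset.mem_toFinset,
        Multiset.mem_map, Finset.mem_image]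
      grind
    have hle : numLabels S' ≤ numLabels (x ::ₘ S) := by
      unfold numLabels
      rw [hlab]
      exact Finset.card_image_le
    have hge : numLabels (x ::ₘ S) ≤ numLabels S' + 1 := by
      unfold numLabels
      rw [hlab]
      refine (Finset.card_le_card (t := insert (h j)
        (((x ::ₘ S).map Prod.snd).toFinset.image ρ)) ?_).trans (Finset.card_insert_le _ _)
      intro y hy
      by_cases hyj : y = h j
      · simp [hyj]
      · exact Finset.mem_insert_of_mem (Finset.mem_image.2 ⟨y, hy, by simp [hρ, hyj]⟩)
    have hL' : Labelled S' U (ρ ∘ h) := by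
      refine ⟨?_, hle.trans hL.le_card⟩
      intro y hy k hk
      rcases Multiset.mem_cons.1 hy with rfl | hy
      · rcases hne k hk with hxk | rfl
        · obtain ⟨h1, h2⟩ := hL.supp x (by simp) k hxk
          exact ⟨h1, by simp [h2, hρx]⟩
        · exact ⟨hj, by simp [hρ]⟩
      · obtain ⟨z, hz, rfl⟩ := Multiset.mem_map.1 hy
        obtain ⟨h1, h2⟩ := hL.supp z (by simp [hz]) k hk
        exact ⟨h1, by simp [h2]⟩
    have := hb S' U (ρ ∘ h) (by simpa [hS'] using hS) hL'
    have hmap : S'.map Prod.fst = (x.1 + pairFreq i j r) ::ₘ S.map Prod.fst := by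
      simp [hS', Multiset.map_map]
    rw [hmap] at this
    refine this.trans (mul_le_mul_of_nonneg_left ?_ hb0)
    exact pow_le_pow_of_le_one (by positivity) (card_div_le_one U) (by omega)
  · rw [if_neg hj]
    set S' : Multiset (Freq N d × Fin N) := (x.1 + pairFreq i j r, x.2) ::ₘ S with hS'
    have hnum : numLabels S' = numLabels (x ::ₘ S) := by simp [numLabels, hS']
    have hcard : (insert j U).card = U.card + 1 := Finset.card_insert_of_notMem hj
    have hL' : Labelled S' (insert j U) (Function.update h j x.2) := by
      refine ⟨?_, by rw [hnum, hcard]; exact hL.le_card.trans (Nat.le_succ _)⟩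
      intro y hy k hk
      by_cases hkj : k = j
      · subst hkj
        refine ⟨by simp, ?_⟩
        rcases Multiset.mem_cons.1 hy with rfl | hy
        · simp
        · exact absurd (hL.supp y (by simp [hy]) k hk).1 hj
      · rw [Function.update_of_ne hkj]
        rcases Multiset.mem_cons.1 hy with rfl | hy
        · obtain ⟨h1, h2⟩ := hL.supp x (by simp) k ((hne k hk).resolve_right hkj)
          exact ⟨by simp [h1], h2⟩
        · obtain ⟨h1, h2⟩ := hL.supp y (by simp [hy]) k hk
          exact ⟨by simp [h1], h2⟩
    have := hb S' _ _ (by simpa [hS'] using hS) hL'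
    rw [hS', Multiset.map_cons] at this
    refine this.trans (mul_le_mul_of_nonneg_left ?_ hb0)
    unfold labelWeight
    rw [← hS', hnum, hcard]
    have hU' : (0 : ℝ) < U.card := by exact_mod_cast hUpos
    -- The number of labels is unchanged, so the whole loss is (1 + 1/|U|)^(c-1).
    have e1 : ((U.card + 1 : ℕ) : ℝ) / N = (1 + 1 / (U.card : ℝ)) * ((U.card : ℝ) / N) := by
      push_cast
      field_simp
    rw [e1, mul_pow]
    exact mul_le_mul_of_nonneg_right (one_add_inv_pow_le hL.le_card hUpos) (by positivity)

/-- A common particle forces the two frequencies to have the same label. Their sum keeps it, so the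
order drops by one while the weight stays the same. -/
lemma LabelBound.merge {n : ℕ} {b : ℝ} {κ : Multiset (Freq N d) → ℂ}
    (hb : LabelBound n b κ) {S : Multiset (Freq N d × Fin N)} {U : Finset (Fin N)}
    {h : Fin N → Fin N} {x y : Freq N d × Fin N} (hS : (x ::ₘ y ::ₘ S).card = n + 1)
    (hL : Labelled (x ::ₘ y ::ₘ S) U h) {i : Fin N} (hx : x.1 i ≠ 0) (hy : y.1 i ≠ 0) :
    ‖κ ((x.1 + y.1) ::ₘ S.map Prod.fst)‖ ≤ b * labelWeight (x ::ₘ y ::ₘ S) U := by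
  have hxy : x.2 = y.2 := by
    rw [← (hL.supp x (by simp) i hx).2, ← (hL.supp y (by simp) i hy).2]
  set S' : Multiset (Freq N d × Fin N) := (x.1 + y.1, x.2) ::ₘ S with hS'
  have hnum : numLabels S' = numLabels (x ::ₘ y ::ₘ S) := by simp [numLabels, hS', hxy]
  have hL' : Labelled S' U h := by
    refine ⟨?_, hnum ▸ hL.le_card⟩
    intro z hz k hk
    rcases Multiset.mem_cons.1 hz with rfl | hz
    · by_cases hxk : x.1 k = 0
      · have hyk : y.1 k ≠ 0 := by
          intro hyk
          exact hk (by simp [hxk, hyk])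
        dsimp only
        rw [hxy]
        exact hL.supp y (by simp) k hyk
      · exact hL.supp x (by simp) k hxk
    · exact hL.supp z (by simp [hz]) k hk
  have := hb S' U h (by simpa [hS'] using hS) hL'
  rw [labelWeight, hnum, hS', Multiset.map_cons] at this
  exact this

/-- Lets the bound depend on labelled elements, although `zmul` sees only their images. The
induction runs over T ≤ S because the multiset being erased from must remain S. -/
lemma norm_zmul_map_le {α β : Type*} [DecidableEq α] [DecidableEq β] (v : β → α)
    (F : α → Multiset α → ℂ) (S : Multiset β) {b : β → ℝ}
    (hF : ∀ x ∈ S, ‖F (v x) ((S.erase x).map v)‖ ≤ b x) :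
    ‖zmul F (S.map v)‖ ≤ (S.map b).sum := by
  unfold zmul
  rw [Multiset.map_map]
  have : ∀ T : Multiset β, T ≤ S →
      ‖(T.map ((fun a => F a ((S.map v).erase a)) ∘ v)).sum‖ ≤ (T.map b).sum := by
    intro T
    induction T using Multiset.induction_on with
    | empty => simp
    | cons x T ih =>
      intro hT
      rw [Multiset.map_cons, Multiset.sum_cons, Multiset.map_cons, Multiset.sum_cons]
      refine (norm_add_le _ _).trans (add_le_add ?_ (ih ((Multiset.le_cons_self T x).trans hT)))
      have hx : x ∈ S := Multiset.mem_of_le hT (by simp)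
      have := hF x hx
      rwa [Multiset.map_erase_of_mem _ _ hx] at this
  exact this S le_rfl

/-- Over ordered pairs of distinct positions, each f(x) is collected card S - 1 times. This is how
the merging terms, bounded by (B(a,a) + B(b,b))/2, become a multiple of the total damping. -/
lemma sum_sum_erase_half {β : Type*} [DecidableEq β] (S : Multiset β) (f : β → ℝ) :
    (S.map fun x => ((S.erase x).map fun y => (f x + f y) / 2).sum).sum =
      (S.card - 1) * (S.map f).sum := by
  have h1 : ∀ x ∈ S, ((S.erase x).map fun y => (f x + f y) / 2).sum =
      ((S.card - 2) / 2) * f x + (S.map f).sum / 2 := by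
    intro x hx
    have h2 : ((S.erase x).map f).sum = (S.map f).sum - f x := by
      conv_rhs => rw [← Multiset.cons_erase hx]
      simp
    have h3 : ((S.erase x).card : ℝ) = S.card - 1 := by
      rw [Multiset.card_erase_of_mem hx, Nat.pred_eq_sub_one, Nat.cast_sub]
      · simp
      · exact Multiset.card_pos.2 (fun h => by simp [h] at hx)
    rw [Multiset.sum_map_div, Multiset.sum_map_add, h2]
    simp only [Multiset.map_const', Multiset.sum_replicate, nsmul_eq_mul]
    rw [h3]
    ring
  rw [Multiset.map_congr rfl h1, Multiset.sum_map_add, Multiset.sum_map_mul_left]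
  simp only [Multiset.map_const', Multiset.sum_replicate, nsmul_eq_mul]
  ring

/-- `∑_i |l_i|²`. -/
def sqFreq (l : Freq N d) : ℝ := ∑ i, ∑ k, ((l i k : ℤ) : ℝ) ^ 2

lemma sqFreq_nonneg (l : Freq N d) : 0 ≤ sqFreq l := by unfold sqFreq; positivity

/-- A mean-field interaction of strength `k` acting on moments of `N` particles. -/
structure MeanFieldData (N d : ℕ) (D : ℝ) (k : (Fin d → ℤ) × (Fin d → ℤ) → ℝ)
    (B : Freq N d →+ Freq N d →+ ℝ)
    (w : Fin N × Fin N × ((Fin d → ℤ) × (Fin d → ℤ)) → Freq N d →+ ℂ) : Prop where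
  diag : ∀ a, B a a = D * sqFreq a
  abs_le : ∀ a b, |B a b| ≤ (B a a + B b b) / 2
  overlap : ∀ a b, B a b ≠ 0 → ∃ i, a i ≠ 0 ∧ b i ≠ 0
  weight_le : ∀ i j r a, ‖w (i, j, r) a‖ ≤ k r / N * ∑ l, ((a i l : ℤ) : ℝ) ^ 2
  summable : Summable k

variable {D : ℝ} {k : (Fin d → ℤ) × (Fin d → ℤ) → ℝ} {B : Freq N d →+ Freq N d →+ ℝ}
  {w : Fin N × Fin N × ((Fin d → ℤ) × (Fin d → ℤ)) → Freq N d →+ ℂ}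

lemma summable_triple {ι R : Type*} [Finite ι] {f : ι × ι × R → ℝ} (hf : ∀ q, 0 ≤ f q)
    (h : ∀ i j, Summable fun r => f (i, j, r)) : Summable f := by
  refine (summable_prod_of_nonneg hf).2 ⟨fun i => ?_, Summable.of_finite⟩
  exact (summable_prod_of_nonneg fun _ => hf _).2 ⟨fun j => h i j, Summable.of_finite⟩

lemma MeanFieldData.summable_weight (H : MeanFieldData N d D k B w) (a : Freq N d) :
    Summable fun q => ‖w q a‖ := by
  refine summable_triple (f := fun q => ‖w q a‖) (fun _ => norm_nonneg _) fun i j => ?_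
  exact Summable.of_nonneg_of_le (fun _ => norm_nonneg _) (fun r => H.weight_le i j r a)
    ((H.summable.div_const _).mul_right _)

lemma hasSum_mul_mul {ι R : Type*} [Fintype ι] {s I : ι → ℝ} {f : R → ℝ} {c : ℝ}
    (hs : ∀ i, 0 ≤ s i) (hI : ∀ i, 0 ≤ I i) (hf : ∀ r, 0 ≤ f r) (h : HasSum f c) :
    HasSum (fun q : ι × ι × R => s q.1 * (I q.2.1 * f q.2.2))
      ((∑ i, s i) * ((∑ j, I j) * c)) := by
  have h2 : HasSum (fun p : ι × R => I p.1 * f p.2) ((∑ j, I j) * c) :=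
    (hasSum_fintype I).mul h (Summable.mul_of_nonneg (hasSum_fintype I).summable h.summable hI hf)
  exact (hasSum_fintype s).mul h2 (Summable.mul_of_nonneg (hasSum_fintype s).summable h2.summable hs
    fun p => mul_nonneg (hI _) (hf _))

/-- Only particles i on which the frequency is nonzero have nonzero weight, so
`LabelBound.interaction` applies to every surviving term. The factor 1/N in the weight turns the sum
over j into an average. -/
lemma norm_tsum_interaction_le (H : MeanFieldData N d D k B w) (hk : ∀ r, 0 ≤ k r) (hN : 0 < N)
    {n : ℕ} {b : ℝ} {κ : Multiset (Freq N d) → ℂ}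
    (hb : LabelBound n b κ) (hb0 : 0 ≤ b) {S : Multiset (Freq N d × Fin N)} {U : Finset (Fin N)}
    {h : Fin N → Fin N} {x : Freq N d × Fin N} (hS : (x ::ₘ S).card = n)
    (hL : Labelled (x ::ₘ S) U h) :
    ‖∑' q : Fin N × Fin N × ((Fin d → ℤ) × (Fin d → ℤ)),
        w q x.1 * κ ((x.1 + pairFreq q.1 q.2.1 q.2.2) ::ₘ S.map Prod.fst)‖ ≤
      sqFreq x.1 * (4 * (∑' r, k r) * b * labelWeight (x ::ₘ S) U) := by
  have hN' : (0 : ℝ) < N := by exact_mod_cast hN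
  set c := numLabels (x ::ₘ S) with hc
  set s : Fin N → ℝ := fun i => ∑ l, ((x.1 i l : ℤ) : ℝ) ^ 2 with hs
  set I : Fin N → ℝ := interactionBound U c with hI
  have hI0 : ∀ j, 0 ≤ I j := fun j => by
    simp only [hI, interactionBound]; split_ifs <;> positivity
  have hs0 : ∀ i, 0 ≤ s i := fun i => by simp only [hs]; positivity
  have hsq : sqFreq x.1 = ∑ i, s i := rfl
  have hw : ∀ i j r, ‖w (i, j, r) x.1‖ ≤ k r / N * s i := fun i j r => H.weight_le i j r x.1
  have hIκ : ∀ i j r, x.1 i ≠ 0 → ‖κ ((x.1 + pairFreq i j r) ::ₘ S.map Prod.fst)‖ ≤ b * I j :=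
    fun i j r hi => hb.interaction hb0 hS hL hi j r
  have hsum : ∑ j, I j ≤ N * (4 * ((U.card : ℝ) / N) ^ (c - 1)) :=
    sum_interactionBound_le U (c := c) hN
  have hsi : ∀ i, x.1 i = 0 → s i = 0 := fun i hi => by simp [hs, hi]
  clear_value s I
  have hf : HasSum (fun r => b / N * k r) (b / N * ∑' r, k r) := H.summable.hasSum.mul_left _
  have hf0 : ∀ r, 0 ≤ b / N * k r := fun r => mul_nonneg (by positivity) (hk r)
  have hgs := hasSum_mul_mul hs0 hI0 hf0 hf
  refine (tsum_of_norm_bounded hgs ?_).trans ?_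
  · rintro ⟨i, j, r⟩
    rw [norm_mul]
    by_cases hi : x.1 i = 0
    · have : ‖w (i, j, r) x.1‖ ≤ 0 := by
        have := hw i j r
        rwa [hsi i hi, mul_zero] at this
      rw [le_antisymm this (norm_nonneg _), zero_mul]
      exact mul_nonneg (hs0 _) (mul_nonneg (hI0 _) (mul_nonneg (by positivity) (hk _)))
    · have h1 := hw i j r
      have h2 := hIκ i j r hi
      calc _ ≤ (k r / N * s i) * (b * I j) :=
            mul_le_mul h1 h2 (norm_nonneg _) ((norm_nonneg _).trans h1)
        _ = _ := by ring
  · rw [hsq]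
    refine mul_le_mul_of_nonneg_left ?_ (Finset.sum_nonneg fun i _ => hs0 i)
    have h3 : 0 ≤ b / N * ∑' r, k r := mul_nonneg (by positivity) (tsum_nonneg hk)
    refine (mul_le_mul_of_nonneg_right hsum h3).trans_eq ?_
    unfold labelWeight
    rw [← hc]
    field_simp

/-- All that is left after removing the damping is measured in units of the total damping rate: the
interaction contributes b/2, the n other partners available for merging contribute n b'. For n = 0
there is nothing to merge. -/
lemma norm_hierarchyRHS_add_le (H : MeanFieldData N d D k B w) (hk : ∀ r, 0 ≤ k r) (hN : 0 < N)
    (hkD : 8 * ∑' r, k r ≤ D) {n : ℕ} {b b' : ℝ} {κ : Multiset (Freq N d) → ℂ}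
    (hb : LabelBound (n + 1) b κ) (hb0 : 0 ≤ b) (hb' : n = 0 ∨ LabelBound n b' κ) (hb0' : 0 ≤ b')
    {S : Multiset (Freq N d × Fin N)} {U : Finset (Fin N)} {h : Fin N → Fin N}
    (hS : S.card = n + 1) (hL : Labelled S U h) :
    ‖hierarchyRHS B w (fun q => pairFreq q.1 q.2.1 q.2.2) κ (S.map Prod.fst) +
        ((S.map fun x => B x.1 x.1).sum : ℝ) * κ (S.map Prod.fst)‖ ≤
      (S.map fun x => B x.1 x.1).sum * ((b / 2 + n * b') * labelWeight S U) := by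
  have hW := labelWeight_nonneg S U
  have hB0 : ∀ a, 0 ≤ B a a := fun a => by
    rw [H.diag]
    exact mul_nonneg ((mul_nonneg (by norm_num) (tsum_nonneg hk)).trans hkD) (sqFreq_nonneg _)
  have hdiag : zmul (fun a => (-(B a a : ℂ)) • shift a κ) (S.map Prod.fst) +
      ((S.map fun x => B x.1 x.1).sum : ℝ) * κ (S.map Prod.fst) = 0 := by
    have h1 : zmul (fun a => (-(B a a : ℂ)) • shift a κ) (S.map Prod.fst) =
        ((S.map Prod.fst).map fun a => -(B a a : ℂ) * κ (S.map Prod.fst)).sum := by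
      unfold zmul
      congr 1
      refine Multiset.map_congr rfl fun a ha => ?_
      beta_reduce
      rw [Pi.smul_apply, shift, Multiset.cons_erase ha, smul_eq_mul]
    have h5 := map_multiset_sum Complex.ofRealHom (S.map fun x => B x.1 x.1)
    rw [Multiset.map_map] at h5
    change (((S.map fun x => B x.1 x.1).sum : ℝ) : ℂ) = _ at h5
    rw [h1, h5, Multiset.sum_map_mul_right, Multiset.sum_map_neg, Multiset.map_map]
    simp
  unfold hierarchyRHS
  rw [Pi.add_apply, Pi.add_apply, add_right_comm, add_right_comm (zmul _ _), hdiag, zero_add]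
  have h2 : ‖zmul (fun a s => ∑' q, w q a * κ ((a + pairFreq q.1 q.2.1 q.2.2) ::ₘ s))
      (S.map Prod.fst)‖ ≤ (S.map fun x => B x.1 x.1 * (b / 2 * labelWeight S U)).sum := by
    refine norm_zmul_map_le _ _ _ fun x hx => ?_
    have hx' := Multiset.cons_erase hx
    have := norm_tsum_interaction_le H hk hN hb hb0 (x := x) (S := S.erase x) (U := U) (h := h)
      (by rw [hx', hS]) (by rwa [hx'])
    rw [hx'] at this
    refine this.trans ?_
    rw [H.diag]
    -- Half of the diffusion suffices to absorb the interaction.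
    have h3 : 4 * (∑' r, k r) ≤ D / 2 := by linarith
    calc sqFreq x.1 * (4 * (∑' r, k r) * b * labelWeight S U)
        = (4 * (∑' r, k r)) * (sqFreq x.1 * b * labelWeight S U) := by ring
      _ ≤ (D / 2) * (sqFreq x.1 * b * labelWeight S U) :=
        mul_le_mul_of_nonneg_right h3 (mul_nonneg (mul_nonneg (sqFreq_nonneg _) hb0) hW)
      _ = _ := by ring
  have h3 : ‖zmul (fun a => zmul fun b => (-(B a b : ℂ)) • shift (a + b) κ) (S.map Prod.fst)‖ ≤
      (S.map fun x => ((S.erase x).map fun y =>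
        (B x.1 x.1 * (b' * labelWeight S U) + B y.1 y.1 * (b' * labelWeight S U)) / 2).sum).sum := by
    refine norm_zmul_map_le _ _ _ fun x hx => ?_
    refine norm_zmul_map_le _ _ _ fun y hy => ?_
    have hx' := Multiset.cons_erase hx
    have hy' := Multiset.cons_erase hy
    have hn : n ≠ 0 := by
      rintro rfl
      have h1 := congrArg Multiset.card hx'
      have h2 := congrArg Multiset.card hy'
      simp at h1 h2
      omega
    have hb' := hb'.resolve_left hn
    rw [Pi.smul_apply, norm_smul, norm_neg, Complex.norm_real, shift]
    by_cases hxy : B x.1 y.1 = 0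
    · rw [hxy, norm_zero, zero_mul]
      have := hB0 x.1
      have := hB0 y.1
      positivity
    · obtain ⟨i, hi1, hi2⟩ := H.overlap _ _ hxy
      have := hb'.merge (x := x) (y := y) (S := (S.erase x).erase y) (U := U) (h := h)
        (by rw [hy', hx', hS]) (by rwa [hy', hx']) hi1 hi2
      rw [hy', hx'] at this
      calc _ ≤ (B x.1 x.1 + B y.1 y.1) / 2 * (b' * labelWeight S U) :=
            mul_le_mul (H.abs_le _ _) this (norm_nonneg _)
              (by have := hB0 x.1; have := hB0 y.1; positivity)
        _ = _ := by ring
  rw [sum_sum_erase_half S fun x => B x.1 x.1 * (b' * labelWeight S U)] at h3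
  refine (norm_add_le _ _).trans ((add_le_add h2 h3).trans_eq ?_)
  rw [Multiset.sum_map_mul_right, Multiset.sum_map_mul_right, hS]
  push_cast
  ring

end Estimate

/-! ### Bootstrap of the uniform cumulant bound. -/

section Estimate

variable {d N : ℕ} {D : ℝ} {k : (Fin d → ℤ) × (Fin d → ℤ) → ℝ} {B : Freq N d →+ Freq N d →+ ℝ}
  {w : Fin N × Fin N × ((Fin d → ℤ) × (Fin d → ℤ)) → Freq N d →+ ℂ}

/-- The moments `M` evolve according to a mean-field interaction, from a product measure. -/
structure IsMeanFieldEvolution (B : Freq N d →+ Freq N d →+ ℝ)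
    (w : Fin N × Fin N × ((Fin d → ℤ) × (Fin d → ℤ)) → Freq N d →+ ℂ)
    (M : ℝ → Freq N d → ℂ) : Prop where
  zero : ∀ t, M t 0 = 1
  norm_le : ∀ t l, ‖M t l‖ ≤ 1
  continuousOn : ∀ l, ContinuousOn (fun t => M t l) (Set.Ici 0)
  deriv : ∀ x, 0 ≤ x → ∀ l, HasDerivWithinAt (fun t => M t l)
      (-(B l l : ℂ) * M x l + ∑' q, w q l * M x (l + pairFreq q.1 q.2.1 q.2.2)) (Set.Ici x) x
  factor : ∀ a b, (∀ i, a i = 0 ∨ b i = 0) → M 0 (a + b) = M 0 a * M 0 b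

variable {M : ℝ → Freq N d → ℂ}

lemma IsMeanFieldEvolution.norm_kap_le (E : IsMeanFieldEvolution B w M) (t : ℝ) {n : ℕ}
    {s : Multiset (Freq N d)} (hs : s.card = n + 1) :
    ‖kap (mom (M t)) s‖ ≤ 2 ^ n * n.factorial := by
  obtain ⟨a, ha⟩ := Multiset.exists_mem_of_ne_zero (s := s) (by rintro rfl; simp at hs)
  obtain ⟨s, rfl⟩ := Multiset.exists_cons_of_mem ha
  obtain rfl : s.card = n := by simpa using hs
  exact norm_kap_cons_le (by simp [E.zero]) (fun s => E.norm_le _ _) a s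

/-- With two or more labels, the frequencies of one label and the rest involve disjoint sets of
particles, independent at time 0, so the cumulant vanishes. With one label the weight is 1 and the
absolute bound is enough. -/
lemma IsMeanFieldEvolution.labelBound_zero (E : IsMeanFieldEvolution B w M) (n : ℕ) :
    LabelBound (n + 1) (2 ^ n * n.factorial) (kap (mom (M 0))) := by
  classical
  intro S U h hS hL
  have hpos := numLabels_pos (S := S) (by rintro rfl; simp at hS)
  rcases (Nat.lt_or_ge 1 (numLabels S)) with h1 | h1
  · obtain ⟨g, hg, g', hg', hne⟩ := Finset.one_lt_card.1 h1
    rw [Multiset.mem_toFinset, Multiset.mem_map] at hg hg'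
    obtain ⟨x, hx, rfl⟩ := hg
    obtain ⟨y, hy, rfl⟩ := hg'
    set t := S.filter fun z => z.2 = x.2 with ht
    set u := S.filter fun z => ¬ z.2 = x.2 with hu
    have htu : t + u = S := Multiset.filter_add_not _ S
    have key := kap_eq_zero_of_factor (μ := mom (M 0)) (by simp [mom, E.zero])
      (P := fun a => ∀ i, h i ≠ x.2 → a i = 0) (Q := fun a => ∀ i, h i = x.2 → a i = 0)
      (t := t.map Prod.fst) (u := u.map Prod.fst) (by
        intro t u ht hu
        simp only [mom, Multiset.sum_add]
        have h0 : ∀ (v : Multiset (Freq N d)) (i : Fin N), (∀ a ∈ v, a i = 0) → v.sum i = 0 := by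
          intro v i hv
          have := map_multiset_sum (Pi.evalAddMonoidHom (fun _ : Fin N => Fin d → ℤ) i) v
          refine this.trans (Multiset.sum_eq_zero ?_)
          intro z hz
          obtain ⟨a, ha, rfl⟩ := Multiset.mem_map.1 hz
          exact hv a ha
        refine E.factor _ _ fun i => ?_
        by_cases hi : h i = x.2
        · exact Or.inr (h0 u i fun a ha => hu a ha i hi)
        · exact Or.inl (h0 t i fun a ha => ht a ha i hi))
      (by
        intro a ha i hi
        obtain ⟨z, hz, rfl⟩ := Multiset.mem_map.1 ha
        rw [ht, Multiset.mem_filter] at hz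
        by_contra hc
        exact hi ((hL.supp z hz.1 i hc).2.trans hz.2))
      (by
        intro a ha i hi
        obtain ⟨z, hz, rfl⟩ := Multiset.mem_map.1 ha
        rw [hu, Multiset.mem_filter] at hz
        by_contra hc
        exact hz.2 ((hL.supp z hz.1 i hc).2.symm.trans hi))
      (by
        intro hc
        have : x.1 ∈ t.map Prod.fst := Multiset.mem_map_of_mem _ (Multiset.mem_filter.2 ⟨hx, rfl⟩)
        simp [hc] at this)
      (by
        intro hc
        have : y.1 ∈ u.map Prod.fst :=
          Multiset.mem_map_of_mem _ (Multiset.mem_filter.2 ⟨hy, fun h => hne h.symm⟩)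
        simp [hc] at this)
    rw [← Multiset.map_add, htu] at key
    rw [key, norm_zero]
    exact mul_nonneg (by positivity) (labelWeight_nonneg S U)
  · have h2 : numLabels S = 1 := le_antisymm h1 hpos
    rw [labelWeight, h2, Nat.sub_self, pow_zero, mul_one]
    exact E.norm_kap_le 0 (by simpa using hS)

/-- The weight is never below N^(-n), so a finite, though N-dependent, constant is available at all
times to start the bootstrap. -/
lemma IsMeanFieldEvolution.labelBound_apriori (E : IsMeanFieldEvolution B w M) (hN : 0 < N) (n : ℕ)
    (t : ℝ) : LabelBound (n + 1) (2 ^ n * n.factorial * N ^ n) (kap (mom (M t))) := by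
  intro S U h hS hL
  have hN' : (0 : ℝ) < N := by exact_mod_cast hN
  have hpos := numLabels_pos (S := S) (by rintro rfl; simp at hS)
  have hle := numLabels_le_card S
  refine (E.norm_kap_le t (s := S.map Prod.fst) (by simpa using hS)).trans ?_
  have h1 : (1 : ℝ) ≤ N ^ n * labelWeight S U := by
    have h2 : 1 / (N : ℝ) ≤ (U.card : ℝ) / N := by
      have : (1 : ℝ) ≤ U.card := by exact_mod_cast hpos.trans_le hL.le_card
      gcongr
    have hN1 : 1 / (N : ℝ) ≤ 1 := (div_le_one hN').2 (by exact_mod_cast hN)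
    have h3 : (1 / (N : ℝ)) ^ n ≤ labelWeight S U :=
      (pow_le_pow_of_le_one (by positivity) hN1 (by omega)).trans
        (pow_le_pow_left₀ (by positivity) h2 _)
    calc (1 : ℝ) = N ^ n * (1 / (N : ℝ)) ^ n := by
          rw [← mul_pow, mul_one_div_cancel hN'.ne', one_pow]
      _ ≤ _ := mul_le_mul_of_nonneg_left h3 (by positivity)
  calc (2 ^ n * n.factorial : ℝ) = 2 ^ n * n.factorial * 1 := (mul_one _).symm
    _ ≤ 2 ^ n * n.factorial * (N ^ n * labelWeight S U) :=
      mul_le_mul_of_nonneg_left h1 (by positivity)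
    _ = _ := by ring

/-- Uniform-in-time decay of the joint cumulants. -/
theorem IsMeanFieldEvolution.labelBound (E : IsMeanFieldEvolution B w M)
    (H : MeanFieldData N d D k B w) (hk : ∀ r, 0 ≤ k r) (hN : 0 < N)
    (hkD : 8 * ∑' r, k r ≤ D) (n : ℕ) {t : ℝ} (ht : 0 ≤ t) :
    LabelBound (n + 1) (2 ^ n * n.factorial) (kap (mom (M t))) := by
  induction n generalizing t with
  | zero =>
    intro S U h hS hL
    have hpos := numLabels_pos (S := S) (by rintro rfl; simp at hS)
    have h2 : numLabels S = 1 := le_antisymm ((numLabels_le_card S).trans_eq hS) hpos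
    rw [labelWeight, h2, Nat.sub_self, pow_zero (_ / _), mul_one]
    exact E.norm_kap_le t (by simpa using hS)
  | succ n ih =>
    set X : ℝ := 2 ^ (n + 1) * (n + 1).factorial with hX
    have hX0 : 0 ≤ X := by positivity
    -- One pass of the maximum principle halves the excess of the constant over X.
    have step : ∀ e : ℝ, 0 ≤ e →
        (∀ t, 0 ≤ t → LabelBound (n + 2) (X + e) (kap (mom (M t)))) →
        ∀ t, 0 ≤ t → LabelBound (n + 2) (X + e / 2) (kap (mom (M t))) := by
      intro e he hb t ht S U h hS hL
      have hW := labelWeight_nonneg S U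
      have hm0 : ∀ t, mom (M t) 0 = 1 := fun t => by simp [mom, E.zero]
      refine norm_le_of_damped (D := (S.map fun x => B x.1 x.1).sum)
        (f := fun t => kap (mom (M t)) (S.map Prod.fst))
        (f' := fun t => hierarchyRHS B w (fun q => pairFreq q.1 q.2.1 q.2.2) (kap (mom (M t)))
          (S.map Prod.fst)) ?_ ?_ ?_ ?_ ht
      · exact kap_mem_of_closed (fun f => ContinuousOn f (Set.Ici 0))
          (fun c => continuousOn_const) (fun f g hf hg => hf.add hg)
          (fun f g hf hg => hf.mul hg) (fun s => E.continuousOn s.sum) _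
      · intro x hx
        exact hasDerivWithinAt_kap_mom E.zero E.norm_le B w _ H.summable_weight (E.deriv x hx) _
      · intro x hx
        have := norm_hierarchyRHS_add_le H hk hN hkD (hb x hx) (by positivity) (Or.inr (ih hx))
          (by positivity) hS hL
        refine this.trans_eq ?_
        -- The choice of constants makes (n + 1) · 2^n n! = X/2, so (X + e)/2 + X/2 = X + e/2.
        congr 2
        rw [hX, Nat.factorial_succ, pow_succ]
        push_cast
        ring
      · refine (E.labelBound_zero (n + 1) S U h hS hL).trans ?_
        refine mul_le_mul_of_nonneg_right ?_ hW
        rw [← hX]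
        linarith
    have hiter : ∀ j : ℕ, ∀ t, 0 ≤ t →
        LabelBound (n + 2) (X + X * N ^ (n + 1) / 2 ^ j) (kap (mom (M t))) := by
      intro j
      induction j with
      | zero =>
        intro t _ S U h hS hL
        refine (E.labelBound_apriori hN (n + 1) t S U h hS hL).trans ?_
        refine mul_le_mul_of_nonneg_right ?_ (labelWeight_nonneg S U)
        rw [pow_zero, div_one, ← hX]
        linarith
      | succ j ihj =>
        have := step _ (by positivity) ihj
        rwa [div_div, ← pow_succ] at this
    intro S U h hS hL
    have hlim : Filter.Tendsto (fun j : ℕ => (X + X * N ^ (n + 1) / 2 ^ j) * labelWeight S U)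
        Filter.atTop (nhds ((X + 0) * labelWeight S U)) := by
      refine Filter.Tendsto.mul_const _ (Filter.Tendsto.const_add _ ?_)
      have := (tendsto_pow_atTop_nhds_zero_of_lt_one (r := (1 / 2 : ℝ)) (by norm_num)
        (by norm_num)).const_mul (X * (N : ℝ) ^ (n + 1))
      rw [mul_zero] at this
      refine this.congr fun j => ?_
      rw [one_div, inv_pow, div_eq_mul_inv]
    rw [add_zero] at hlim
    exact ge_of_tendsto' hlim fun j => hiter j t ht S U h hS hL

end Estimate

/-! ### Exponentials on the configuration space -/

section Expo

variable {d N : ℕ}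

/-- The exponential `e_l` on the configuration space of `N` particles. -/
noncomputable def expo (l : Freq N d) (x : Fin N → Torus d) : ℂ :=
  ∏ i, UnitAddTorus.mFourier (l i) (x i)

/-- The pairing of a frequency with a displacement of the particles. -/
def dotp (l : Freq N d) (v : Fin N → EuclideanSpace ℝ (Fin d)) : ℝ :=
  ∑ i, ∑ k, (l i k : ℝ) * v i k

lemma continuous_expo (l : Freq N d) : Continuous (expo l) := by
  unfold expo
  refine continuous_finsetProd _ fun i _ => ?_
  exact (UnitAddTorus.mFourier (l i)).continuous.comp (continuous_apply i)

lemma norm_mFourier_apply (n : Fin d → ℤ) (x : Torus d) : ‖UnitAddTorus.mFourier n x‖ = 1 := by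
  simp only [UnitAddTorus.mFourier, ContinuousMap.coe_mk, norm_prod]
  exact Finset.prod_eq_one fun i _ => by rw [fourier_apply, Circle.norm_coe]

lemma norm_expo (l : Freq N d) (x : Fin N → Torus d) : ‖expo l x‖ = 1 := by
  unfold expo
  rw [norm_prod]
  exact Finset.prod_eq_one fun i _ => norm_mFourier_apply _ _

lemma expo_zero (x : Fin N → Torus d) : expo 0 x = 1 := by
  simp [expo, UnitAddTorus.mFourier_zero]

lemma expo_add (l l' : Freq N d) (x : Fin N → Torus d) :
    expo (l + l') x = expo l x * expo l' x := by
  unfold expo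
  rw [← Finset.prod_mul_distrib]
  exact Finset.prod_congr rfl fun i _ => UnitAddTorus.mFourier_add

lemma expo_single (i : Fin N) (a : Fin d → ℤ) (x : Fin N → Torus d) :
    expo (Pi.single i a) x = UnitAddTorus.mFourier a (x i) := by
  unfold expo
  rw [Finset.prod_eq_single i]
  · simp
  · intro j _ hj
    simp [Pi.single_eq_of_ne hj, UnitAddTorus.mFourier_zero]
  · simp

lemma toTorus_add (v v' : Fin d → ℝ) : toTorus (v + v') = toTorus v + toTorus v' := by
  funext k
  exact AddCircle.coe_add _ _ _

lemma mFourier_add_toTorus (n : Fin d → ℤ) (x : Torus d) (v : Fin d → ℝ) :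
    UnitAddTorus.mFourier n (x + toTorus v) =
      UnitAddTorus.mFourier n x * Complex.exp (Complex.I * (2 * Real.pi * ∑ k, n k * v k : ℝ)) := by
  simp only [UnitAddTorus.mFourier, ContinuousMap.coe_mk, Pi.add_apply]
  have h : ∀ k, fourier (n k) (x k + toTorus v k) = fourier (n k) (x k) *
      Complex.exp (Complex.I * (2 * Real.pi * (n k * v k) : ℝ)) := by
    intro k
    rw [fourier_apply, fourier_apply, smul_add, AddCircle.toCircle_add, Circle.coe_mul]
    congr 1
    rw [toTorus, fourier_coe_apply']
    congr 1
    push_cast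
    ring
  simp_rw [h]
  rw [Finset.prod_mul_distrib, ← Complex.exp_sum, ← Finset.mul_sum, ← Complex.ofReal_sum,
    ← Finset.mul_sum]

lemma expo_add_toTorus (l : Freq N d) (x : Fin N → Torus d)
    (v : Fin N → EuclideanSpace ℝ (Fin d)) :
    expo l (fun i => x i + toTorus (WithLp.ofLp (v i))) =
      expo l x * Complex.exp (Complex.I * (2 * Real.pi * dotp l v : ℝ)) := by
  unfold expo dotp
  simp_rw [mFourier_add_toTorus]
  rw [Finset.prod_mul_distrib, ← Complex.exp_sum, ← Finset.mul_sum, ← Complex.ofReal_sum,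
    ← Finset.mul_sum]

lemma dotp_add (l : Freq N d) (v v' : Fin N → EuclideanSpace ℝ (Fin d)) :
    dotp l (v + v') = dotp l v + dotp l v' := by
  simp [dotp, mul_add, Finset.sum_add_distrib]

lemma dotp_smul (l : Freq N d) (c : ℝ) (v : Fin N → EuclideanSpace ℝ (Fin d)) :
    dotp l (c • v) = c * dotp l v := by
  simp only [dotp, Finset.mul_sum, Pi.smul_apply, PiLp.smul_apply, smul_eq_mul]
  exact Finset.sum_congr rfl fun i _ => Finset.sum_congr rfl fun k _ => by ring

lemma abs_dotp_le (l : Freq N d) {v : Fin N → EuclideanSpace ℝ (Fin d)} {c : ℝ}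
    (hv : ∀ i, ‖v i‖ ≤ c) : |dotp l v| ≤ (∑ i, ∑ k, |(l i k : ℝ)|) * c := by
  unfold dotp
  rw [Finset.sum_mul]
  refine (Finset.abs_sum_le_sum_abs _ _).trans (Finset.sum_le_sum fun i _ => ?_)
  rw [Finset.sum_mul]
  refine (Finset.abs_sum_le_sum_abs _ _).trans (Finset.sum_le_sum fun k _ => ?_)
  rw [abs_mul]
  exact mul_le_mul_of_nonneg_left ((PiLp.norm_apply_le (v i) k).trans (hv i)) (abs_nonneg _)

lemma continuous_dotp (l : Freq N d) : Continuous (dotp (N := N) (d := d) l) := by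
  unfold dotp
  fun_prop

/-- The drift of the particle system. -/
noncomputable def drift (K : Torus d → Torus d → EuclideanSpace ℝ (Fin d))
    (x : Fin N → Torus d) (i : Fin N) : EuclideanSpace ℝ (Fin d) :=
  (N : ℝ)⁻¹ • ∑ j : Fin N, K (x i) (x j)

lemma continuous_drift {K : Torus d → Torus d → EuclideanSpace ℝ (Fin d)}
    (hK : Continuous fun p : Torus d × Torus d => K p.1 p.2) :
    Continuous (drift (N := N) K) := by
  refine continuous_pi fun i => ?_
  have h : ∀ j, Continuous fun x : Fin N → Torus d => K (x i) (x j) := fun j => ?_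
  · exact Continuous.const_smul (continuous_finsetSum Finset.univ fun j _ => h j) ((N : ℝ)⁻¹)
  exact hK.comp (f := fun x : Fin N → Torus d => (x i, x j)) (by fun_prop)

lemma exists_norm_drift_le {K : Torus d → Torus d → EuclideanSpace ℝ (Fin d)}
    (hK : Continuous fun p : Torus d × Torus d => K p.1 p.2) :
    ∃ c : ℝ, 0 ≤ c ∧ ∀ (x : Fin N → Torus d) i, ‖drift K x i‖ ≤ c := by
  obtain ⟨c, hc⟩ := (isCompact_range (continuous_drift (N := N) hK)).isBounded.exists_norm_le
  refine ⟨max c 0, le_max_right _ _, fun x i => (norm_le_pi_norm (drift K x) i).trans ?_⟩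
  exact (hc _ (Set.mem_range_self x)).trans (le_max_left _ _)

/-- The Fourier series of a component of the kernel. -/
lemma hasSum_kernel {K : Torus d → Torus d → EuclideanSpace ℝ (Fin d)}
    (hK : Continuous fun p : Torus d × Torus d => K p.1 p.2)
    (hKsum : Summable fun p : (Fin d → ℤ) × (Fin d → ℤ) => ‖kernelFourierCoeff K p.1 p.2‖)
    (x y : Torus d) (k : Fin d) :
    HasSum (fun r : (Fin d → ℤ) × (Fin d → ℤ) => kernelFourierCoeff K r.1 r.2 k *
      (UnitAddTorus.mFourier r.1 x * UnitAddTorus.mFourier r.2 y)) ((K x y k : ℝ) : ℂ) := by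
  set f : C(UnitAddTorus (Fin d ⊕ Fin d), ℂ) := ⟨fun z =>
    ((K (fun k => z (Sum.inl k)) (fun k => z (Sum.inr k)) k : ℝ) : ℂ), by
      refine Complex.continuous_ofReal.comp ?_
      have h1 : Continuous fun z : UnitAddTorus (Fin d ⊕ Fin d) =>
          K (fun k => z (Sum.inl k)) (fun k => z (Sum.inr k)) :=
        hK.comp (f := fun z : UnitAddTorus (Fin d ⊕ Fin d) =>
          ((fun k => z (Sum.inl k) : Torus d), (fun k => z (Sum.inr k) : Torus d))) (by fun_prop)
      fun_prop⟩ with hf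
  set e : ((Fin d → ℤ) × (Fin d → ℤ)) ≃ (Fin d ⊕ Fin d → ℤ) :=
    (Equiv.sumArrowEquivProdArrow (Fin d) (Fin d) ℤ).symm with he
  have hcoeff : ∀ r, UnitAddTorus.mFourierCoeff f (e r) = kernelFourierCoeff K r.1 r.2 k :=
    fun r => rfl
  have hs : Summable (UnitAddTorus.mFourierCoeff f) := by
    rw [← e.summable_iff]
    refine Summable.of_norm_bounded hKsum fun r => ?_
    change ‖UnitAddTorus.mFourierCoeff f (e r)‖ ≤ _
    rw [hcoeff]
    exact PiLp.norm_apply_le (kernelFourierCoeff K r.1 r.2) k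
  have h := UnitAddTorus.hasSum_mFourier_series_apply_of_summable hs (Sum.elim x y)
  rw [← e.hasSum_iff] at h
  have heq : (fun r : (Fin d → ℤ) × (Fin d → ℤ) => kernelFourierCoeff K r.1 r.2 k *
      (UnitAddTorus.mFourier r.1 x * UnitAddTorus.mFourier r.2 y)) =
      (fun i => UnitAddTorus.mFourierCoeff f i • UnitAddTorus.mFourier i (Sum.elim x y)) ∘ e := by
    funext r
    rw [Function.comp_apply, hcoeff, smul_eq_mul]
    congr 1
    simp only [UnitAddTorus.mFourier, ContinuousMap.coe_mk, Fintype.prod_sum_type, Sum.elim_inl,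
      Sum.elim_inr]
    rfl
  rw [heq]
  exact h

end Expo

/-! ### The evolution of the Fourier moments of the particle system -/

section Moments

variable {d N : ℕ} {Ω : Type*} {mΩ : MeasurableSpace Ω} {P : Measure Ω}
  {ℱ : Filtration ℝ≥0 mΩ} {W : ℝ≥0 → Ω → Fin N → EuclideanSpace ℝ (Fin d)}
  {X : ℝ≥0 → Ω → Fin N → Torus d} {K : Torus d → Torus d → EuclideanSpace ℝ (Fin d)} {σ : ℝ}
  {ρ₀ : Torus d → ℝ}

/-- The Fourier coefficients of the law of the particles at time `t`. -/
noncomputable def fourierMoment (P : Measure Ω) (X : ℝ≥0 → Ω → Fin N → Torus d) (t : ℝ)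
    (l : Freq N d) : ℂ :=
  ∫ ω, expo l (X t.toNNReal ω) ∂P

/-- The Brownian characters `exp(2πi √(2σ) l · (W_t - W_s))`. -/
noncomputable def noise (σ : ℝ) (W : ℝ≥0 → Ω → Fin N → EuclideanSpace ℝ (Fin d)) (l : Freq N d)
    (s t : ℝ) (ω : Ω) : ℂ :=
  Complex.exp (Complex.I *
    (2 * Real.pi * (Real.sqrt (2 * σ) * dotp l (W t.toNNReal ω - W s.toNNReal ω)) : ℝ))

lemma IsParticleSystem.measurable (h : IsParticleSystem K σ ρ₀ P ℱ W X) (t : ℝ≥0) :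
    Measurable (X t) := (h.adapted t).mono (ℱ.le t) le_rfl

lemma IsParticleSystem.measurable_noise (h : IsParticleSystem K σ ρ₀ P ℱ W X) (l : Freq N d)
    (s t : ℝ) : Measurable (noise σ W l s t) := by
  have hW : ∀ t, Measurable (W t) := fun t => (h.brownian.adapted t).mono (ℱ.le t) le_rfl
  have h1 : Measurable fun ω => dotp l (W t.toNNReal ω - W s.toNNReal ω) :=
    (continuous_dotp l).measurable.comp ((hW _).sub (hW _))
  unfold noise
  fun_prop

lemma norm_noise (l : Freq N d) (s t : ℝ) (ω : Ω) : ‖noise σ W l s t ω‖ = 1 := by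
  rw [noise, Complex.norm_exp_I_mul_ofReal]

/-- Independence of the coordinates splits the expectation into one-dimensional Gaussian
characteristic functions of variance t - s. -/
lemma IsBrownianFamily.integral_noise (h : IsBrownianFamily P ℱ W) (hσ : 0 ≤ σ) (l : Freq N d)
    {s t : ℝ} (hs : 0 ≤ s) (hst : s ≤ t) :
    ∫ ω, noise σ W l s t ω ∂P =
      Complex.exp (-(4 * Real.pi ^ 2 * σ * sqFreq l * (t - s) : ℝ)) := by
  set c : Fin N × Fin d → ℝ := fun p => 2 * Real.pi * Real.sqrt (2 * σ) * l p.1 p.2 with hc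
  have hW : ∀ t, Measurable (W t) := fun t => (h.adapted t).mono (ℱ.le t) le_rfl
  have h1 : ∀ ω, noise σ W l s t ω = ∏ p : Fin N × Fin d, Complex.exp
      (c p * ((W t.toNNReal ω p.1 p.2 - W s.toNNReal ω p.1 p.2 : ℝ) : ℂ) * Complex.I) := by
    intro ω
    rw [noise, ← Complex.exp_sum, dotp, ← Finset.sum_mul]
    congr 1
    rw [mul_comm, Fintype.sum_prod_type]
    congr 1
    simp only [hc]
    push_cast
    simp only [Finset.mul_sum, Pi.sub_apply, PiLp.sub_apply]
    refine Finset.sum_congr rfl fun i _ => Finset.sum_congr rfl fun k _ => ?_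
    push_cast
    ring
  simp_rw [h1]
  have h2 := h.indep.integral_fun_prod_comp (f := fun p (y : ℝ≥0 → ℝ) => Complex.exp
      (c p * ((y t.toNNReal - y s.toNNReal : ℝ) : ℂ) * Complex.I)) (fun p => by
    refine (measurable_pi_iff.2 fun t => ?_).aemeasurable
    have := hW t
    fun_prop) (fun p => by
    refine Measurable.aestronglyMeasurable ?_
    fun_prop)
  rw [h2]
  have h3 : ∀ p : Fin N × Fin d, ∫ ω, Complex.exp
      (c p * ((W t.toNNReal ω p.1 p.2 - W s.toNNReal ω p.1 p.2 : ℝ) : ℂ) * Complex.I) ∂P =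
      Complex.exp (-((t - s) * c p ^ 2 / 2 : ℝ)) := by
    intro p
    have hl : HasLaw ((fun ω => W t.toNNReal ω p.1 p.2) - fun ω => W s.toNNReal ω p.1 p.2)
        (gaussianReal 0 (t - s).toNNReal) P := by
      have hl := (h.brownian p.1 p.2).toIsPreBrownianReal.hasLaw_sub t.toNNReal s.toNNReal
      have e : nndist t.toNNReal.1 s.toNNReal.1 = (t - s).toNNReal := by
        refine NNReal.eq ?_
        rw [coe_nndist, Real.coe_toNNReal _ (sub_nonneg.2 hst), Real.dist_eq]
        change |(t.toNNReal : ℝ) - (s.toNNReal : ℝ)| = _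
        rw [Real.coe_toNNReal t (hs.trans hst), Real.coe_toNNReal s hs,
          abs_of_nonneg (by linarith)]
      rwa [e] at hl
    have h4 := hl.integral_comp (f := fun x : ℝ => Complex.exp (c p * (x : ℂ) * Complex.I))
      (Measurable.aestronglyMeasurable (by fun_prop))
    rw [← charFun_apply_real, charFun_gaussianReal] at h4
    refine h4.trans ?_
    have h6 : (((t - s).toNNReal : ℝ) : ℂ) = ((t - s : ℝ) : ℂ) := by
      rw [Real.coe_toNNReal _ (sub_nonneg.2 hst)]
    rw [h6]
    congr 1
    push_cast
    ring
  simp_rw [h3]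
  rw [← Complex.exp_sum]
  congr 1
  rw [Fintype.sum_prod_type]
  simp only [← Complex.ofReal_neg, ← Complex.ofReal_sum]
  congr 1
  simp only [hc, sqFreq, Finset.mul_sum, Finset.sum_mul, ← Finset.sum_neg_distrib]
  refine Finset.sum_congr rfl fun i _ => Finset.sum_congr rfl fun k _ => ?_
  have h6 := Real.sq_sqrt (show (0 : ℝ) ≤ 2 * σ by positivity)
  linear_combination (-(t - s) / 2 * (2 * Real.pi) ^ 2 * (l i k : ℝ) ^ 2) * h6

lemma IsParticleSystem.integral_expo_mul_noise (h : IsParticleSystem K σ ρ₀ P ℱ W X) (hσ : 0 ≤ σ)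
    (l : Freq N d) {s t : ℝ} (hs : 0 ≤ s) (hst : s ≤ t) :
    ∫ ω, expo l (X s.toNNReal ω) * noise σ W l s t ω ∂P = fourierMoment P X s l *
      Complex.exp (-(4 * Real.pi ^ 2 * σ * sqFreq l * (t - s) : ℝ)) := by
  rw [← h.brownian.integral_noise hσ l hs hst]
  have hW : ∀ t, Measurable (W t) := fun t => (h.brownian.adapted t).mono (ℱ.le t) le_rfl
  have h1 := h.brownian.indep_past s.toNNReal t.toNNReal (Real.toNNReal_le_toNNReal hst)
  have h2 : IndepFun (X s.toNNReal) (fun ω => W t.toNNReal ω - W s.toNNReal ω) P :=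
    (indep_of_indep_of_le_right h1 (h.adapted s.toNNReal).comap_le).symm
  exact h2.integral_fun_comp_mul_comp (f := expo l) (g := fun v => Complex.exp (Complex.I *
      (2 * Real.pi * (Real.sqrt (2 * σ) * dotp l v) : ℝ))) (h.measurable _).aemeasurable
    ((hW _).sub (hW _)).aemeasurable (continuous_expo l).measurable.aestronglyMeasurable
    (by
      have := (continuous_dotp l).measurable
      exact Measurable.aestronglyMeasurable (by fun_prop))

/-- The almost sure expansion of an exponential of the solution. -/
lemma IsParticleSystem.ae_expo (h : IsParticleSystem K σ ρ₀ P ℱ W X)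
    (hK : Continuous fun p : Torus d × Torus d => K p.1 p.2) :
    ∀ᵐ ω ∂P, ∀ l : Freq N d, ∀ s t : ℝ, 0 ≤ s → s ≤ t → expo l (X t.toNNReal ω) =
      expo l (X s.toNNReal ω) * noise σ W l s t ω * Complex.exp (Complex.I * (2 * Real.pi *
        dotp l (fun i => ∫ r in s..t, drift K (X r.toNNReal ω) i) : ℝ)) := by
  filter_upwards [h.sde, h.continuous_paths] with ω hω hc l s t hs hst
  have hcont : ∀ i, Continuous fun r : ℝ => drift K (X r.toNNReal ω) i := fun i =>
    (continuous_apply i).comp ((continuous_drift hK).comp (hc.comp continuous_real_toNNReal))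
  have ht := hs.trans hst
  -- Subtracting the integrated equations at times s and t leaves a deterministic translation on the
  -- torus, on which an exponential acts as a character.
  have key : X t.toNNReal ω = fun i => X s.toNNReal ω i + toTorus (WithLp.ofLp
      ((Real.sqrt (2 * σ) • (W t.toNNReal ω - W s.toNNReal ω) +
        fun i => ∫ r in s..t, drift K (X r.toNNReal ω) i) i)) := by
    funext i
    have e1 := hω t.toNNReal i
    have e2 := hω s.toNNReal i
    rw [Real.coe_toNNReal t ht] at e1
    rw [Real.coe_toNNReal s hs] at e2
    have e3 : ∫ r in (0 : ℝ)..t, drift K (X r.toNNReal ω) i =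
        (∫ r in (0 : ℝ)..s, drift K (X r.toNNReal ω) i) +
          ∫ r in s..t, drift K (X r.toNNReal ω) i :=
      (intervalIntegral.integral_add_adjacent_intervals ((hcont i).intervalIntegrable _ _)
        ((hcont i).intervalIntegrable _ _)).symm
    change X t.toNNReal ω i = X 0 ω i + toTorus (WithLp.ofLp
      ((∫ r in (0 : ℝ)..t, drift K (X r.toNNReal ω) i) + _)) at e1
    change X s.toNNReal ω i = X 0 ω i + toTorus (WithLp.ofLp
      ((∫ r in (0 : ℝ)..s, drift K (X r.toNNReal ω) i) + _)) at e2
    rw [e1, e2, e3, add_assoc (X 0 ω i), ← toTorus_add]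
    have e4 : ∀ a b w v : EuclideanSpace ℝ (Fin d), a + b + w = a + v + (w - v + b) := by
      intro a b w v; abel
    rw [e4 _ _ _ (Real.sqrt (2 * σ) • W s.toNNReal ω i)]
    simp only [Pi.add_apply, Pi.smul_apply, Pi.sub_apply, smul_sub, WithLp.ofLp_add]
  rw [key, expo_add_toTorus, dotp_add, dotp_smul, noise, mul_assoc (expo l _), ← Complex.exp_add]
  congr 2
  push_cast
  ring

variable [IsProbabilityMeasure P]

lemma IsParticleSystem.integrable_expo (h : IsParticleSystem K σ ρ₀ P ℱ W X) (t : ℝ≥0)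
    (l : Freq N d) : Integrable (fun ω => expo l (X t ω)) P :=
  Integrable.of_bound ((continuous_expo l).measurable.comp (h.measurable t)).aestronglyMeasurable 1
    (Filter.Eventually.of_forall fun _ => (norm_expo l _).le)

lemma norm_fourierMoment_le (t : ℝ) (l : Freq N d) : ‖fourierMoment P X t l‖ ≤ 1 := by
  refine (norm_integral_le_of_norm_le_const (C := 1)
    (Filter.Eventually.of_forall fun _ => (norm_expo l _).le)).trans ?_
  simp

lemma fourierMoment_zero (t : ℝ) : fourierMoment P X t (0 : Freq N d) = 1 := by
  simp [fourierMoment, expo_zero]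

lemma IsParticleSystem.continuous_fourierMoment (h : IsParticleSystem K σ ρ₀ P ℱ W X)
    (l : Freq N d) : Continuous fun t => fourierMoment P X t l := by
  refine continuous_of_dominated (bound := fun _ => 1)
    (fun t => (h.integrable_expo _ l).aestronglyMeasurable)
    (fun t => Filter.Eventually.of_forall fun _ => (norm_expo l _).le) (integrable_const _) ?_
  filter_upwards [h.continuous_paths] with ω hω
  exact (continuous_expo l).comp (hω.comp continuous_real_toNNReal)

/-- Initial independence makes the moment a product over particles; on each particle one of the two
factors is 1. -/
lemma IsParticleSystem.fourierMoment_factor (h : IsParticleSystem K σ ρ₀ P ℱ W X)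
    {a b : Freq N d} (hab : ∀ i, a i = 0 ∨ b i = 0) :
    fourierMoment P X 0 (a + b) = fourierMoment P X 0 a * fourierMoment P X 0 b := by
  have h1 : ∀ l : Freq N d, fourierMoment P X 0 l =
      ∏ i, ∫ ω, UnitAddTorus.mFourier (l i) (X 0 ω i) ∂P := by
    intro l
    unfold fourierMoment expo
    rw [Real.toNNReal_zero]
    refine h.initial_indep.integral_fun_prod_comp
      (f := fun i x => UnitAddTorus.mFourier (l i) x) (fun i => ?_) (fun i => ?_)
    · exact ((measurable_pi_apply i).comp (h.measurable 0)).aemeasurable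
    · exact (UnitAddTorus.mFourier (l i)).continuous.measurable.aestronglyMeasurable
  rw [h1, h1, h1, ← Finset.prod_mul_distrib]
  refine Finset.prod_congr rfl fun i _ => ?_
  rcases hab i with hi | hi <;> simp [hi, UnitAddTorus.mFourier_zero]

end Moments

/-! ### Right derivative in time of the Fourier moments. -/

section Derivative

open Filter Topology

variable {d N : ℕ} {Ω : Type*} {mΩ : MeasurableSpace Ω} {P : Measure Ω}
  {ℱ : Filtration ℝ≥0 mΩ} {W : ℝ≥0 → Ω → Fin N → EuclideanSpace ℝ (Fin d)}
  {X : ℝ≥0 → Ω → Fin N → Torus d} {K : Torus d → Torus d → EuclideanSpace ℝ (Fin d)} {σ : ℝ}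
  {ρ₀ : Torus d → ℝ}

lemma IsBrownianFamily.ae_continuous (h : IsBrownianFamily P ℱ W) :
    ∀ᵐ ω ∂P, Continuous fun t => W t ω := by
  have h1 : ∀ᵐ ω ∂P, ∀ p : Fin N × Fin d, Continuous fun t => W t ω p.1 p.2 :=
    ae_all_iff.2 fun p => (h.brownian p.1 p.2).cont
  filter_upwards [h1] with ω hω
  refine continuous_pi fun i => ?_
  exact (PiLp.continuous_toLp 2 _).comp (continuous_pi fun k => hω (i, k))

/-- The part of the increment of an exponential due to the drift. -/
noncomputable def driftIncrement (σ : ℝ) (W : ℝ≥0 → Ω → Fin N → EuclideanSpace ℝ (Fin d))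
    (X : ℝ≥0 → Ω → Fin N → Torus d) (l : Freq N d) (s t : ℝ) (ω : Ω) : ℂ :=
  expo l (X t.toNNReal ω) - expo l (X s.toNNReal ω) * noise σ W l s t ω

lemma IsParticleSystem.ae_norm_driftIncrement_le (h : IsParticleSystem K σ ρ₀ P ℱ W X)
    (hK : Continuous fun p : Torus d × Torus d => K p.1 p.2) (l : Freq N d) :
    ∃ C : ℝ, ∀ s t, 0 ≤ s → s ≤ t →
      ∀ᵐ ω ∂P, ‖driftIncrement σ W X l s t ω‖ ≤ C * (t - s) := by
  obtain ⟨c, hc0, hc⟩ := exists_norm_drift_le (N := N) hK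
  refine ⟨2 * Real.pi * ((∑ i, ∑ k, |(l i k : ℝ)|) * c), fun s t hs hst => ?_⟩
  filter_upwards [h.ae_expo hK] with ω hω
  have h1 : driftIncrement σ W X l s t ω = expo l (X s.toNNReal ω) * noise σ W l s t ω *
      (Complex.exp (Complex.I * (2 * Real.pi *
        dotp l (fun i => ∫ r in s..t, drift K (X r.toNNReal ω) i) : ℝ)) - 1) := by
    rw [driftIncrement, hω l s t hs hst]
    ring
  rw [h1, norm_mul, norm_mul, norm_expo, norm_noise, one_mul, one_mul]
  refine Real.norm_exp_I_mul_ofReal_sub_one_le.trans ?_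
  rw [Real.norm_eq_abs, abs_mul, abs_of_nonneg Real.two_pi_pos.le,
    mul_assoc (2 * Real.pi) _ (t - s), mul_assoc _ c]
  refine mul_le_mul_of_nonneg_left ?_ Real.two_pi_pos.le
  refine abs_dotp_le l fun i => ?_
  have := intervalIntegral.norm_integral_le_of_norm_le_const (a := s) (b := t)
    (f := fun r => drift K (X r.toNNReal ω) i) (C := c) fun r _ => hc _ i
  rwa [abs_of_nonneg (by linarith)] at this

lemma IsParticleSystem.ae_tendsto_driftIncrement (h : IsParticleSystem K σ ρ₀ P ℱ W X)
    (hK : Continuous fun p : Torus d × Torus d => K p.1 p.2) (l : Freq N d) {s : ℝ} (hs : 0 ≤ s) :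
    ∀ᵐ ω ∂P, Tendsto (fun t => ((t - s)⁻¹ : ℝ) • driftIncrement σ W X l s t ω) (𝓝[>] s)
      (𝓝 (expo l (X s.toNNReal ω) *
        (Complex.I * (2 * Real.pi * dotp l (drift K (X s.toNNReal ω)) : ℝ)))) := by
  filter_upwards [h.ae_expo hK, h.continuous_paths, h.brownian.ae_continuous] with ω hω hX hW
  set β : ℝ → Fin N → EuclideanSpace ℝ (Fin d) := fun r => drift K (X r.toNNReal ω) with hβ
  have hcont : Continuous β := (continuous_drift hK).comp (hX.comp continuous_real_toNNReal)
  have hθ : HasDerivAt (fun t => dotp l fun i => ∫ r in s..t, β r i) (dotp l (β s)) s := by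
    unfold dotp
    refine HasDerivAt.fun_sum fun i _ => HasDerivAt.fun_sum fun k _ => HasDerivAt.const_mul _ ?_
    have hci : Continuous fun r => β r i := (continuous_apply i).comp hcont
    have := intervalIntegral.integral_hasDerivAt_right (hci.intervalIntegrable s s)
      hci.stronglyMeasurable.stronglyMeasurableAtFilter hci.continuousAt
    exact (EuclideanSpace.proj (𝕜 := ℝ) k).hasFDerivAt.comp_hasDerivAt s this
  have hθ0 : (dotp l fun i => ∫ r in s..s, β r i) = 0 := by simp [dotp]
  have hexp : HasDerivAt (fun t => Complex.exp (Complex.I * (2 * Real.pi *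
      dotp l (fun i => ∫ r in s..t, β r i) : ℝ)))
      (Complex.I * (2 * Real.pi * dotp l (β s) : ℝ)) s := by
    have := ((hθ.const_mul (2 * Real.pi)).ofReal_comp.const_mul Complex.I).cexp
    rw [hθ0] at this
    simpa using this
  have hnoise : Tendsto (fun t => noise σ W l s t ω) (𝓝[>] s) (𝓝 1) := by
    have h1 : Continuous fun t => noise σ W l s t ω := by
      have h2 : Continuous fun t : ℝ => W t.toNNReal ω := hW.comp continuous_real_toNNReal
      have h3 : Continuous fun t : ℝ => dotp l (W t.toNNReal ω - W s.toNNReal ω) :=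
        (continuous_dotp l).comp (h2.sub continuous_const)
      unfold noise
      fun_prop
    have h4 := h1.tendsto s
    have h5 : noise σ W l s s ω = 1 := by simp [noise, dotp]
    rw [h5] at h4
    exact h4.mono_left nhdsWithin_le_nhds
  have hslope := (hasDerivAt_iff_tendsto_slope.1 hexp).mono_left
    (nhdsWithin_mono s (fun t (ht : s < t) => ht.ne'))
  have := (hnoise.mul hslope).const_mul (expo l (X s.toNNReal ω))
  rw [one_mul] at this
  refine this.congr' ?_
  filter_upwards [self_mem_nhdsWithin] with t ht
  rw [driftIncrement, hω l s t hs (le_of_lt ht), slope_def_module, hθ0]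
  simp only [Complex.real_smul, hβ]
  simp
  ring

variable [IsProbabilityMeasure P]

lemma IsParticleSystem.integrable_expo_mul_noise (h : IsParticleSystem K σ ρ₀ P ℱ W X)
    (l : Freq N d) (s t : ℝ) :
    Integrable (fun ω => expo l (X s.toNNReal ω) * noise σ W l s t ω) P := by
  refine Integrable.of_bound (C := 1) ?_ (Filter.Eventually.of_forall fun ω => ?_)
  · exact (h.integrable_expo _ l).aestronglyMeasurable.mul
      (h.measurable_noise l s t).aestronglyMeasurable
  · rw [norm_mul, norm_expo, norm_noise, one_mul]

/-- No Itô calculus is needed. The exponential at time t is the one at time s times an independent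
Brownian character, with explicit mean, plus an increment of size O(t - s) due to the drift; the
latter, divided by t - s, converges by dominated convergence. A right derivative is all the maximum
principle uses. -/
lemma IsParticleSystem.hasDerivWithinAt_fourierMoment (h : IsParticleSystem K σ ρ₀ P ℱ W X)
    (hK : Continuous fun p : Torus d × Torus d => K p.1 p.2) (hσ : 0 ≤ σ) (l : Freq N d) {s : ℝ}
    (hs : 0 ≤ s) :
    HasDerivWithinAt (fun t => fourierMoment P X t l)
      (-((4 * Real.pi ^ 2 * σ * sqFreq l : ℝ) : ℂ) * fourierMoment P X s l +
        ∫ ω, expo l (X s.toNNReal ω) *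
          (Complex.I * (2 * Real.pi * dotp l (drift K (X s.toNNReal ω)) : ℝ)) ∂P)
      (Set.Ici s) s := by
  obtain ⟨C, hC⟩ := h.ae_norm_driftIncrement_le hK l
  set q : ℝ := 4 * Real.pi ^ 2 * σ * sqFreq l with hq
  have hA : HasDerivAt (fun t : ℝ => fourierMoment P X s l *
      Complex.exp (-(q * (t - s) : ℝ))) (-(q : ℂ) * fourierMoment P X s l) s := by
    have h1 : HasDerivAt (fun t : ℝ => q * (t - s)) q s := by
      simpa using ((hasDerivAt_id s).sub_const s).const_mul q
    have := (h1.ofReal_comp.neg.cexp).const_mul (fourierMoment P X s l)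
    refine this.congr_deriv ?_
    simp
    ring
  set R : ℝ → ℂ := fun t => ∫ ω, driftIncrement σ W X l s t ω ∂P with hR
  have hRs : R s = 0 := by
    simp only [hR]
    rw [← integral_zero Ω ℂ (μ := P)]
    refine integral_congr_ae (Eventually.of_forall fun ω => ?_)
    simp [driftIncrement, noise, dotp]
  have hRd : HasDerivWithinAt R (∫ ω, expo l (X s.toNNReal ω) *
      (Complex.I * (2 * Real.pi * dotp l (drift K (X s.toNNReal ω)) : ℝ)) ∂P) (Set.Ici s) s := by
    rw [hasDerivWithinAt_iff_tendsto_slope, Set.Ici_sdiff_left]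
    have h1 : Tendsto (fun t => ∫ ω, ((t - s)⁻¹ : ℝ) • driftIncrement σ W X l s t ω ∂P) (𝓝[>] s)
        (𝓝 (∫ ω, expo l (X s.toNNReal ω) *
          (Complex.I * (2 * Real.pi * dotp l (drift K (X s.toNNReal ω)) : ℝ)) ∂P)) := by
      refine tendsto_integral_filter_of_dominated_convergence (fun _ => C) ?_ ?_
        (integrable_const _) (h.ae_tendsto_driftIncrement hK l hs)
      · refine Eventually.of_forall fun t => AEStronglyMeasurable.fun_const_smul ?_ _
        exact (h.integrable_expo _ l).aestronglyMeasurable.sub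
          (h.integrable_expo_mul_noise l s t).aestronglyMeasurable
      · filter_upwards [self_mem_nhdsWithin] with t ht
        filter_upwards [hC s t hs (le_of_lt ht)] with ω hω
        have hts : 0 < t - s := sub_pos.2 ht
        rw [norm_smul, norm_inv, Real.norm_of_nonneg hts.le, inv_mul_le_iff₀ hts]
        linarith
    refine h1.congr fun t => ?_
    rw [slope_def_module, hRs, sub_zero, integral_smul]
  refine (hA.hasDerivWithinAt.add hRd).congr ?_ ?_
  · intro t ht
    rw [Pi.add_apply, ← h.integral_expo_mul_noise hσ l hs ht]
    simp only [hR, driftIncrement]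
    rw [integral_sub (h.integrable_expo _ l) (h.integrable_expo_mul_noise l s t)]
    simp [fourierMoment]
  · simp [hRs]

end Derivative

/-! ### The particle system as a mean-field evolution. -/

section Assembly

variable {d N : ℕ} {Ω : Type*} {mΩ : MeasurableSpace Ω} {P : Measure Ω}
  {ℱ : Filtration ℝ≥0 mΩ} {W : ℝ≥0 → Ω → Fin N → EuclideanSpace ℝ (Fin d)}
  {X : ℝ≥0 → Ω → Fin N → Torus d} {K : Torus d → Torus d → EuclideanSpace ℝ (Fin d)} {σ : ℝ}
  {ρ₀ : Torus d → ℝ}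

/-- The bilinear form `D ∑_i a_i · b_i`. -/
noncomputable def freqForm (N d : ℕ) (D : ℝ) : Freq N d →+ Freq N d →+ ℝ :=
  AddMonoidHom.mk' (fun a => AddMonoidHom.mk' (fun b => D * ∑ i, ∑ k, (a i k : ℝ) * b i k)
    (fun b b' => by simp [mul_add, Finset.sum_add_distrib]))
    (fun a a' => by ext b; simp [mul_add, add_mul, Finset.sum_add_distrib])

lemma freqForm_apply (D : ℝ) (a b : Freq N d) :
    freqForm N d D a b = D * ∑ i, ∑ k, (a i k : ℝ) * b i k := rfl

/-- The Fourier multipliers of the mean-field drift. -/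
noncomputable def driftWeight (N : ℕ) (K : Torus d → Torus d → EuclideanSpace ℝ (Fin d))
    (q : Fin N × Fin N × ((Fin d → ℤ) × (Fin d → ℤ))) : Freq N d →+ ℂ :=
  AddMonoidHom.mk' (fun l => 2 * Real.pi * Complex.I / N *
    ∑ k, (l q.1 k : ℂ) * kernelFourierCoeff K q.2.2.1 q.2.2.2 k)
    (fun l l' => by simp [mul_add, add_mul, Finset.sum_add_distrib])

lemma driftWeight_apply (q : Fin N × Fin N × ((Fin d → ℤ) × (Fin d → ℤ))) (l : Freq N d) :
    driftWeight N K q l = 2 * Real.pi * Complex.I / N *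
      ∑ k, (l q.1 k : ℂ) * kernelFourierCoeff K q.2.2.1 q.2.2.2 k := rfl

lemma meanFieldData (hKsum : Summable fun p : (Fin d → ℤ) × (Fin d → ℤ) =>
    ‖kernelFourierCoeff K p.1 p.2‖) {D : ℝ} (hD : 0 ≤ D) :
    MeanFieldData N d D (fun r => 2 * Real.pi * ‖kernelFourierCoeff K r.1 r.2‖) (freqForm N d D)
      (driftWeight N K) where
  diag a := by
    rw [freqForm_apply, sqFreq]
    simp only [pow_two]
  abs_le a b := by
    simp only [freqForm_apply]
    rw [abs_mul, abs_of_nonneg hD, ← mul_add, mul_div_assoc]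
    refine mul_le_mul_of_nonneg_left ?_ hD
    rw [← Finset.sum_add_distrib, Finset.sum_div]
    refine (Finset.abs_sum_le_sum_abs _ _).trans (Finset.sum_le_sum fun i _ => ?_)
    rw [← Finset.sum_add_distrib, Finset.sum_div]
    refine (Finset.abs_sum_le_sum_abs _ _).trans (Finset.sum_le_sum fun k _ => ?_)
    rw [abs_le]
    constructor <;> nlinarith [sq_nonneg ((a i k : ℝ) + b i k), sq_nonneg ((a i k : ℝ) - b i k)]
  overlap a b h := by
    by_contra! hc
    apply h
    rw [freqForm_apply, Finset.sum_eq_zero, mul_zero]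
    intro i _
    refine Finset.sum_eq_zero fun k _ => ?_
    by_cases ha : a i = 0
    · simp [ha]
    · simp [hc i ha]
  weight_le i j r a := by
    rw [driftWeight_apply, norm_mul, norm_div]
    have h1 : ‖(2 * Real.pi * Complex.I : ℂ)‖ = 2 * Real.pi := by
      simp [abs_of_pos Real.pi_pos]
    rw [h1, Complex.norm_natCast]
    have h2 : ‖∑ k, (a i k : ℂ) * kernelFourierCoeff K r.1 r.2 k‖ ≤
        ‖kernelFourierCoeff K r.1 r.2‖ * ∑ k, (a i k : ℝ) ^ 2 := by
      rw [Finset.mul_sum]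
      refine (norm_sum_le _ _).trans (Finset.sum_le_sum fun k _ => ?_)
      rw [norm_mul, mul_comm]
      refine mul_le_mul (PiLp.norm_apply_le _ k) ?_ (norm_nonneg _) (norm_nonneg _)
      rw [Complex.norm_intCast]
      -- Integrality of frequencies lets the second-order diffusion dominate the first-order drift.
      have : |a i k| ≤ a i k ^ 2 := by
        rw [← sq_abs]
        exact Int.le_self_sq _
      exact_mod_cast this
    calc _ ≤ 2 * Real.pi / N * (‖kernelFourierCoeff K r.1 r.2‖ * ∑ k, (a i k : ℝ) ^ 2) :=
          mul_le_mul_of_nonneg_left h2 (by positivity)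
      _ = _ := by ring
  summable := hKsum.mul_left _

lemma hasSum_triple {ι R : Type*} [Fintype ι] {f : ι × ι × R → ℂ} {g : ι → ι → ℂ}
    (hf : Summable f) (h : ∀ i j, HasSum (fun r => f (i, j, r)) (g i j)) :
    HasSum f (∑ i, ∑ j, g i j) := by
  have h1 : ∀ i, HasSum (fun p : ι × R => f (i, p)) (∑ j, g i j) := by
    intro i
    have hs : Summable fun p : ι × R => f (i, p) := hf.prod_factor i
    have := hs.hasSum.prod_fiberwise (h i)
    rw [← this.unique (hasSum_fintype _)]
    exact hs.hasSum
  have := hf.hasSum.prod_fiberwise h1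
  rw [← this.unique (hasSum_fintype _)]
  exact hf.hasSum

/-- Inserting the Fourier series of K, each mode shifts the frequency on particles i and j only.
This is where summability of the coefficients enters. -/
lemma hasSum_driftWeight (hK : Continuous fun p : Torus d × Torus d => K p.1 p.2)
    (hKsum : Summable fun p : (Fin d → ℤ) × (Fin d → ℤ) => ‖kernelFourierCoeff K p.1 p.2‖)
    (l : Freq N d) (x : Fin N → Torus d) :
    HasSum (fun q : Fin N × Fin N × ((Fin d → ℤ) × (Fin d → ℤ)) =>
        driftWeight N K q l * expo (l + pairFreq q.1 q.2.1 q.2.2) x)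
      (expo l x * (Complex.I * (2 * Real.pi * dotp l (drift K x) : ℝ))) := by
  have hs : Summable fun q : Fin N × Fin N × ((Fin d → ℤ) × (Fin d → ℤ)) =>
      driftWeight N K q l * expo (l + pairFreq q.1 q.2.1 q.2.2) x := by
    refine Summable.of_norm_bounded ((meanFieldData hKsum zero_le_one).summable_weight l)
      fun q => ?_
    rw [norm_mul, norm_expo, mul_one]
  have h1 : ∀ i j : Fin N, HasSum (fun r : (Fin d → ℤ) × (Fin d → ℤ) =>
      driftWeight N K (i, j, r) l * expo (l + pairFreq i j r) x)
      (2 * Real.pi * Complex.I / N * expo l x * ∑ k, (l i k : ℂ) * ((K (x i) (x j) k : ℝ) : ℂ)) := by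
    intro i j
    have h2 := (hasSum_sum fun k (_ : k ∈ Finset.univ) =>
      (hasSum_kernel hK hKsum (x i) (x j) k).mul_left (l i k : ℂ)).mul_left
        (2 * Real.pi * Complex.I / N * expo l x)
    refine h2.congr_fun ?_
    intro r
    rw [driftWeight_apply, expo_add, pairFreq, expo_add, expo_single, expo_single]
    simp only [← mul_assoc, ← Finset.sum_mul]
    ring
  have h3 := hasSum_triple hs h1
  convert h3 using 1
  simp only [dotp, drift, PiLp.smul_apply, WithLp.ofLp_sum, Finset.sum_apply, smul_eq_mul]
  push_cast
  simp only [Finset.mul_sum]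
  refine Finset.sum_congr rfl fun i _ => ?_
  rw [Finset.sum_comm]
  refine Finset.sum_congr rfl fun j _ => Finset.sum_congr rfl fun k _ => ?_
  ring

variable [IsProbabilityMeasure P]

lemma IsParticleSystem.integral_drift (h : IsParticleSystem K σ ρ₀ P ℱ W X)
    (hK : Continuous fun p : Torus d × Torus d => K p.1 p.2)
    (hKsum : Summable fun p : (Fin d → ℤ) × (Fin d → ℤ) => ‖kernelFourierCoeff K p.1 p.2‖)
    (l : Freq N d) (s : ℝ) :
    ∫ ω, expo l (X s.toNNReal ω) *
        (Complex.I * (2 * Real.pi * dotp l (drift K (X s.toNNReal ω)) : ℝ)) ∂P =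
      ∑' q : Fin N × Fin N × ((Fin d → ℤ) × (Fin d → ℤ)),
        driftWeight N K q l * fourierMoment P X s (l + pairFreq q.1 q.2.1 q.2.2) := by
  have h1 := hasSum_integral_of_summable_integral_norm (μ := P)
    (F := fun (q : Fin N × Fin N × ((Fin d → ℤ) × (Fin d → ℤ))) ω =>
      driftWeight N K q l * expo (l + pairFreq q.1 q.2.1 q.2.2) (X s.toNNReal ω))
    (fun q => (h.integrable_expo _ _).const_mul _) (by
      simp only [norm_mul, norm_expo, mul_one, integral_const, smul_eq_mul, probReal_univ, one_mul]
      exact (meanFieldData hKsum zero_le_one).summable_weight l)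
  simp only [(hasSum_driftWeight hK hKsum l _).tsum_eq, integral_const_mul] at h1
  exact h1.tsum_eq.symm

lemma IsParticleSystem.isMeanFieldEvolution (h : IsParticleSystem K σ ρ₀ P ℱ W X)
    (hK : Continuous fun p : Torus d × Torus d => K p.1 p.2)
    (hKsum : Summable fun p : (Fin d → ℤ) × (Fin d → ℤ) => ‖kernelFourierCoeff K p.1 p.2‖)
    (hσ : 0 ≤ σ) :
    IsMeanFieldEvolution (freqForm N d (4 * Real.pi ^ 2 * σ)) (driftWeight N K)
      (fourierMoment P X) where
  zero t := fourierMoment_zero t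
  norm_le t l := norm_fourierMoment_le t l
  continuousOn l := (h.continuous_fourierMoment l).continuousOn
  deriv s hs l := by
    have := h.hasDerivWithinAt_fourierMoment hK hσ l hs
    rw [h.integral_drift hK hKsum] at this
    rwa [(meanFieldData (N := N) hKsum (by positivity)).diag]
  factor a b hab := h.fourierMoment_factor hab

/-- The damping is 4π²σ and the interaction strength 2π ∑‖K̂‖, so the requirement 8 · 2π ∑‖K̂‖ ≤
4π²σ reads σ ≥ (4/π) ∑‖K̂‖; the constant 2 exceeds 4/π. -/
lemma IsParticleSystem.labelBound (h : IsParticleSystem K σ ρ₀ P ℱ W X)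
    (hK : Continuous fun p : Torus d × Torus d => K p.1 p.2)
    (hKsum : Summable fun p : (Fin d → ℤ) × (Fin d → ℤ) => ‖kernelFourierCoeff K p.1 p.2‖)
    (hσ : 2 * ∑' p : (Fin d → ℤ) × (Fin d → ℤ), ‖kernelFourierCoeff K p.1 p.2‖ ≤ σ) (hN : 0 < N)
    (n : ℕ) {t : ℝ} (ht : 0 ≤ t) :
    LabelBound (n + 1) (2 ^ n * n.factorial) (kap (mom (fourierMoment P X t))) := by
  have hS : 0 ≤ ∑' p : (Fin d → ℤ) × (Fin d → ℤ), ‖kernelFourierCoeff K p.1 p.2‖ :=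
    tsum_nonneg fun _ => norm_nonneg _
  have hσ0 : 0 ≤ σ := (mul_nonneg zero_le_two hS).trans hσ
  refine (h.isMeanFieldEvolution hK hKsum hσ0).labelBound
    (meanFieldData hKsum (by positivity)) (fun r => by positivity) hN ?_ n ht
  rw [tsum_mul_left]
  have hpi := Real.pi_gt_three
  have h1 := mul_le_mul_of_nonneg_left hσ (by positivity : 0 ≤ 4 * Real.pi ^ 2)
  have h2 := mul_nonneg (mul_nonneg hS Real.pi_pos.le) (by linarith : 0 ≤ Real.pi - 3)
  nlinarith [mul_nonneg hS Real.pi_pos.le]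

end Assembly

/-! ### Contraction of joint moments and cumulants -/

section Contract

variable {Λ β : Type*}

/-- The `n`-fold contraction of a function on multisets with the weights `α`: the `n`-th Taylor
coefficient at zero along the direction `∑_b α_b ℓ_b`. -/
noncomputable def contract (α : β → ℂ) (l : β → Λ) : ℕ → (Multiset Λ → ℂ) → ℂ
  | 0, f => f 0
  | n + 1, f => ∑' b, α b * contract α l n (shift (l b) f)

/-- A function on multisets which is bounded on the multisets of each cardinality. -/
def LevelBounded (f : Multiset Λ → ℂ) : Prop := ∃ c : ℕ → ℝ, ∀ s, ‖f s‖ ≤ c s.card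

lemma LevelBounded.shift {f : Multiset Λ → ℂ} (hf : LevelBounded f) (a : Λ) :
    LevelBounded (shift a f) := by
  obtain ⟨c, hc⟩ := hf
  exact ⟨fun n => c (n + 1), fun s => by simpa [MeanField.shift] using hc (a ::ₘ s)⟩

lemma LevelBounded.conv {f g : Multiset Λ → ℂ} (hf : LevelBounded f) (hg : LevelBounded g) :
    LevelBounded (conv f g) := by
  -- The constant is chosen before the functions, so that the induction applies uniformly to all
  -- their shifts.
  suffices h : ∀ (n : ℕ) (c c' : ℕ → ℝ), ∃ C : ℝ, ∀ f g : Multiset Λ → ℂ,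
      (∀ s, ‖f s‖ ≤ c s.card) → (∀ s, ‖g s‖ ≤ c' s.card) → ∀ s, s.card = n →
        ‖MeanField.conv f g s‖ ≤ C by
    obtain ⟨c, hc⟩ := hf
    obtain ⟨c', hc'⟩ := hg
    choose C hC using fun n => h n c c'
    exact ⟨C, fun s => hC _ f g hc hc' s rfl⟩
  intro n
  induction n with
  | zero =>
    intro c c'
    refine ⟨c 0 * c' 0, fun f g hf hg s hs => ?_⟩
    rw [Multiset.card_eq_zero.1 hs, conv_zero_apply, norm_mul]
    exact mul_le_mul (hf 0) (hg 0) (norm_nonneg _) ((norm_nonneg _).trans (hf 0))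
  | succ n ih =>
    intro c c'
    have hs : ∀ (f : Multiset Λ → ℂ) (c : ℕ → ℝ), (∀ s, ‖f s‖ ≤ c s.card) → ∀ a s,
        ‖MeanField.shift a f s‖ ≤ (fun n => c (n + 1)) s.card := fun f c hf a s => by
      simpa [MeanField.shift] using hf (a ::ₘ s)
    obtain ⟨C₁, h₁⟩ := ih c fun n => c' (n + 1)
    obtain ⟨C₂, h₂⟩ := ih (fun n => c (n + 1)) c'
    refine ⟨C₁ + C₂, fun f g hf hg s hsn => ?_⟩
    obtain ⟨b, hb⟩ := Multiset.card_pos_iff_exists_mem.1 (by omega : 0 < s.card)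
    obtain ⟨s, rfl⟩ := Multiset.exists_cons_of_mem hb
    rw [Multiset.card_cons, add_left_inj] at hsn
    rw [conv_cons]
    exact (norm_add_le _ _).trans (add_le_add (h₁ _ _ hf (hs g c' hg b) _ hsn)
      (h₂ _ _ (hs f c hf b) hg _ hsn))

variable {α : β → ℂ} {l : β → Λ}

lemma norm_contract_le (hα : Summable fun b => ‖α b‖) (n : ℕ) {f : Multiset Λ → ℂ} {c : ℝ}
    (hf : ∀ s, s.card = n → ‖f s‖ ≤ c) : ‖contract α l n f‖ ≤ (∑' b, ‖α b‖) ^ n * c := by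
  induction n generalizing f with
  | zero => simpa [contract] using hf 0 rfl
  | succ n ih =>
    have h1 : ∀ b, ‖α b * contract α l n (shift (l b) f)‖ ≤ ‖α b‖ * ((∑' b, ‖α b‖) ^ n * c) := by
      intro b
      rw [norm_mul]
      exact mul_le_mul_of_nonneg_left (ih fun s hs => hf _ (by simp [hs])) (norm_nonneg _)
    rw [contract]
    refine (tsum_of_norm_bounded (hα.mul_right _).hasSum h1).trans_eq ?_
    rw [tsum_mul_right, pow_succ']
    ring

lemma LevelBounded.summable_contract (hα : Summable fun b => ‖α b‖) {f : Multiset Λ → ℂ}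
    (hf : LevelBounded f) (n : ℕ) :
    Summable fun b => α b * contract α l n (MeanField.shift (l b) f) := by
  obtain ⟨c, hc⟩ := hf
  refine Summable.of_norm_bounded (hα.mul_right ((∑' b, ‖α b‖) ^ n * c (n + 1))) fun b => ?_
  rw [norm_mul]
  refine mul_le_mul_of_nonneg_left (norm_contract_le hα n fun s hs => ?_) (norm_nonneg _)
  simpa [MeanField.shift, hs] using hc (l b ::ₘ s)

lemma contract_add (hα : Summable fun b => ‖α b‖) (n : ℕ) {f g : Multiset Λ → ℂ}
    (hf : LevelBounded f) (hg : LevelBounded g) :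
    contract α l n (f + g) = contract α l n f + contract α l n g := by
  induction n generalizing f g with
  | zero => rfl
  | succ n ih =>
    simp only [contract]
    rw [← (hf.summable_contract hα n).tsum_add (hg.summable_contract hα n)]
    refine tsum_congr fun b => ?_
    rw [← mul_add, ← ih (hf.shift _) (hg.shift _)]
    rfl

/-- Restricting a power series to a line respects products. Multisets over `Unit` stand for the
exponents of one variable, so the same product and formal logarithm serve on both sides. -/
lemma contract_conv (hα : Summable fun b => ‖α b‖) {f g : Multiset Λ → ℂ}
    (hf : LevelBounded f) (hg : LevelBounded g) (s : Multiset Unit) :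
    contract α l s.card (conv f g) =
      conv (fun s => contract α l s.card f) (fun s => contract α l s.card g) s := by
  induction s using Multiset.induction_on generalizing f g with
  | empty => simp [contract, conv_zero_apply]
  | cons a s ih =>
    have hsum : ∀ {f : Multiset Λ → ℂ}, LevelBounded f → ∀ s : Multiset Unit,
        HasSum (fun b => (α b • fun s : Multiset Unit => contract α l s.card (shift (l b) f)) s)
          (shift a (fun s => contract α l s.card f) s) := by
      intro f hf s
      have : shift a (fun s => contract α l s.card f) s = contract α l (s.card + 1) f := by
        simp [shift]
      rw [this, contract]
      exact (hf.summable_contract hα s.card).hasSum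
    have h1 := hasSum_conv_left (fun s => contract α l s.card g) (hsum hf) s
    have h2 := hasSum_conv_left (fun s => contract α l s.card f) (hsum hg) s
    rw [conv_comm] at h2
    rw [conv_cons, ← (h2.add h1).tsum_eq, Multiset.card_cons, contract]
    refine tsum_congr fun b => ?_
    rw [shift_conv, contract_add hα _ (hf.conv (hg.shift _)) ((hf.shift _).conv hg),
      ih hf (hg.shift _), ih (hf.shift _) hg, conv_smul_left, conv_smul_left, conv_comm _
      (fun s => contract α l s.card f), Pi.smul_apply, Pi.smul_apply, smul_eq_mul, smul_eq_mul,
      mul_add]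

lemma levelBounded_kap {μ : Multiset Λ → ℂ} (h0 : μ 0 = 1) (hμ : ∀ s, ‖μ s‖ ≤ 1) :
    LevelBounded (kap μ) := by
  refine ⟨fun n => 2 ^ (n - 1) * (n - 1).factorial, fun s => ?_⟩
  rcases Multiset.empty_or_exists_mem s with rfl | ⟨a, ha⟩
  · simp [kap_zero]
  · obtain ⟨s, rfl⟩ := Multiset.exists_cons_of_mem ha
    simpa using norm_kap_cons_le h0 hμ a s

/-- Contraction commutes with passing from moments to cumulants. -/
lemma contract_kap (hα : Summable fun b => ‖α b‖) {μ : Multiset Λ → ℂ} (h0 : μ 0 = 1)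
    (hμ : ∀ s, ‖μ s‖ ≤ 1) (s : Multiset Unit) :
    contract α l s.card (kap μ) = kap (fun s => contract α l s.card μ) s := by
  have hb : LevelBounded μ := ⟨fun _ => 1, hμ⟩
  have hκ := levelBounded_kap h0 hμ
  refine congrFun (f := fun s : Multiset Unit => contract α l s.card (kap μ))
    (kap_unique (by simpa [contract] using h0) (by simp [contract, kap_zero]) fun a => ?_) s
  funext s
  have h1 := hasSum_conv_left (F := fun b => α b • fun s : Multiset Unit =>
    contract α l s.card (shift (l b) (kap μ))) (f := shift a fun s => contract α l s.card (kap μ))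
    (fun s => contract α l s.card μ) (fun s => by
      have : shift a (fun s => contract α l s.card (kap μ)) s =
          contract α l (s.card + 1) (kap μ) := by
        simp [shift]
      rw [this, contract]
      exact (hκ.summable_contract hα s.card).hasSum) s
  rw [← h1.tsum_eq]
  have h2 : shift a (fun s => contract α l s.card μ) s = contract α l (s.card + 1) μ := by
    simp [shift]
  rw [h2, contract]
  refine tsum_congr fun b => ?_
  rw [conv_smul_left, Pi.smul_apply, ← contract_conv hα (hκ.shift _) hb, conv_shift_kap h0,
    smul_eq_mul]

/-- The contractions of the moments of a family of characters are the moments of its sum. -/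
lemma contract_moment [AddCommMonoid Λ] {Ω : Type*} {mΩ : MeasurableSpace Ω} {P : Measure Ω}
    [IsFiniteMeasure P] [Countable β] (hα : Summable fun b => ‖α b‖) {e : Λ → Ω → ℂ}
    (hem : ∀ a, Measurable (e a)) (he : ∀ a ω, ‖e a ω‖ = 1)
    (hadd : ∀ a b ω, e (a + b) ω = e a ω * e b ω) (h0 : ∀ ω, e 0 ω = 1) {Y : Ω → ℂ}
    (hYm : Measurable Y) (hY : ∀ ω, HasSum (fun b => α b * e (l b) ω) (Y ω)) (n : ℕ) {H : Ω → ℂ}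
    (hH : Measurable H) (hHb : ∀ ω, ‖H ω‖ ≤ 1) :
    contract α l n (fun s => ∫ ω, H ω * e s.sum ω ∂P) = ∫ ω, H ω * Y ω ^ n ∂P := by
  have hYb : ∀ ω, ‖Y ω‖ ≤ ∑' b, ‖α b‖ := fun ω => by
    rw [← (hY ω).tsum_eq]
    exact tsum_of_norm_bounded hα.hasSum fun b => by rw [norm_mul, he, mul_one]
  -- The bounded weight `H` absorbs the character peeled off at each step.
  induction n generalizing H with
  | zero => simp [contract, h0]
  | succ n ih =>
    set A := ∑' b, ‖α b‖ with hA
    have h1 : ∀ b, shift (l b) (fun s => ∫ ω, H ω * e s.sum ω ∂P) =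
        fun s => ∫ ω, (H ω * e (l b) ω) * e s.sum ω ∂P := by
      intro b
      funext s
      simp only [shift, Multiset.sum_cons, hadd, mul_assoc]
    have hm : ∀ b, Measurable fun ω => H ω * e (l b) ω := fun b => hH.mul (hem _)
    have hb : ∀ b ω, ‖H ω * e (l b) ω‖ ≤ 1 := fun b ω => by rw [norm_mul, he, mul_one]; exact hHb ω
    have hF : ∀ b ω, ‖α b * (H ω * e (l b) ω * Y ω ^ n)‖ ≤ ‖α b‖ * A ^ n := by
      intro b ω
      rw [norm_mul, norm_mul, norm_pow]
      refine mul_le_mul_of_nonneg_left ?_ (norm_nonneg _)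
      calc _ ≤ 1 * A ^ n := mul_le_mul (hb b ω) (pow_le_pow_left₀ (norm_nonneg _) (hYb ω) n)
            (by positivity) zero_le_one
        _ = _ := one_mul _
    have hI : ∀ b, Integrable (fun ω => α b * (H ω * e (l b) ω * Y ω ^ n)) P := fun b =>
      (integrable_const (‖α b‖ * A ^ n)).mono'
        (((hm b).mul (hYm.pow_const n)).const_mul _).aestronglyMeasurable
        (Filter.Eventually.of_forall (hF b))
    have h2 := hasSum_integral_of_summable_integral_norm hI (by
      refine Summable.of_nonneg_of_le (fun b => integral_nonneg fun ω => norm_nonneg _)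
        (fun b => ?_) ((hα.mul_right (A ^ n)).mul_left (P.real Set.univ))
      refine (integral_mono (hI b).norm (integrable_const _) (hF b)).trans_eq ?_
      simp)
    rw [contract]
    simp only [h1]
    rw [tsum_congr fun b => by rw [ih (hm b) (hb b), ← integral_const_mul], h2.tsum_eq]
    refine integral_congr_ae (Filter.Eventually.of_forall fun ω => ?_)
    beta_reduce
    rw [← (hY ω).tsum_eq, pow_succ, ← mul_assoc, ← tsum_mul_left, (hY ω).tsum_eq]
    exact tsum_congr fun b => by ring

end Contract

/-! ### Jets of functions of one variable -/

section Jet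

/-- The derivatives of a function at a point, as a function on multisets over one letter. -/
noncomputable def jet (f : ℝ → ℂ) (x : ℝ) (s : Multiset Unit) : ℂ := iteratedDeriv s.card f x

lemma shift_jet (f : ℝ → ℂ) (x : ℝ) (a : Unit) : shift a (jet f x) = jet (deriv f) x := by
  funext s
  simp [shift, jet, iteratedDeriv_succ']

lemma jet_congr {f g : ℝ → ℂ} {U : Set ℝ} (hU : IsOpen U) {x : ℝ} (hx : x ∈ U)
    (h : Set.EqOn f g U) : jet f x = jet g x := by
  funext s
  exact Filter.EventuallyEq.iteratedDeriv_eq _ (h.eventuallyEq_of_mem (hU.mem_nhds hx))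

/-- The Leibniz rule for all orders. It is stated on an open set because the logarithm it is applied
to is smooth only where its argument avoids the cut. -/
lemma jet_mul {f g : ℝ → ℂ} {U : Set ℝ} (hU : IsOpen U) {x : ℝ} (hx : x ∈ U)
    (hf : ContDiffOn ℝ (⊤ : ℕ∞) f U) (hg : ContDiffOn ℝ (⊤ : ℕ∞) g U) :
    jet (fun y => f y * g y) x = conv (jet f x) (jet g x) := by
  funext s
  induction s using Multiset.induction_on generalizing f g with
  | empty => simp [jet, conv_zero_apply]
  | cons a s ih =>
    have hf' : ContDiffOn ℝ (⊤ : ℕ∞) (deriv f) U := hf.deriv_of_isOpen hU (by simp)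
    have hg' : ContDiffOn ℝ (⊤ : ℕ∞) (deriv g) U := hg.deriv_of_isOpen hU (by simp)
    have hd : ∀ {f : ℝ → ℂ}, ContDiffOn ℝ (⊤ : ℕ∞) f U → ∀ y ∈ U, DifferentiableAt ℝ f y :=
      fun hf y hy => (hf.differentiableOn (by simp)).differentiableAt (hU.mem_nhds hy)
    have h1 : shift a (jet (fun y => f y * g y) x) s =
        jet (fun y => f y * deriv g y + deriv f y * g y) x s := by
      rw [shift_jet]
      refine congrFun (jet_congr hU hx fun y hy => ?_) s
      rw [deriv_fun_mul (hd hf y hy) (hd hg y hy), add_comm]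
    have h2 : jet (fun y => f y * deriv g y + deriv f y * g y) x s =
        jet (fun y => f y * deriv g y) x s + jet (fun y => deriv f y * g y) x s := by
      have hc : ∀ {f : ℝ → ℂ}, ContDiffOn ℝ (⊤ : ℕ∞) f U → ContDiffAt ℝ s.card f x := fun hf =>
        (hf.contDiffAt (hU.mem_nhds hx)).of_le (by exact_mod_cast le_top)
      exact iteratedDeriv_fun_add (hc (hf.mul hg')) (hc (hf'.mul hg))
    change shift a (jet (fun y => f y * g y) x) s = _
    rw [h1, h2, conv_cons, shift_jet, shift_jet, ih hf hg', ih hf' hg]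

/-- The jet of the logarithm of a function is the formal logarithm of its jet. -/
lemma jet_log {F : ℝ → ℂ} (hF : ContDiff ℝ (⊤ : ℕ∞) F) {x : ℝ} (hx : F x = 1) :
    jet (fun y => Complex.log (F y)) x = kap (jet F x) := by
  set U : Set ℝ := F ⁻¹' Complex.slitPlane with hUdef
  have hU : IsOpen U := Complex.isOpen_slitPlane.preimage hF.continuous
  have hxU : x ∈ U := by
    change F x ∈ Complex.slitPlane
    rw [hx]
    exact Complex.one_mem_slitPlane
  have hd : ∀ y, DifferentiableAt ℝ F y := fun y => hF.differentiable (by simp) y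
  have hlog : ContDiffOn ℝ (⊤ : ℕ∞) (fun y => Complex.log (F y)) U := fun y hy =>
    (((Complex.contDiffAt_log hy).restrict_scalars ℝ).comp y hF.contDiffAt).contDiffWithinAt
  refine kap_unique (by simpa [jet] using hx) (by simp [jet, hx]) fun a => ?_
  rw [shift_jet, shift_jet, ← jet_mul hU hxU (hlog.deriv_of_isOpen hU (by simp)) hF.contDiffOn]
  refine jet_congr hU hxU fun y hy => ?_
  have hne : F y ≠ 0 := Complex.slitPlane_ne_zero hy
  have : HasDerivAt (fun y => Complex.log (F y)) (deriv F y / F y) y :=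
    (hd y).hasDerivAt.clog_real hy
  rw [this.deriv]
  field_simp

end Jet

/-! ### Contraction against one-particle observables -/

section Observable

variable {d N : ℕ}

/-- The frequency of a one-particle character. -/
def siteFreq (b : Fin N × (Fin d → ℤ)) : Freq N d := Pi.single b.1 b.2

/-- The particles occurring in a multiset of one-particle characters. -/
def sites (L : Multiset (Fin N × (Fin d → ℤ))) : Finset (Fin N) := (L.map Prod.fst).toFinset

lemma sites_cons (b : Fin N × (Fin d → ℤ)) (L : Multiset (Fin N × (Fin d → ℤ))) :
    sites (b ::ₘ L) = insert b.1 (sites L) := by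
  simp [sites]

lemma card_sites_le (L : Multiset (Fin N × (Fin d → ℤ))) : (sites L).card ≤ L.card :=
  (Multiset.toFinset_card_le _).trans (Multiset.card_map _ _).le

/-- For one-particle characters each particle serves as its own label, so labels and occupied sites
coincide. -/
lemma LabelBound.norm_le_of_sites {n : ℕ} {c : ℝ} {κ : Multiset (Freq N d) → ℂ}
    (h : LabelBound n c κ) {L : Multiset (Fin N × (Fin d → ℤ))} (hL : L.card = n) :
    ‖κ (L.map siteFreq)‖ ≤ c * (((sites L).card : ℝ) / N) ^ ((sites L).card - 1) := by
  set S : Multiset (Freq N d × Fin N) := L.map fun b => (siteFreq b, b.1) with hS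
  have h1 : S.map Prod.snd = L.map Prod.fst := by simp [hS]
  have h2 : S.map Prod.fst = L.map siteFreq := by simp [hS]
  have h3 := h S (sites L) id (by simp [hS, hL]) ⟨?_, by rw [numLabels, h1]; exact le_rfl⟩
  · rwa [h2, labelWeight, numLabels, h1] at h3
  · intro x hx i hi
    obtain ⟨b, hb, rfl⟩ := Multiset.mem_map.1 hx
    have : i = b.1 := by
      by_contra hne
      exact hi (Pi.single_eq_of_ne hne _)
    subst this
    exact ⟨by simpa [sites] using ⟨b.2, hb⟩, rfl⟩

variable {a : (Fin d → ℤ) → ℂ}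

lemma hasSum_weight_mul (ha : Summable fun k => ‖a k‖) (w : Fin N → ℝ) :
    HasSum (fun b : Fin N × (Fin d → ℤ) => ‖a b.2 / N‖ * w b.1)
      ((∑' k, ‖a k‖) / N * ∑ i, w i) := by
  have h1 : Summable fun b : Fin N × (Fin d → ℤ) => w b.1 * ‖a b.2‖ :=
    summable_mul_of_summable_norm (f := w) (g := fun k => ‖a k‖)
      (hasSum_fintype fun i => ‖w i‖).summable (by simpa using ha)
  have h2 := ((hasSum_fintype w).mul ha.hasSum h1).div_const (N : ℝ)
  have e1 : (fun b : Fin N × (Fin d → ℤ) => ‖a b.2 / N‖ * w b.1) =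
      fun b => w b.1 * ‖a b.2‖ / N := by
    funext b
    rw [norm_div, Complex.norm_natCast]
    ring
  have e2 : (∑' k, ‖a k‖) / N * ∑ i, w i = (∑ i, w i) * (∑' k, ‖a k‖) / N := by ring
  rw [e1, e2]
  exact h2

lemma summable_weight (ha : Summable fun k => ‖a k‖) :
    Summable fun b : Fin N × (Fin d → ℤ) => ‖a b.2 / N‖ := by
  simpa using (hasSum_weight_mul ha fun _ => 1).summable

/-- Contractions of functions that decay in the number of new particles. -/
lemma norm_contract_siteFreq_le (ha : Summable fun k => ‖a k‖) (hN : 0 < N) (m n : ℕ)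
    (J : Finset (Fin N)) (hJ : J.card + n ≤ m) {f : Multiset (Freq N d) → ℂ} {c : ℝ} (hc : 0 ≤ c)
    (hf : ∀ L : Multiset (Fin N × (Fin d → ℤ)), L.card = n →
      ‖f (L.map siteFreq)‖ ≤ c * ((m : ℝ) / N) ^ (sites L \ J).card) :
    ‖contract (fun b : Fin N × (Fin d → ℤ) => a b.2 / N) siteFreq n f‖ ≤
      c * (2 * m * (∑' k, ‖a k‖) / N) ^ n := by
  have hN' : (0 : ℝ) < N := by exact_mod_cast hN
  set q : ℝ := (m : ℝ) / N with hq
  set A : ℝ := ∑' k, ‖a k‖ with hA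
  have hA0 : 0 ≤ A := tsum_nonneg fun _ => norm_nonneg _
  induction n generalizing J f c with
  | zero => simpa [contract, sites] using hf 0 rfl
  | succ n ih =>
    set E : ℝ := c * (2 * m * A / N) ^ n with hE
    have hE0 : 0 ≤ E := by positivity
    -- A particle already seen costs nothing and a new one costs q = m/N. Since |J| ≤ m and N q = m,
    -- both kinds contribute at most m, which gives the factor 2m.
    set w : Fin N → ℝ := fun i => (if i ∈ J then 1 else q) * E with hw
    have h1 : ∀ b : Fin N × (Fin d → ℤ), ‖a b.2 / N *
        contract (fun b : Fin N × (Fin d → ℤ) => a b.2 / N) siteFreq n (shift (siteFreq b) f)‖ ≤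
        ‖a b.2 / N‖ * w b.1 := by
      intro b
      rw [norm_mul]
      refine mul_le_mul_of_nonneg_left ?_ (norm_nonneg _)
      by_cases hb : b.1 ∈ J
      · rw [hw]
        simp only [hb, if_true, one_mul, hE]
        refine ih J (by omega) hc fun L hL => ?_
        have := hf (b ::ₘ L) (by simp [hL])
        rwa [sites_cons, Finset.insert_sdiff_of_mem _ hb, Multiset.map_cons] at this
      · rw [hw]
        simp only [hb, if_false]
        refine (ih (c := q * c) (insert b.1 J) (by rw [Finset.card_insert_of_notMem hb]; omega)
          (by positivity) fun L hL => ?_).trans_eq (by rw [hE]; ring)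
        have := hf (b ::ₘ L) (by simp [hL])
        have e1 : sites (b ::ₘ L) \ J = insert b.1 (sites L \ insert b.1 J) := by
          rw [sites_cons]
          ext i
          by_cases hi : i = b.1 <;> simp [hi, hb]
        rw [e1, Finset.card_insert_of_notMem (by simp), pow_succ, Multiset.map_cons] at this
        exact this.trans_eq (by ring)
    rw [contract]
    refine (tsum_of_norm_bounded (hasSum_weight_mul ha w) h1).trans ?_
    have h2 : ∑ i, w i = (J.card + ((Finset.univ.filter fun i => i ∉ J).card : ℝ) * q) * E := by
      rw [hw, ← Finset.sum_mul, Finset.sum_ite]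
      simp
    have h3 : ((Finset.univ.filter fun i => i ∉ J).card : ℝ) * q ≤ N * q := by
      refine mul_le_mul_of_nonneg_right ?_ (by positivity)
      have := (Finset.univ.filter fun i : Fin N => i ∉ J).card_le_univ
      rw [Fintype.card_fin] at this
      exact_mod_cast this
    have h4 : (N : ℝ) * q = m := by rw [hq]; field_simp
    have h5 : (J.card : ℝ) ≤ m := by exact_mod_cast (by omega : J.card ≤ m)
    rw [h2]
    calc A / N * ((J.card + ((Finset.univ.filter fun i => i ∉ J).card : ℝ) * q) * E)
        ≤ A / N * ((m + m) * E) := by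
          refine mul_le_mul_of_nonneg_left (mul_le_mul_of_nonneg_right ?_ hE0) (by positivity)
          linarith
      _ = _ := by rw [hE, pow_succ]; ring

/-- From (n+2)^n ≤ 3(n+1)^n, each step costs 3(n+2), which is at most 2(n+2)². -/
lemma add_one_pow_le (n : ℕ) : ((n : ℝ) + 1) ^ n ≤ 2 ^ n * ((n + 1).factorial : ℝ) ^ 2 := by
  induction n with
  | zero => norm_num
  | succ n ih =>
    have h1 := one_add_inv_pow_le (le_refl (n + 1)) n.succ_pos
    rw [Nat.add_sub_cancel] at h1
    have h2 : ((n : ℝ) + 2) ^ n ≤ 3 * ((n : ℝ) + 1) ^ n := by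
      have : (n : ℝ) + 2 = (1 + 1 / ((n + 1 : ℕ) : ℝ)) * (n + 1) := by push_cast; field_simp; ring
      rw [this, mul_pow]
      exact mul_le_mul_of_nonneg_right h1 (by positivity)
    rw [Nat.factorial_succ (n + 1)]
    push_cast
    have h3 : (n : ℝ) + 1 + 1 = n + 2 := by ring
    rw [h3, pow_succ, pow_succ]
    have hn : (0 : ℝ) ≤ n := n.cast_nonneg
    set F : ℝ := ((n + 1).factorial : ℝ) with hF
    have h4 : 0 ≤ 2 ^ n * F ^ 2 := by positivity
    calc ((n : ℝ) + 2) ^ n * (n + 2) ≤ 3 * (2 ^ n * F ^ 2) * (n + 2) :=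
          mul_le_mul_of_nonneg_right (h2.trans (by linarith)) (by linarith)
      _ ≤ _ := by nlinarith [mul_nonneg h4 hn, mul_nonneg (mul_nonneg h4 hn) hn]

/-- The first particle is free, and the n others bring a factor 2(n+1)A/N each. This gives 4^n n!
(n+1)^n A^(n+1) / N^n; in the final form one factor 8 and one factorial are slack. -/
lemma norm_contract_kap_le (ha : Summable fun k => ‖a k‖) (hN : 0 < N)
    {κ : Multiset (Freq N d) → ℂ} {n : ℕ} (h : LabelBound (n + 1) (2 ^ n * n.factorial) κ) :
    ‖contract (fun b : Fin N × (Fin d → ℤ) => a b.2 / N) siteFreq (n + 1) κ‖ ≤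
      (8 * ∑' k, ‖a k‖) ^ (n + 1) * ((n + 1).factorial : ℝ) ^ 4 / (N : ℝ) ^ n := by
  have hN' : (0 : ℝ) < N := by exact_mod_cast hN
  set A : ℝ := ∑' k, ‖a k‖ with hA
  have hA0 : 0 ≤ A := tsum_nonneg fun _ => norm_nonneg _
  set c : ℝ := 2 ^ n * n.factorial with hc
  set E : ℝ := c * (2 * (n + 1 : ℕ) * A / N) ^ n with hE
  have h1 : ∀ b : Fin N × (Fin d → ℤ), ‖a b.2 / N *
      contract (fun b : Fin N × (Fin d → ℤ) => a b.2 / N) siteFreq n (shift (siteFreq b) κ)‖ ≤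
      ‖a b.2 / N‖ * (fun _ => E) b.1 := by
    intro b
    rw [norm_mul]
    refine mul_le_mul_of_nonneg_left ?_ (norm_nonneg _)
    refine norm_contract_siteFreq_le ha hN (n + 1) n {b.1} (by simp [add_comm]) (by positivity)
      fun L hL => ?_
    have h2 := h.norm_le_of_sites (L := b ::ₘ L) (by simp [hL])
    rw [Multiset.map_cons] at h2
    have hcard := card_sites_le (b ::ₘ L)
    rw [Multiset.card_cons, hL] at hcard
    -- The exponent c - 1 counts exactly the particles other than the first.
    have e1 : (sites L \ {b.1}).card = (sites (b ::ₘ L)).card - 1 := by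
      rw [sites_cons, ← Finset.erase_eq, ← Finset.card_erase_of_mem (Finset.mem_insert_self _ _),
        Finset.erase_insert_eq_erase]
    rw [e1]
    refine h2.trans (mul_le_mul_of_nonneg_left (pow_le_pow_left₀ (by positivity) ?_ _)
      (by positivity))
    exact div_le_div_of_nonneg_right (by exact_mod_cast hcard) hN'.le
  rw [contract]
  refine (tsum_of_norm_bounded (hasSum_weight_mul ha fun _ => E) h1).trans ?_
  rw [Finset.sum_const, Finset.card_univ, Fintype.card_fin, nsmul_eq_mul, hE, hc,
    div_pow, ← mul_assoc (A / N), div_mul_cancel₀ _ hN'.ne', mul_pow, mul_pow, ← mul_div_assoc,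
    ← mul_div_assoc, mul_pow]
  refine div_le_div_of_nonneg_right ?_ (by positivity)
  have h2 := add_one_pow_le n
  have h3 : (n.factorial : ℝ) ≤ (n + 1).factorial := by
    exact_mod_cast Nat.factorial_le n.le_succ
  have h4 : (1 : ℝ) ≤ (n + 1).factorial := by
    exact_mod_cast (n + 1).factorial_pos
  push_cast
  set F : ℝ := ((n + 1).factorial : ℝ) with hF
  have h5 : (n.factorial : ℝ) * ((n : ℝ) + 1) ^ n ≤ F * (2 ^ n * F ^ 2) :=
    mul_le_mul h3 h2 (by positivity) (by positivity)
  have h6 : F * (2 ^ n * F ^ 2) ≤ 2 ^ n * F ^ 4 := by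
    have : F ^ 3 ≤ F ^ 4 := pow_le_pow_right₀ h4 (by norm_num)
    calc _ = 2 ^ n * F ^ 3 := by ring
      _ ≤ _ := mul_le_mul_of_nonneg_left this (by positivity)
  have h7 : (8 : ℝ) ^ (n + 1) = 2 ^ n * 2 ^ n * 2 ^ n * 8 := by
    rw [pow_succ, ← mul_pow, ← mul_pow]; norm_num
  rw [h7, pow_succ A n]
  have h8 : 0 ≤ A ^ n * A * (2 ^ n * 2 ^ n) := by positivity
  have h9 : (0 : ℝ) ≤ 2 ^ n * F ^ 4 := by positivity
  calc _ = A ^ n * A * (2 ^ n * 2 ^ n) * ((n.factorial : ℝ) * ((n : ℝ) + 1) ^ n) := by ring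
    _ ≤ A ^ n * A * (2 ^ n * 2 ^ n) * (8 * (2 ^ n * F ^ 4)) :=
        mul_le_mul_of_nonneg_left (by linarith) h8
    _ = _ := by ring

end Observable

/-! ### Fourier coefficients of smooth functions -/

section Smooth

variable {d : ℕ}

lemma isOpenQuotientMap_toTorus : IsOpenQuotientMap (toTorus (d := d)) :=
  IsOpenQuotientMap.piMap fun _ => QuotientAddGroup.isOpenQuotientMap_mk

/-- Smoothness of a complex function on the torus. -/
def IsSmooth (f : Torus d → ℂ) : Prop := ContDiff ℝ (⊤ : ℕ∞) fun v : Fin d → ℝ => f (toTorus v)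

lemma IsSmooth.continuous {f : Torus d → ℂ} (hf : IsSmooth f) : Continuous f :=
  isOpenQuotientMap_toTorus.isQuotientMap.continuous_iff.2 (ContDiff.continuous hf)

lemma IsSmoothOnTorus.isSmooth {φ : Torus d → ℝ} (hφ : IsSmoothOnTorus φ) :
    IsSmooth fun x => (φ x : ℂ) :=
  Complex.ofRealCLM.contDiff.comp hφ

/-- The partial derivative of a function on the torus. -/
noncomputable def partialDeriv (j : Fin d) (f : Torus d → ℂ) (x : Torus d) : ℂ :=
  deriv (fun h : ℝ => f (x + toTorus (Pi.single j h))) 0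

lemma IsSmooth.hasDerivAt {f : Torus d → ℂ} (hf : IsSmooth f) (j : Fin d) (x : Torus d) (h : ℝ) :
    HasDerivAt (fun h : ℝ => f (x + toTorus (Pi.single j h)))
      (partialDeriv j f (x + toTorus (Pi.single j h))) h := by
  have key : ∀ x h, DifferentiableAt ℝ (fun h : ℝ => f (x + toTorus (Pi.single j h))) h := by
    intro x h
    obtain ⟨v, rfl⟩ := isOpenQuotientMap_toTorus.surjective x
    simp_rw [← toTorus_add]
    have h1 : Differentiable ℝ fun v : Fin d → ℝ => f (toTorus v) :=
      ContDiff.differentiable hf (by simp)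
    have h2 : Differentiable ℝ fun h : ℝ => v + Pi.single j h :=
      (ContinuousLinearMap.single ℝ (fun _ : Fin d => ℝ) j).differentiable.const_add v
    exact (h1.comp h2) h
  have h1 := (key (x + toTorus (Pi.single j h)) 0).hasDerivAt
  rw [← sub_self h] at h1
  have h2 := HasDerivAt.comp_sub_const h h h1
  simp only [add_assoc, ← toTorus_add, ← Pi.single_add, add_sub_cancel, sub_self] at h2
  simpa only [partialDeriv, add_assoc, ← toTorus_add, ← Pi.single_add] using h2

lemma IsSmooth.partialDeriv {f : Torus d → ℂ} (hf : IsSmooth f) (j : Fin d) :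
    IsSmooth (partialDeriv j f) := by
  have h1 : (fun v : Fin d → ℝ => MeanField.partialDeriv j f (toTorus v)) =
      fun v => fderiv ℝ (fun v : Fin d → ℝ => f (toTorus v)) v (Pi.single j 1) := by
    funext v
    have h2 : HasFDerivAt (fun v : Fin d → ℝ => f (toTorus v))
        (fderiv ℝ (fun v : Fin d → ℝ => f (toTorus v)) v) (v + Pi.single j (0 : ℝ)) := by
      rw [Pi.single_zero, add_zero]
      exact (ContDiff.differentiable hf (by simp) v).hasFDerivAt
    have h3 : HasDerivAt (fun h : ℝ => v + Pi.single j h) (Pi.single j (1 : ℝ)) 0 :=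
      ((ContinuousLinearMap.single ℝ (fun _ : Fin d => ℝ) j).hasDerivAt (x := 0)).const_add v
    have h4 := h2.comp_hasDerivAt (0 : ℝ) h3
    rw [← h4.deriv, MeanField.partialDeriv]
    simp_rw [← toTorus_add]
    rfl
  unfold IsSmooth
  rw [h1]
  exact (ContDiff.fderiv_right (m := (⊤ : ℕ∞)) hf (by simp)).clm_apply contDiff_const

lemma IsSmooth.sub {f g : Torus d → ℂ} (hf : IsSmooth f) (hg : IsSmooth g) :
    IsSmooth fun x => f x - g x := ContDiff.sub hf hg

lemma mFourierCoeff_eq_integral_torusMeasure (f : Torus d → ℂ) (k : Fin d → ℤ) :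
    UnitAddTorus.mFourierCoeff f k =
      ∫ x, UnitAddTorus.mFourier (-k) x * f x ∂torusMeasure d := rfl

instance : IsProbabilityMeasure (torusMeasure d) := by unfold torusMeasure; infer_instance

instance : (torusMeasure d).IsAddRightInvariant := by unfold torusMeasure; infer_instance

lemma exists_norm_le {f : Torus d → ℂ} (hf : Continuous f) : ∃ c : ℝ, ∀ x, ‖f x‖ ≤ c := by
  obtain ⟨c, hc⟩ := (isCompact_range hf).isBounded.exists_norm_le
  exact ⟨c, fun x => hc _ (Set.mem_range_self x)⟩

lemma integrable_mFourier_mul (k : Fin d → ℤ) {f : Torus d → ℂ} (hf : Continuous f) :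
    Integrable (fun x => UnitAddTorus.mFourier k x * f x) (torusMeasure d) :=
  ((UnitAddTorus.mFourier k).continuous.mul hf).integrable_of_hasCompactSupport
    (HasCompactSupport.of_compactSpace _)

lemma norm_mFourierCoeff_le {f : Torus d → ℂ} {c : ℝ} (hf : ∀ x, ‖f x‖ ≤ c) (k : Fin d → ℤ) :
    ‖UnitAddTorus.mFourierCoeff f k‖ ≤ c := by
  rw [mFourierCoeff_eq_integral_torusMeasure]
  refine (norm_integral_le_of_norm_le_const (C := c)
    (Filter.Eventually.of_forall fun x => ?_)).trans (by simp)
  rw [norm_mul, norm_mFourier_apply, one_mul]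
  exact hf x

lemma mFourierCoeff_translate (f : Torus d → ℂ) (k : Fin d → ℤ) (v : Fin d → ℝ) :
    UnitAddTorus.mFourierCoeff (fun x => f (x + toTorus v)) k =
      Complex.exp (Complex.I * (2 * Real.pi * ∑ i, k i * v i : ℝ)) *
        UnitAddTorus.mFourierCoeff f k := by
  rw [mFourierCoeff_eq_integral_torusMeasure, mFourierCoeff_eq_integral_torusMeasure,
    ← integral_add_right_eq_self (μ := torusMeasure d)
      (fun x => UnitAddTorus.mFourier (-k) x * f x) (toTorus v), ← integral_const_mul]
  refine integral_congr_ae (Filter.Eventually.of_forall fun x => ?_)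
  beta_reduce
  rw [mFourier_add_toTorus, mul_comm (UnitAddTorus.mFourier (-k) x) (Complex.exp _), ← mul_assoc,
    ← mul_assoc, ← Complex.exp_add]
  have : Complex.I * ((2 * Real.pi * ∑ i, k i * v i : ℝ) : ℂ) +
      Complex.I * ((2 * Real.pi * ∑ i, ((-k) i : ℤ) * v i : ℝ) : ℂ) = 0 := by
    rw [← mul_add, ← Complex.ofReal_add, ← mul_add, ← Finset.sum_add_distrib]
    simp
  rw [this, Complex.exp_zero, one_mul]

/-- Translation invariance of the measure turns a shift of f into a phase on its coefficient;
differentiating at zero shift replaces integration by parts. -/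
lemma IsSmooth.mFourierCoeff_partialDeriv {f : Torus d → ℂ} (hf : IsSmooth f) (j : Fin d)
    (k : Fin d → ℤ) : UnitAddTorus.mFourierCoeff (MeanField.partialDeriv j f) k =
      Complex.I * (2 * Real.pi * k j) * UnitAddTorus.mFourierCoeff f k := by
  have hc := (hf.partialDeriv j).continuous
  obtain ⟨c, hc'⟩ := exists_norm_le hc
  have hcont : ∀ h : ℝ, Continuous fun x => f (x + toTorus (Pi.single j h)) := fun h =>
    hf.continuous.comp (continuous_add_const _)
  have h1 := (hasDerivAt_integral_of_dominated_loc_of_deriv_le (μ := torusMeasure d)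
    (F := fun (h : ℝ) x => UnitAddTorus.mFourier (-k) x * f (x + toTorus (Pi.single j h)))
    (F' := fun (h : ℝ) x => UnitAddTorus.mFourier (-k) x *
      MeanField.partialDeriv j f (x + toTorus (Pi.single j h)))
    (x₀ := 0) (s := Set.univ) (bound := fun _ => c) Filter.univ_mem
    (Filter.Eventually.of_forall fun h =>
      (integrable_mFourier_mul _ (hcont h)).aestronglyMeasurable)
    (integrable_mFourier_mul _ (hcont 0))
    (integrable_mFourier_mul _ (hc.comp (continuous_add_const _))).aestronglyMeasurable
    (Filter.Eventually.of_forall fun x h _ => by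
      rw [norm_mul, norm_mFourier_apply, one_mul]; exact hc' _)
    (integrable_const c)
    (Filter.Eventually.of_forall fun x h _ => (hf.hasDerivAt j x h).const_mul _)).2
  have h2 : (fun h : ℝ => ∫ x, UnitAddTorus.mFourier (-k) x * f (x + toTorus (Pi.single j h))
      ∂torusMeasure d) = fun h : ℝ => Complex.exp (Complex.I * (2 * Real.pi * k j) * h) *
        UnitAddTorus.mFourierCoeff f k := by
    funext h
    rw [← mFourierCoeff_eq_integral_torusMeasure, mFourierCoeff_translate]
    congr 2
    rw [Finset.sum_eq_single j (fun i _ hi => by simp [Pi.single_eq_of_ne hi]) (by simp)]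
    simp
    ring
  have h3 : HasDerivAt (fun h : ℝ => Complex.exp (Complex.I * (2 * Real.pi * k j) * h) *
      UnitAddTorus.mFourierCoeff f k)
      (Complex.I * (2 * Real.pi * k j) * UnitAddTorus.mFourierCoeff f k) 0 := by
    have h4 := (((hasDerivAt_id (0 : ℝ)).ofReal_comp.const_mul
      (Complex.I * (2 * Real.pi * k j))).cexp).mul_const (UnitAddTorus.mFourierCoeff f k)
    simpa using h4
  have h5 : toTorus (0 : Fin d → ℝ) = 0 := rfl
  rw [h2] at h1
  simp only [Pi.single_zero, h5, add_zero] at h1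
  exact h1.unique h3

/-- The Fourier coefficients of smooth functions decay rapidly in any set of coordinates. -/
lemma IsSmooth.exists_mFourierCoeff_eq {f : Torus d → ℂ} (hf : IsSmooth f) (s : Finset (Fin d)) :
    ∃ g : Torus d → ℂ, IsSmooth g ∧ ∀ k, UnitAddTorus.mFourierCoeff g k =
      (∏ j ∈ s, (1 + (2 * Real.pi * k j : ℂ) ^ 2)) * UnitAddTorus.mFourierCoeff f k := by
  induction s using Finset.induction_on with
  | empty => exact ⟨f, hf, by simp⟩
  | insert j s hj ih =>
    obtain ⟨g, hg, h⟩ := ih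
    have hgg := (hg.partialDeriv j).partialDeriv j
    -- The operator 1 - ∂_j² has symbol 1 + (2πk_j)². Applied in every coordinate, it makes the
    -- coefficients summable without isotropic norms.
    refine ⟨_, hg.sub hgg, fun k => ?_⟩
    have h1 : UnitAddTorus.mFourierCoeff (fun x => g x -
        MeanField.partialDeriv j (MeanField.partialDeriv j g) x) k =
        UnitAddTorus.mFourierCoeff g k - UnitAddTorus.mFourierCoeff
          (MeanField.partialDeriv j (MeanField.partialDeriv j g)) k := by
      simp only [mFourierCoeff_eq_integral_torusMeasure, mul_sub]
      exact integral_sub (integrable_mFourier_mul _ hg.continuous)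
        (integrable_mFourier_mul _ hgg.continuous)
    rw [h1, (hg.partialDeriv j).mFourierCoeff_partialDeriv, hg.mFourierCoeff_partialDeriv, h,
      Finset.prod_insert hj]
    linear_combination (-(2 * Real.pi * k j) ^ 2 *
      ((∏ j ∈ s, (1 + (2 * Real.pi * k j : ℂ) ^ 2)) * UnitAddTorus.mFourierCoeff f k)) *
      Complex.I_sq

lemma summable_pi_prod {w : ℤ → ℝ} (hw : Summable w) (hw0 : ∀ n, 0 ≤ w n) (d : ℕ) :
    Summable fun k : Fin d → ℤ => ∏ j, w (k j) := by
  induction d with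
  | zero => exact (hasSum_fintype _).summable
  | succ d ih =>
    rw [← (Fin.consEquiv fun _ : Fin (d + 1) => ℤ).summable_iff]
    refine (Summable.mul_of_nonneg hw ih hw0 fun k => Finset.prod_nonneg fun j _ => hw0 _).congr
      fun p => ?_
    simp [Fin.consEquiv, Fin.prod_univ_succ]

lemma summable_inv_one_add_sq : Summable fun n : ℤ => (1 + (2 * Real.pi * n) ^ 2)⁻¹ := by
  have h1 : Summable fun n : ℤ => 1 / (n : ℝ) ^ 2 := Real.summable_one_div_int_pow.2 one_lt_two
  refine (h1.add (hasSum_ite_eq (0 : ℤ) (1 : ℝ)).summable).of_nonneg_of_le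
    (fun n => by positivity) fun n => ?_
  rcases eq_or_ne n 0 with rfl | hn
  · simp
  · simp only [hn, if_false, add_zero, one_div]
    have hn' : (0 : ℝ) < (n : ℝ) ^ 2 := by positivity
    refine inv_anti₀ hn' ?_
    have hpi := Real.pi_gt_three
    have h2 : 1 ≤ (2 * Real.pi) ^ 2 := one_le_pow₀ (by linarith)
    rw [mul_pow]
    nlinarith [mul_le_mul_of_nonneg_right h2 hn'.le]

lemma IsSmooth.summable_mFourierCoeff {f : Torus d → ℂ} (hf : IsSmooth f) :
    Summable fun k => ‖UnitAddTorus.mFourierCoeff f k‖ := by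
  obtain ⟨g, hg, h⟩ := hf.exists_mFourierCoeff_eq Finset.univ
  obtain ⟨c, hc⟩ := exists_norm_le hg.continuous
  refine ((summable_pi_prod summable_inv_one_add_sq (fun n => by positivity) d).mul_left
    c).of_nonneg_of_le (fun k => norm_nonneg _) fun k => ?_
  have h1 := norm_mFourierCoeff_le hc k
  have h2 : (∏ j, (1 + (2 * Real.pi * k j : ℂ) ^ 2)) =
      ((∏ j, (1 + (2 * Real.pi * k j) ^ 2) : ℝ) : ℂ) := by push_cast; rfl
  have h3 : 0 < ∏ j, (1 + (2 * Real.pi * (k j : ℝ)) ^ 2) :=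
    Finset.prod_pos fun j _ => by positivity
  rw [h, h2, norm_mul, Complex.norm_real, Real.norm_of_nonneg h3.le] at h1
  rw [Finset.prod_inv_distrib, ← div_eq_mul_inv, le_div_iff₀ h3, mul_comm]
  exact h1

lemma IsSmooth.hasSum_mFourier {f : Torus d → ℂ} (hf : IsSmooth f) (x : Torus d) :
    HasSum (fun k => UnitAddTorus.mFourierCoeff f k * UnitAddTorus.mFourier k x) (f x) :=
  UnitAddTorus.hasSum_mFourier_series_apply_of_summable (f := ⟨f, hf.continuous⟩)
    hf.summable_mFourierCoeff.of_norm x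

end Smooth

/-! ### Cumulants of linear statistics of the particle system -/

section LinearStatistic

variable {d N : ℕ}

lemma integral_empiricalMeasure (φ : Torus d → ℝ) (x : Fin N → Torus d) :
    ∫ y, φ y ∂(empiricalMeasure x) = (N : ℝ)⁻¹ * ∑ i, φ (x i) := by
  rw [empiricalMeasure, integral_smul_measure, integral_finsetSum_measure fun i _ =>
    integrable_dirac (by simp)]
  simp

variable {Ω : Type*} {mΩ : MeasurableSpace Ω} {P : Measure Ω} [IsProbabilityMeasure P]

/-- The cumulants of a bounded random variable as formal cumulants of its moments. -/
lemma cumulant_eq_kap {Y : Ω → ℝ} (hY : Measurable Y) {c : ℝ} (hc : ∀ ω, |Y ω| ≤ c)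
    (s : Multiset Unit) : cumulant P Y s.card = (-Complex.I) ^ s.card *
      kap (fun s : Multiset Unit => ∫ ω, (Complex.I * Y ω) ^ s.card ∂P) s := by
  have : IsProbabilityMeasure (P.map Y) := Measure.isProbabilityMeasure_map hY.aemeasurable
  have hmem : ∀ n : ℕ, MemLp id n (P.map Y) := fun n => by
    refine (memLp_map_measure_iff aestronglyMeasurable_id hY.aemeasurable).2 ?_
    exact MemLp.of_bound hY.aestronglyMeasurable c (Filter.Eventually.of_forall hc)
  have hF : ContDiff ℝ (⊤ : ℕ∞) (charFun (P.map Y)) := contDiff_charFun' hmem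
  have h1 : jet (charFun (P.map Y)) 0 = fun s : Multiset Unit =>
      ∫ ω, (Complex.I * Y ω) ^ s.card ∂P := by
    funext s
    rw [jet, iteratedDeriv_charFun_zero (hmem _), integral_map hY.aemeasurable
      (by fun_prop), ← integral_complex_ofReal, ← integral_const_mul]
    refine integral_congr_ae (Filter.Eventually.of_forall fun ω => ?_)
    beta_reduce
    rw [mul_pow, Complex.ofReal_pow]
  rw [cumulant, ← h1, ← jet_log hF (by simp)]
  rfl

variable {X : Ω → Fin N → Torus d}

/-- The variable iY is the combination of one-particle exponentials with coefficients iφ̂(k)/N. The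
factor i makes its moments the derivatives of the characteristic function at 0. -/
lemma norm_cumulant_le (hX : Measurable X) (hN : 0 < N) {n : ℕ}
    (h : LabelBound (n + 1) (2 ^ n * n.factorial) (kap (mom fun l => ∫ ω, expo l (X ω) ∂P)))
    {φ : Torus d → ℝ} (hφ : IsSmoothOnTorus φ) :
    ‖cumulant P (fun ω => ∫ x, φ x ∂(empiricalMeasure (X ω))) (n + 1)‖ ≤
      (8 * fourierL1Norm φ) ^ (n + 1) * ((n + 1).factorial : ℝ) ^ 4 / (N : ℝ) ^ n := by
  set a : (Fin d → ℤ) → ℂ := fun k =>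
    Complex.I * UnitAddTorus.mFourierCoeff (fun x : Torus d => (φ x : ℂ)) k with ha
  have hnorm : ∀ k, ‖a k‖ = ‖UnitAddTorus.mFourierCoeff (fun x : Torus d => (φ x : ℂ)) k‖ :=
    fun k => by simp [ha]
  have hsum : Summable fun k => ‖a k‖ := by
    simpa only [hnorm] using hφ.isSmooth.summable_mFourierCoeff
  have hA : fourierL1Norm φ = ∑' k, ‖a k‖ := by simp only [hnorm]; rfl
  have hφc : Continuous φ :=
    isOpenQuotientMap_toTorus.isQuotientMap.continuous_iff.2 (ContDiff.continuous hφ)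
  obtain ⟨c, hc⟩ := exists_norm_le hφ.isSmooth.continuous
  set Y : Ω → ℝ := fun ω => ∫ x, φ x ∂(empiricalMeasure (X ω)) with hYdef
  have hYe : ∀ ω, Y ω = (N : ℝ)⁻¹ * ∑ i, φ (X ω i) := fun ω => integral_empiricalMeasure φ (X ω)
  have hYm : Measurable Y := by
    simp only [hYdef, integral_empiricalMeasure]
    refine Measurable.const_mul (Finset.measurable_sum _ fun i _ => ?_) _
    exact hφc.measurable.comp ((measurable_pi_apply i).comp hX)
  have hN' : (0 : ℝ) < N := by exact_mod_cast hN
  have hYb : ∀ ω, |Y ω| ≤ c := by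
    intro ω
    rw [hYe, abs_mul, abs_of_pos (inv_pos.2 hN'), inv_mul_le_iff₀ hN']
    refine (Finset.abs_sum_le_sum_abs _ _).trans ?_
    refine (Finset.sum_le_sum (g := fun _ => c) fun i _ => by simpa using hc (X ω i)).trans ?_
    simp
  set μ : Multiset (Freq N d) → ℂ := mom fun l => ∫ ω, expo l (X ω) ∂P with hμ
  have hμ0 : μ 0 = 1 := by simp [hμ, mom, expo_zero]
  have hμ1 : ∀ s, ‖μ s‖ ≤ 1 := fun s =>
    (norm_integral_le_of_norm_le_const (C := 1) (Filter.Eventually.of_forall fun ω =>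
      (norm_expo _ _).le)).trans (by simp)
  have hYs : ∀ ω, HasSum (fun b : Fin N × (Fin d → ℤ) => a b.2 / N * expo (siteFreq b) (X ω))
      (Complex.I * Y ω) := by
    intro ω
    have h1 : Summable fun b : Fin N × (Fin d → ℤ) => a b.2 / N * expo (siteFreq b) (X ω) :=
      Summable.of_norm_bounded (summable_weight hsum) fun b => by rw [norm_mul, norm_expo, mul_one]
    have h2 : ∀ i, HasSum (fun k => a k / N * expo (siteFreq (i, k)) (X ω))
        (Complex.I / N * φ (X ω i)) := by
      intro i
      refine ((hφ.isSmooth.hasSum_mFourier (X ω i)).mul_left (Complex.I / N)).congr_fun fun k => ?_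
      rw [siteFreq, expo_single]
      ring
    have h3 := (h1.hasSum.prod_fiberwise h2).unique (hasSum_fintype _)
    convert h1.hasSum using 1
    rw [h3, hYe]
    push_cast
    rw [← Finset.mul_sum]
    ring
  have hmoment : ∀ n, contract (fun b : Fin N × (Fin d → ℤ) => a b.2 / N) siteFreq n μ =
      ∫ ω, (Complex.I * Y ω) ^ n ∂P := by
    intro n
    have := contract_moment (P := P) (l := siteFreq) (summable_weight (N := N) hsum)
      (e := fun l ω => expo l (X ω)) (fun l => (continuous_expo l).measurable.comp hX)
      (fun l ω => norm_expo l _) (fun l l' ω => expo_add l l' _) (fun ω => expo_zero _)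
      (Y := fun ω => Complex.I * Y ω) (by fun_prop) hYs n (H := fun _ => 1) measurable_const
      (by simp)
    simp only [one_mul] at this
    exact this
  have key := cumulant_eq_kap (P := P) hYm hYb (Multiset.replicate (n + 1) ())
  have hcon := contract_kap (l := siteFreq) (summable_weight (N := N) hsum) hμ0 hμ1
    (Multiset.replicate (n + 1) ())
  simp only [hmoment] at hcon
  rw [← hcon, Multiset.card_replicate] at key
  rw [key, norm_mul, norm_pow, norm_neg, Complex.norm_I, one_pow, one_mul, hA]
  exact norm_contract_kap_le hsum hN h

end LinearStatistic

end MeanField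

theorem mainTheorem6 (d : ℕ)
    (K : MeanField.Torus d → MeanField.Torus d → EuclideanSpace ℝ (Fin d))
    (hK : Continuous fun p : MeanField.Torus d × MeanField.Torus d => K p.1 p.2)
    (hKsum : Summable fun p : (Fin d → ℤ) × (Fin d → ℤ) =>
      ‖MeanField.kernelFourierCoeff K p.1 p.2‖) :
    ∃ C : ℝ, 0 ≤ C ∧ ∀ σ : ℝ, C < σ →
      ∀ ρ₀ : MeanField.Torus d → ℝ,
        MemLp ρ₀ 2 (MeanField.torusMeasure d) →
        (∀ᵐ x ∂(MeanField.torusMeasure d), 0 ≤ ρ₀ x) →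
        ∫ x, ρ₀ x ∂(MeanField.torusMeasure d) = 1 →
      ∀ N : ℕ, 1 ≤ N →
      ∀ (Ω : Type*) (mΩ : MeasurableSpace Ω) (P : Measure Ω) (_ : IsProbabilityMeasure P)
        (ℱ : Filtration ℝ≥0 mΩ)
        (W : ℝ≥0 → Ω → Fin N → EuclideanSpace ℝ (Fin d))
        (X : ℝ≥0 → Ω → Fin N → MeanField.Torus d),
        MeanField.IsParticleSystem K σ ρ₀ P ℱ W X →
      ∀ φ : MeanField.Torus d → ℝ, MeanField.IsSmoothOnTorus φ →
      ∀ (t : ℝ≥0) (m : ℕ), 1 ≤ m →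
        ‖MeanField.cumulant P
            (fun ω => ∫ x, φ x ∂(MeanField.empiricalMeasure (X t ω))) m‖ ≤
          (8 * MeanField.fourierL1Norm φ) ^ m * (m.factorial : ℝ) ^ 4 / (N : ℝ) ^ (m - 1) := by
  -- The threshold at which half of the diffusion dominates the interaction, see
  -- `IsParticleSystem.labelBound`.
  refine ⟨2 * ∑' p : (Fin d → ℤ) × (Fin d → ℤ), ‖MeanField.kernelFourierCoeff K p.1 p.2‖,
    mul_nonneg zero_le_two (tsum_nonneg fun _ => norm_nonneg _), ?_⟩
  intro σ hσ ρ₀ _ _ _ N hN Ω mΩ P _ ℱ W X hX φ hφ t m hm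
  obtain ⟨n, rfl⟩ : ∃ n, m = n + 1 := ⟨m - 1, by omega⟩
  have h := hX.labelBound hK hKsum hσ.le hN n t.2
  have ht : (t : ℝ).toNNReal = t := Real.toNNReal_coe
  refine MeanField.norm_cumulant_le (hX.measurable t) hN ?_ hφ
  rw [← ht]
  exact h
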